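/- Let $n,k,l$ be integers with $0\le l<k<n/2$, let $0<\alpha<1$, and let $(M,g_0)$ be a compact, locally conformally flat smooth Riemannian manifold of dimension $n$ without boundary (for instance an oriented one; neither orientability nor connectedness is required). For a metric $g$ let $S_g=\frac1{n-2}\bigl(\mathrm{Ric}_g-\frac{R_g}{2(n-1)}g\bigr)$ be its Schouten tensor and $\sigma_j(g)$ the $j$-th elementary symmetric function of the eigenvalues of $g^{-1}S_g$ ($\sigma_0=1$). Let $\mathcal C_k([g_0])$ be the set of metrics $g=e^{-2u}g_0$ with $u\in C^{4,\alpha}(M)$ such that $\sigma_j(g)>0$ on $M$ for all $1\le j\le k$, and put $$Y_{k,l}(M,[g_0])=\inf_{g\in\mathcal C_k([g_0])}\Bigl(\int_M\sigma_l(g)\,dg\Bigr)^{-\frac{n-2k}{n-2l}}\int_M\sigma_k(g)\,dg .$$ Assume that $\mathcal C_k([g_0])$ is non-empty. Then $$Y_{k,l}(M,[g_0])\le Y_{k,l}(\mathbb S^n,[g_{\mathbb S^n}]),$$ where $g_{\mathbb S^n}$ is the standard metric of the unit sphere $\mathbb S^n\subset\mathbb R^{n+1}$. -/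

import Mathlib

open scoped Manifold ContDiff Topology NNReal ENNReal

noncomputable section

namespace SchoutenGeom

/-! ### Elementary symmetric functions of a matrix -/

/-- The `j`-th elementary symmetric function of the eigenvalues of a real `n × n` matrix, read off
from the characteristic polynomial `∑ j, (-1) ^ j * σ_j * X ^ (n - j)`; it is `0` for `j > n`. -/
def sigma {n : ℕ} (j : ℕ) (A : Matrix (Fin n) (Fin n) ℝ) : ℝ :=
  if j ≤ n then (-1) ^ j * A.charpoly.coeff (n - j) else 0

theorem sigma_zero {n : ℕ} (A : Matrix (Fin n) (Fin n) ℝ) : sigma 0 A = 1 := by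
  have h := A.charpoly_monic
  rw [Polynomial.Monic, Polynomial.leadingCoeff, A.charpoly_natDegree_eq_dim, Fintype.card_fin] at h
  simp [sigma, h]

/-- When all eigenvalues are real, `sigma j` is the elementary symmetric function of them. -/
theorem sigma_eq_esymm {n : ℕ} (j : ℕ) (A : Matrix (Fin n) (Fin n) ℝ) (h : A.charpoly.Splits) :
    sigma j A = A.charpoly.roots.esymm j := by
  have hd : A.charpoly.natDegree = n := by simp
  unfold sigma
  split_ifs with hj
  · rw [Polynomial.coeff_eq_esymm_roots_of_splits h (by omega), A.charpoly_monic.leadingCoeff, hd,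
      Nat.sub_sub_self hj, one_mul, ← mul_assoc, ← mul_pow]
    simp
  · have hc : Multiset.card A.charpoly.roots = n := by
      exact (Polynomial.splits_iff_card_roots.1 h).trans hd
    rw [Multiset.esymm, Multiset.powersetCard_eq_empty j (by omega)]
    simp

/-! ### Curvature of a metric in coordinates

`G y` is the matrix `(g_ij(y))` of a Riemannian metric in coordinates on an open subset of `ℝⁿ`. -/

/-- The partial derivative `∂_i f (y)`. -/
def pd {n : ℕ} (i : Fin n) (f : EuclideanSpace ℝ (Fin n) → ℝ) (y : EuclideanSpace ℝ (Fin n)) : ℝ :=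
  fderiv ℝ f y (EuclideanSpace.single i 1)

/-- The Christoffel symbol `Γ^m_ij` of the Levi-Civita connection. -/
def christoffel {n : ℕ} (G : EuclideanSpace ℝ (Fin n) → Matrix (Fin n) (Fin n) ℝ)
    (m i j : Fin n) (y : EuclideanSpace ℝ (Fin n)) : ℝ :=
  (1 / 2) * ∑ p, (G y)⁻¹ m p *
    (pd i (fun z => G z j p) y + pd j (fun z => G z i p) y - pd p (fun z => G z i j) y)

/-- The Ricci tensor
`Ric_ij = ∂_m Γ^m_ij - ∂_j Γ^m_im + Γ^m_mp Γ^p_ij - Γ^m_jp Γ^p_im` (summed over `m`, `p`). -/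
def ricci {n : ℕ} (G : EuclideanSpace ℝ (Fin n) → Matrix (Fin n) (Fin n) ℝ)
    (y : EuclideanSpace ℝ (Fin n)) : Matrix (Fin n) (Fin n) ℝ :=
  Matrix.of fun i j =>
    ∑ m, (pd m (christoffel G m i j) y - pd j (christoffel G m i m) y) +
    ∑ m, ∑ p, (christoffel G m m p y * christoffel G p i j y -
      christoffel G m j p y * christoffel G p i m y)

/-- The scalar curvature `g^{ij} Ric_ij`. -/
def scalarCurv {n : ℕ} (G : EuclideanSpace ℝ (Fin n) → Matrix (Fin n) (Fin n) ℝ)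
    (y : EuclideanSpace ℝ (Fin n)) : ℝ :=
  ∑ i, ∑ j, (G y)⁻¹ i j * ricci G y i j

/-- The Schouten tensor `S = (Ric - R / (2 (n - 1)) g) / (n - 2)`. -/
def schouten {n : ℕ} (G : EuclideanSpace ℝ (Fin n) → Matrix (Fin n) (Fin n) ℝ)
    (y : EuclideanSpace ℝ (Fin n)) : Matrix (Fin n) (Fin n) ℝ :=
  (1 / ((n : ℝ) - 2)) • (ricci G y - (scalarCurv G y / (2 * ((n : ℝ) - 1))) • G y)

/-! ### Metrics on a manifold -/

section Manifold

variable {n : ℕ} {M : Type*} [TopologicalSpace M] [ChartedSpace (EuclideanSpace ℝ (Fin n)) M]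

variable (n M) in
/-- A field of bilinear forms on the tangent spaces of `M`, with no regularity imposed. -/
abbrev FormField : Type _ :=
  ∀ x : M, TangentSpace (𝓡 n) x →L[ℝ] TangentSpace (𝓡 n) x →L[ℝ] ℝ

variable (n M) in
/-- Smooth Riemannian metrics on `M`. -/
abbrev SmoothMetric [IsManifold (𝓡 n) ∞ M] : Type _ :=
  Bundle.ContMDiffRiemannianMetric (𝓡 n) ∞ (EuclideanSpace ℝ (Fin n))
    (fun x : M => TangentSpace (𝓡 n) x)

/-- The coordinate vector field `∂_i` of the chart `e`, at the point with coordinates `y`. -/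
def coordVec (e : OpenPartialHomeomorph M (EuclideanSpace ℝ (Fin n)))
    (y : EuclideanSpace ℝ (Fin n)) (i : Fin n) : TangentSpace (𝓡 n) (e.symm y) :=
  mfderiv (𝓡 n) (𝓡 n) e.symm y
    (EuclideanSpace.single i (1 : ℝ) : EuclideanSpace ℝ (Fin n))

/-- The matrix `g_ij = g(∂_i, ∂_j)` in the chart `e`, as a function of the coordinates. -/
def gram (g : FormField n M) (e : OpenPartialHomeomorph M (EuclideanSpace ℝ (Fin n)))
    (y : EuclideanSpace ℝ (Fin n)) : Matrix (Fin n) (Fin n) ℝ :=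
  Matrix.of fun i j => g (e.symm y) (coordVec e y i) (coordVec e y j)

/-- The `σ_j`-scalar curvature `σ_j(g⁻¹ S_g)` at `x`, computed in the preferred chart at `x`. -/
def sigmaCurv (j : ℕ) (g : FormField n M) (x : M) : ℝ :=
  let e := chartAt (EuclideanSpace ℝ (Fin n)) x
  sigma j ((gram g e (e x))⁻¹ * schouten (gram g e) (e x))

/-- `g ∈ Γ_k^+`: at every point, `σ_j(g⁻¹ S_g) > 0` for all `1 ≤ j ≤ k`. -/
def IsAdmissible (k : ℕ) (g : FormField n M) : Prop :=
  ∀ x : M, ∀ j : ℕ, 1 ≤ j → j ≤ k → 0 < sigmaCurv j g x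

/-- `u` is of class `C^{4,α}`: in every chart of the atlas it is `C⁴`, with fourth derivative
locally Hölder continuous with exponent `α`. -/
def IsC4Holder (α : ℝ≥0) (u : M → ℝ) : Prop :=
  ∀ e ∈ atlas (EuclideanSpace ℝ (Fin n)) M,
    ContDiffOn ℝ 4 (u ∘ e.symm) e.target ∧
    ∀ y ∈ e.target, ∃ s ∈ 𝓝 y, ∃ C : ℝ≥0,
      HolderOnWith C α (iteratedFDeriv ℝ 4 (u ∘ e.symm)) s

/-- The conformal metric `e^{-2u} g`. -/
def conformalChange (u : M → ℝ) (g : FormField n M) : FormField n M :=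
  fun x => Real.exp (-2 * u x) • g x

/-- `C_k([g₀])`: the `C^{4,α}` metrics conformal to `g₀` that lie in `Γ_k^+`. -/
def admissibleClass (α : ℝ≥0) (k : ℕ) (g₀ : FormField n M) : Set (FormField n M) :=
  {g | (∃ u : M → ℝ, IsC4Holder (n := n) α u ∧ g = conformalChange u g₀) ∧ IsAdmissible k g}

/-- `g` is locally conformally flat: around every point there are smooth coordinates in which
`g = e^{-2w} |dx|²`. -/
def IsLocallyConformallyFlat (g : FormField n M) : Prop :=
  ∀ p : M, ∃ e ∈ IsManifold.maximalAtlas (𝓡 n) ∞ M, p ∈ e.source ∧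
    ∃ w : EuclideanSpace ℝ (Fin n) → ℝ, ∀ y ∈ e.target, gram g e y = Real.exp (-2 * w y) • 1

/-! ### Integration -/

section Volume

variable [CompactSpace M] [T2Space M]

variable (n M) in
theorem exists_chartPartition :
    ∃ ρ : PartitionOfUnity M M,
      ρ.IsSubordinate fun x => (chartAt (EuclideanSpace ℝ (Fin n)) x).source :=
  PartitionOfUnity.exists_isSubordinate isClosed_univ _
    (fun x => (chartAt (EuclideanSpace ℝ (Fin n)) x).open_source)
    (fun x _ => Set.mem_iUnion.2 ⟨x, mem_chart_source _ x⟩)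

variable (n M) in
/-- A partition of unity subordinate to the preferred charts. -/
def chartPartition : PartitionOfUnity M M := (exists_chartPartition n M).choose

variable (n M) in
theorem chartPartition_isSubordinate :
    (chartPartition n M).IsSubordinate fun x => (chartAt (EuclideanSpace ℝ (Fin n)) x).source :=
  (exists_chartPartition n M).choose_spec

/-- The Riemannian volume measure `dg`, that is, the sum over `i` of the measures
`ρ_i √(det g) dx` on the chart domains, for a partition of unity `ρ`. -/
def volumeMeasure [MeasurableSpace M] (g : FormField n M) : MeasureTheory.Measure M :=
  MeasureTheory.Measure.sum fun i : M =>
    let e := chartAt (EuclideanSpace ℝ (Fin n)) i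
    (((MeasureTheory.volume : MeasureTheory.Measure (EuclideanSpace ℝ (Fin n))).restrict
      e.target).withDensity fun y =>
        ENNReal.ofReal (chartPartition n M i (e.symm y) * √((gram g e y).det))).map e.symm

/-- The total `σ_j`-curvature `∫_M σ_j(g) dg`. -/
def totalSigma [MeasurableSpace M] (j : ℕ) (g : FormField n M) : ℝ :=
  ∫ x, sigmaCurv j g x ∂(volumeMeasure g)

/-- `Y_{k,l}(M, [g₀])`, the infimum over `g ∈ C_k([g₀])` of
`(∫ σ_l(g) dg)^{-(n-2k)/(n-2l)} ∫ σ_k(g) dg`; the infimum over the empty set is `+∞`. -/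
def yamabeConst [MeasurableSpace M] (α : ℝ≥0) (k l : ℕ) (g₀ : FormField n M) : EReal :=
  ⨅ g ∈ admissibleClass α k g₀,
    (((totalSigma l g) ^ (-(((n : ℝ) - 2 * k) / ((n : ℝ) - 2 * l))) * totalSigma k g : ℝ) : EReal)

end Volume

end Manifold

/-- The standard metric on the unit sphere of `ℝⁿ⁺¹`, induced by the inclusion. -/
def roundMetric (n : ℕ) :
    FormField n (Metric.sphere (0 : EuclideanSpace ℝ (Fin (n + 1))) 1) :=
  fun x =>
    let ι : EuclideanSpace ℝ (Fin n) →L[ℝ] EuclideanSpace ℝ (Fin (n + 1)) :=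
      mfderiv (𝓡 n) (𝓡 (n + 1))
        (Subtype.val : Metric.sphere (0 : EuclideanSpace ℝ (Fin (n + 1))) 1 → _) x
    let b : EuclideanSpace ℝ (Fin n) →L[ℝ] EuclideanSpace ℝ (Fin n) →L[ℝ] ℝ :=
      (innerSL ℝ).bilinearComp ι ι
    b

theorem roundMetric_apply (n : ℕ) (x : Metric.sphere (0 : EuclideanSpace ℝ (Fin (n + 1))) 1)
    (v w : TangentSpace (𝓡 n) x) :
    roundMetric n x v w =
      @inner ℝ (EuclideanSpace ℝ (Fin (n + 1))) _
        (mfderiv (𝓡 n) (𝓡 (n + 1)) Subtype.val x v)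
        (mfderiv (𝓡 n) (𝓡 (n + 1)) Subtype.val x w) := rfl

end SchoutenGeom

end

open SchoutenGeom

/-!
The inequality is proved by gluing. Let `h` be an admissible metric in the conformal class of the
round sphere, and `g = e^{-2u} g₀` an admissible metric on `M`. In stereographic coordinates `h` is
`e^{-2v} |dy|²` with `v - 2 log (1 + |y|)` bounded and with derivatives of the matching decay, a
*bubble* (`IsBubble`, `exists_bubble_of_mem_admissibleClass`). In a conformally flat chart of `M`
centred at a point, `g` is `e^{-2U} |dx|²`, and the rescaled bubble `v_t(x) = v(x / t) + 2 log t` is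
glued into `U` by a soft minimum with cut-off,
`U_t = -κ⁻¹ log (e^{-κ U} + ε χ e^{-κ v_t})`.
The metrics so obtained on `M` are admissible for all scales `t ∈ (0, 1]`, and as `t → 0` their
quotients tend to the quotient of `h`, because the quotient is invariant under scaling
(`exists_test_metrics`, `tendsto_quotient`). So the infimum over `M` is at most the quotient of each
`h`.

**Admissibility.** The Schouten tensor of `e^{-2f} |dx|²` is
`S(f) = ∇²f + ∇f ⊗ ∇f - |∇f|² / 2` (`schouten_conformal`). For a soft minimum `f` of `f₁` and `f₂`,
with weights `a` and `1 - a`,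
`S(f) = a S(f₁) + (1 - a) S(f₂) + ½ a (1 - a) |d|² (1 - (2 + 2κ) θ θᵀ)`,
where `d = ∇f₁ - ∇f₂ = |d| θ` (`flatSchouten_softMin`). The Gårding cone `Γ_k` is a convex cone, and
`1 - c θ θᵀ ∈ Γ_k` if and only if `c k < n`; this is where `k < n / 2` enters, as it leaves room for
a `κ > 0` with `(2 + 2κ) k < n`. Hence `S(f) ∈ Γ_k` (`softMin_mem_coneGamma`). On the annulus where
`χ` is cut off, the bubbles `v_t` are bounded in `C²` uniformly in `t`, so there a small `ε`,
independent of `t`, keeps `S(U_t)` in `Γ_k` by openness (`GlueData.exists_glued_mem`). That `Γ_k` is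
closed under addition follows for vectors from the superadditivity of `e_{j+1} / e_j`, by induction
on `j` (`VecCone.add_aux`), and for matrices because the diagonal of a symmetric matrix is the image
of its eigenvalues under a doubly stochastic matrix (`add_mem_coneGamma`).

**The limit.** In the coordinates `y = x / t` and up to an additive constant, `U_t` converges to `v`
with its 2-jet, and the densities of the `σ_j`-integrals are dominated by a multiple of
`(1 + |y|)^{-2n+2j}`, which is integrable for `2j < n` (`GlueData.tendsto_integral`). The
contribution of the points of `M` outside the support of the cut-off does not depend on `t`, and is
scaled away.

**Passage to coordinates.** The curvature in the preferred charts is compared with that in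
conformally flat charts through the invariance of the Ricci tensor, proved by the gauge
transformation law of connection matrices (`sigma_schouten_pullback`, `sigmaCurv_eq_flatSigma`), and
the measure by the change of variables formula (`volumeMeasure_restrict_source`). The class
`C^{4,α}` is handled pointwise through `ContDiffHolderAt`.
-/

set_option linter.unusedSectionVars false

noncomputable section

namespace SchoutenGeom

/-! ### Elementary symmetric functions of a vector -/

section Vector

open Polynomial

variable {ι : Type*} [DecidableEq ι]

/-- The `j`-th elementary symmetric function of the numbers `x i`, `i ∈ s`. -/
def elemSym (s : Finset ι) (x : ι → ℝ) (j : ℕ) : ℝ :=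
  (∏ i ∈ s, (1 + C (x i) * X)).coeff j

theorem elemSym_zero (s : Finset ι) (x : ι → ℝ) : elemSym s x 0 = 1 := by
  simp [elemSym, coeff_zero_eq_eval_zero, eval_prod]

theorem elemSym_insert {s : Finset ι} {i : ι} (hi : i ∉ s) (x : ι → ℝ) (j : ℕ) :
    elemSym (insert i s) x (j + 1) = elemSym s x (j + 1) + x i * elemSym s x j := by
  simp only [elemSym, Finset.prod_insert hi, add_mul, one_mul, coeff_add, mul_assoc, coeff_C_mul,
    coeff_X_mul]

theorem elemSym_erase {s : Finset ι} {i : ι} (hi : i ∈ s) (x : ι → ℝ) (j : ℕ) :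
    elemSym s x (j + 1) = elemSym (s.erase i) x (j + 1) + x i * elemSym (s.erase i) x j := by
  conv_lhs => rw [← Finset.insert_erase hi]
  exact elemSym_insert (Finset.notMem_erase i s) x j

/-- Euler's identity `∑ xᵢ ∂ᵢ e_{j+1} = (j + 1) e_{j+1}`. -/
theorem sum_mul_elemSym_erase (s : Finset ι) (x : ι → ℝ) (j : ℕ) :
    ∑ i ∈ s, x i * elemSym (s.erase i) x j = (j + 1) * elemSym s x (j + 1) := by
  have h := congrArg (fun p : ℝ[X] => p.coeff j)
    (derivative_prod_finset (s := s) (f := fun i => 1 + C (x i) * X))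
  simp only [coeff_derivative, finsetSum_coeff] at h
  rw [mul_comm, elemSym, h]
  refine Finset.sum_congr rfl fun i _ => ?_
  rw [derivative_add, derivative_one, zero_add, derivative_C_mul, derivative_X, mul_one,
    coeff_mul_C, mul_comm]
  rfl

theorem elemSym_one (s : Finset ι) (x : ι → ℝ) : elemSym s x 1 = ∑ i ∈ s, x i := by
  have h := sum_mul_elemSym_erase s x 0
  simpa [elemSym_zero] using h.symm

/-- The derivative of a real-rooted polynomial is real-rooted. -/
theorem splits_derivative {p : ℝ[X]} (hp : p.Splits) : p.derivative.Splits := by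
  rw [splits_iff_card_roots] at *
  rcases Nat.eq_zero_or_pos p.natDegree with h | h
  · rw [eq_C_of_natDegree_eq_zero h]; simp
  · have h1 := card_roots_le_derivative p
    have h2 := card_roots' p.derivative
    have h3 := natDegree_derivative_lt (p := p) (by omega)
    omega

/-- Laguerre's inequality `p p'' ≤ p'^2` for real-rooted polynomials. -/
theorem laguerre_inequality {p : ℝ[X]} (hp : p.Splits) (t : ℝ) :
    p.eval t * p.derivative.derivative.eval t ≤ p.derivative.eval t ^ 2 := by
  have key : ∀ m : Multiset ℝ, ∀ c : ℝ,
      (C c * (m.map fun a => X - C a).prod).eval t *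
        (C c * (m.map fun a => X - C a).prod).derivative.derivative.eval t ≤
        (C c * (m.map fun a => X - C a).prod).derivative.eval t ^ 2 := by
    intro m c
    induction m using Multiset.induction_on with
    | empty => simp
    | cons a m ih =>
      set q := (C c * (m.map fun a => X - C a).prod) with hq
      have : C c * ((a ::ₘ m).map fun a => X - C a).prod = (X - C a) * q := by
        rw [Multiset.map_cons, Multiset.prod_cons, hq]; ring
      rw [this]
      simp only [derivative_mul, derivative_add, derivative_sub, derivative_X, derivative_C,
        eval_add, eval_mul, eval_sub, eval_X, eval_C, sub_zero, one_mul]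
      nlinarith [sq_nonneg (q.eval t), mul_le_mul_of_nonneg_left ih (sq_nonneg (t - a))]
  rw [hp.eq_prod_roots]
  exact key _ _

/-- Newton's inequality, in a non-sharp form. -/
theorem newton_inequality (s : Finset ι) (x : ι → ℝ) (m : ℕ) :
    elemSym s x m * elemSym s x (m + 2) ≤ elemSym s x (m + 1) ^ 2 := by
  set P : ℝ[X] := ∏ i ∈ s, (1 + C (x i) * X) with hP
  have hs : P.Splits := Splits.prod fun i _ => by
    have : (1 + C (x i) * X : ℝ[X]) = C (x i) * X + C 1 := by simp [add_comm]
    rw [this]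
    exact Splits.of_natDegree_le_one (natDegree_linear_le)
  have hsd : ∀ j : ℕ, (derivative^[j] P).Splits := by
    intro j
    induction j with
    | zero => exact hs
    | succ j ih => rw [Function.iterate_succ_apply']; exact splits_derivative ih
  have h := laguerre_inequality (hsd m) 0
  simp only [← Function.iterate_succ_apply' derivative] at h
  simp only [← coeff_zero_eq_eval_zero, coeff_iterate_derivative, zero_add,
    Nat.descFactorial_self, nsmul_eq_mul] at h
  change ((m.factorial : ℕ) : ℝ) * elemSym s x m *
    (((m+2).factorial : ℕ) * elemSym s x (m+2)) ≤ (((m+1).factorial : ℕ) * elemSym s x (m+1))^2 at h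
  have e1 : (((m+1).factorial : ℕ) : ℝ) = (m+1) * m.factorial := by
    rw [Nat.factorial_succ]; push_cast; ring
  have e2 : (((m+2).factorial : ℕ) : ℝ) = (m+2) * ((m+1) * m.factorial) := by
    rw [Nat.factorial_succ, Nat.factorial_succ]; push_cast; ring
  rw [e1, e2] at h
  have hf : (0:ℝ) < m.factorial := by exact_mod_cast m.factorial_pos
  have h' : (m + 2 : ℝ) * (elemSym s x m * elemSym s x (m + 2)) ≤
      (m + 1) * elemSym s x (m + 1) ^ 2 := by
    have hpos : (0:ℝ) < (m+1) * m.factorial ^ 2 := by positivity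
    refine le_of_mul_le_mul_left ?_ hpos
    nlinarith [h]
  by_contra! hc
  have hm : (0:ℝ) ≤ m := by positivity
  nlinarith [sq_nonneg (elemSym s x (m+1))]

/-- The vector Gårding cone: `e_j(x) > 0` for all `j ≤ k`. -/
def VecCone (k : ℕ) (s : Finset ι) (x : ι → ℝ) : Prop :=
  ∀ j ≤ k, 0 < elemSym s x j

theorem VecCone.mono {k l : ℕ} {s : Finset ι} {x : ι → ℝ} (h : VecCone k s x) (hl : l ≤ k) :
    VecCone l s x := fun j hj => h j (hj.trans hl)

/-- Deleting an entry of a vector in `Γ_{k+1}` leaves a vector in `Γ_k`. -/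
theorem VecCone.erase {k : ℕ} {s : Finset ι} {x : ι → ℝ} (h : VecCone (k + 1) s x) {i : ι}
    (hi : i ∈ s) : VecCone k (s.erase i) x := by
  intro j
  induction j with
  | zero => intro _; simp [elemSym_zero]
  | succ j ih =>
    intro hj
    have h0 := ih (by omega)
    have h1 := h (j + 1) (by omega)
    have h2 := h (j + 2) (by omega)
    rw [elemSym_erase hi] at h1 h2
    have hN := newton_inequality (s.erase i) x j
    by_contra! hc
    set a := elemSym (s.erase i) x j
    set b := elemSym (s.erase i) x (j + 1)
    set c := elemSym (s.erase i) x (j + 2)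
    -- `x i > -b / a ≥ 0`, so `c > -x i * b ≥ b ^ 2 / a`, against Newton
    nlinarith [mul_pos h0 h2, mul_nonneg (neg_nonneg.2 hc) h1.le]

/-- The quotient `e_{k+1} / e_k`, through the vectors with one entry deleted. -/
theorem mul_elemSym_div (k : ℕ) (s : Finset ι) (x : ι → ℝ) (h1 : 0 < elemSym s x (k + 1))
    (h2 : ∀ i ∈ s, 0 < elemSym (s.erase i) x k) :
    (k + 2 : ℝ) * (elemSym s x (k + 2) / elemSym s x (k + 1)) =
      ∑ i ∈ s, x i - ∑ i ∈ s,
        x i ^ 2 / (x i + elemSym (s.erase i) x (k + 1) / elemSym (s.erase i) x k) := by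
  have h := sum_mul_elemSym_erase s x (k + 1)
  have e : (k + 2 : ℝ) * (elemSym s x (k + 2) / elemSym s x (k + 1)) =
      (∑ i ∈ s, x i * elemSym (s.erase i) x (k + 1)) / elemSym s x (k + 1) := by
    rw [h]; push_cast; ring
  rw [e, ← Finset.sum_sub_distrib, Finset.sum_div]
  refine Finset.sum_congr rfl fun i hi => ?_
  have h3 := elemSym_erase hi x k
  have h4 := h2 i hi
  have h5 : x i + elemSym (s.erase i) x (k + 1) / elemSym (s.erase i) x k =
      elemSym s x (k + 1) / elemSym (s.erase i) x k := by
    rw [h3]; field_simp; ring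
  rw [h5]
  field_simp
  rw [h3]; ring

/-- The vector Gårding cone is closed under addition, and `e_{k+1} / e_k` is superadditive on it
(Marcus–Lopes). -/
theorem VecCone.add_aux (k : ℕ) : ∀ (s : Finset ι) (x y : ι → ℝ), VecCone (k + 1) s x →
    VecCone (k + 1) s y → VecCone (k + 1) s (x + y) ∧
      elemSym s x (k + 1) / elemSym s x k + elemSym s y (k + 1) / elemSym s y k ≤
        elemSym s (x + y) (k + 1) / elemSym s (x + y) k := by
  induction k with
  | zero =>
    intro s x y hx hy
    have hs : elemSym s (x + y) 1 = elemSym s x 1 + elemSym s y 1 := by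
      simp [elemSym_one, Finset.sum_add_distrib]
    refine ⟨fun j hj => ?_, by simp [elemSym_zero, hs]⟩
    interval_cases j
    · simp [elemSym_zero]
    · rw [hs]; exact add_pos (hx 1 le_rfl) (hy 1 le_rfl)
  | succ k ih =>
    intro s x y hx hy
    have hz := (ih s x y (hx.mono (by omega)) (hy.mono (by omega))).1
    have hzi : ∀ i ∈ s, 0 < elemSym (s.erase i) (x + y) k := fun i hi =>
      (ih _ x y (hx.erase hi) (hy.erase hi)).1 k (by omega)
    have ex := mul_elemSym_div k s x (hx (k + 1) (by omega)) fun i hi => hx.erase hi k (by omega)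
    have ey := mul_elemSym_div k s y (hy (k + 1) (by omega)) fun i hi => hy.erase hi k (by omega)
    have ez := mul_elemSym_div k s (x + y) (hz (k + 1) (by omega)) hzi
    have hden : ∀ x : ι → ℝ, VecCone (k + 2) s x → ∀ i ∈ s,
        0 < x i + elemSym (s.erase i) x (k + 1) / elemSym (s.erase i) x k := by
      intro x hx i hi
      have h4 := hx.erase hi k (by omega)
      have h5 : x i + elemSym (s.erase i) x (k + 1) / elemSym (s.erase i) x k =
          elemSym s x (k + 1) / elemSym (s.erase i) x k := by
        rw [elemSym_erase hi x k]; field_simp; ring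
      rw [h5]
      exact div_pos (hx _ (by omega)) h4
    have hle : elemSym s x (k + 2) / elemSym s x (k + 1) +
        elemSym s y (k + 2) / elemSym s y (k + 1) ≤
          elemSym s (x + y) (k + 2) / elemSym s (x + y) (k + 1) := by
      have hk : (0:ℝ) < k + 2 := by positivity
      refine le_of_mul_le_mul_left ?_ hk
      rw [mul_add, ex, ey, ez]
      have : ∑ i ∈ s, (x + y) i ^ 2 / ((x + y) i +
          elemSym (s.erase i) (x + y) (k + 1) / elemSym (s.erase i) (x + y) k) ≤
          ∑ i ∈ s, x i ^ 2 / (x i + elemSym (s.erase i) x (k + 1) / elemSym (s.erase i) x k) +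
          ∑ i ∈ s, y i ^ 2 / (y i + elemSym (s.erase i) y (k + 1) / elemSym (s.erase i) y k) := by
        rw [← Finset.sum_add_distrib]
        refine Finset.sum_le_sum fun i hi => ?_
        have hA := hden x hx i hi
        have hB := hden y hy i hi
        have hq := (ih _ x y (hx.erase hi) (hy.erase hi)).2
        set A := x i + elemSym (s.erase i) x (k + 1) / elemSym (s.erase i) x k
        set B := y i + elemSym (s.erase i) y (k + 1) / elemSym (s.erase i) y k
        have hAB : A + B ≤ (x + y) i +
            elemSym (s.erase i) (x + y) (k + 1) / elemSym (s.erase i) (x + y) k := by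
          simp only [A, B, Pi.add_apply]; linarith
        calc _ ≤ (x i + y i) ^ 2 / (A + B) :=
              div_le_div_of_nonneg_left (sq_nonneg _) (by positivity) hAB
          _ ≤ _ := by
            rw [div_add_div _ _ hA.ne' hB.ne', div_le_div_iff₀ (by positivity) (by positivity)]
            nlinarith [sq_nonneg (x i * B - y i * A)]
      have h2 : ∑ i ∈ s, (x + y) i = ∑ i ∈ s, x i + ∑ i ∈ s, y i := by
        simp [Finset.sum_add_distrib]
      rw [h2]; linarith
    refine ⟨fun j hj => ?_, hle⟩
    rcases Nat.lt_or_ge j (k + 2) with hj' | hj'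
    · exact hz j (by omega)
    · obtain rfl : j = k + 2 := by omega
      have : 0 < elemSym s (x + y) (k + 2) / elemSym s (x + y) (k + 1) :=
        lt_of_lt_of_le (add_pos (div_pos (hx _ le_rfl) (hx _ (by omega)))
          (div_pos (hy _ le_rfl) (hy _ (by omega)))) hle
      exact (div_pos_iff_of_pos_right (hz _ (by omega))).1 this

theorem VecCone.add {k : ℕ} {s : Finset ι} {x y : ι → ℝ} (hx : VecCone k s x)
    (hy : VecCone k s y) : VecCone k s (x + y) := by
  cases k with
  | zero => intro j hj; obtain rfl : j = 0 := by omega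
            simp [elemSym_zero]
  | succ k => exact (VecCone.add_aux k s x y hx hy).1

theorem elemSym_smul (s : Finset ι) (x : ι → ℝ) (c : ℝ) (j : ℕ) :
    elemSym s (c • x) j = c ^ j * elemSym s x j := by
  have : ∏ i ∈ s, (1 + C ((c • x) i) * X) = (∏ i ∈ s, (1 + C (x i) * X)).comp (C c * X) := by
    rw [prod_comp]
    refine Finset.prod_congr rfl fun i _ => ?_
    simp only [Pi.smul_apply, smul_eq_mul, map_mul, add_comp, one_comp, mul_comp, C_comp, X_comp]
    ring
  rw [elemSym, this, comp_C_mul_X_coeff, mul_comm]; rfl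

theorem VecCone.smul {k : ℕ} {s : Finset ι} {x : ι → ℝ} (hx : VecCone k s x) {c : ℝ}
    (hc : 0 < c) : VecCone k s (c • x) := fun j hj => by
  rw [elemSym_smul]; exact mul_pos (pow_pos hc _) (hx j hj)

theorem VecCone.comp_perm [Fintype ι] {k : ℕ} {x : ι → ℝ} (hx : VecCone k Finset.univ x)
    (σ : Equiv.Perm ι) : VecCone k Finset.univ (x ∘ σ) := fun j hj => by
  have : elemSym Finset.univ (x ∘ σ) j = elemSym Finset.univ x j := by
    simp only [elemSym, Function.comp_apply]
    rw [Equiv.prod_comp σ (fun i => 1 + C (x i) * X)]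
  rw [this]; exact hx j hj

/-- A doubly stochastic matrix preserves the vector Gårding cone. -/
theorem VecCone.mulVec [Fintype ι] {k : ℕ} {x : ι → ℝ} (hx : VecCone k Finset.univ x)
    {A : Matrix ι ι ℝ} (hA : A ∈ doublyStochastic ℝ ι) :
    VecCone k Finset.univ (A.mulVec x) := by
  have hconv : Convex ℝ {x : ι → ℝ | VecCone k Finset.univ x} := by
    rw [convex_iff_forall_pos]
    intro x hx y hy a b ha hb _
    exact VecCone.add (VecCone.smul hx ha) (VecCone.smul hy hb)
  obtain ⟨w, hw0, hw1, hw⟩ := exists_eq_sum_perm_of_mem_doublyStochastic hA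
  have : A.mulVec x = ∑ σ, w σ • (x ∘ σ) := by
    rw [← hw, Matrix.sum_mulVec]
    refine Finset.sum_congr rfl fun σ _ => ?_
    rw [Matrix.smul_mulVec, Matrix.permMatrix_mulVec]
  rw [this]
  exact hconv.sum_mem (fun σ _ => hw0 σ) hw1 (fun σ _ => hx.comp_perm σ)

end Vector

/-! ### The Gårding cone of symmetric matrices -/

section MatrixCone

open Polynomial Matrix

variable {n : ℕ}

theorem sigma_congr {A B : Matrix (Fin n) (Fin n) ℝ} (h : A.charpoly = B.charpoly) (j : ℕ) :
    sigma j A = sigma j B := by simp [sigma, h]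

theorem charpoly_conj {U V : Matrix (Fin n) (Fin n) ℝ} (h : U * V = 1)
    (A : Matrix (Fin n) (Fin n) ℝ) : (U * A * V).charpoly = A.charpoly := by
  have h' : V * U = 1 := mul_eq_one_comm.1 h
  have := charpoly_units_conj ⟨U, V, h, h'⟩ A
  rwa [← Matrix.coe_units_inv] at this

theorem sigma_conj {U V : Matrix (Fin n) (Fin n) ℝ} (h : U * V = 1)
    (A : Matrix (Fin n) (Fin n) ℝ) (j : ℕ) : sigma j (U * A * V) = sigma j A :=
  sigma_congr (charpoly_conj h A) j

/-- Vieta's formula for the product of the linear factors `X - xᵢ`. -/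
theorem coeff_prod_X_sub_C {ι : Type*} [DecidableEq ι] (s : Finset ι) (x : ι → ℝ) :
    ∀ j, j ≤ s.card → (-1) ^ j * (∏ i ∈ s, (X - C (x i))).coeff (s.card - j) = elemSym s x j := by
  induction s using Finset.induction_on with
  | empty => intro j hj; obtain rfl : j = 0 := by simpa using hj
             simp [elemSym]
  | insert a s ha ih =>
    intro j hj
    rw [Finset.card_insert_of_notMem ha] at hj ⊢
    rw [Finset.prod_insert ha, sub_mul, coeff_sub, coeff_C_mul]
    have hdeg : (∏ i ∈ s, (X - C (x i))).natDegree = s.card := by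
      rw [natDegree_prod_of_monic _ _ fun i _ => monic_X_sub_C _]; simp
    cases j with
    | zero =>
      have h0 : (∏ i ∈ s, (X - C (x i))).coeff (s.card + 1) = 0 :=
        coeff_eq_zero_of_natDegree_lt (by omega)
      have := ih 0 (by omega)
      simp only [elemSym_zero, pow_zero, one_mul, Nat.sub_zero] at this ⊢
      rw [coeff_X_mul, h0, this]; simp
    | succ j =>
      rw [elemSym_insert ha, Nat.add_sub_add_right]
      have h1 := ih j (by omega)
      rw [← h1]
      rcases Nat.lt_or_ge j s.card with hj' | hj'
      · have h2 := ih (j + 1) (by omega)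
        rw [← h2]
        have : s.card - j = s.card - (j + 1) + 1 := by omega
        rw [this, coeff_X_mul]
        ring
      · obtain rfl : j = s.card := by omega
        have h3 : elemSym s x (s.card + 1) = 0 := by
          rw [elemSym]
          refine coeff_eq_zero_of_natDegree_lt (lt_of_le_of_lt (natDegree_prod_le _ _) ?_)
          refine lt_of_le_of_lt (Finset.sum_le_card_nsmul s _ 1 fun i _ => ?_) (by simp)
          have : (1 + C (x i) * X : ℝ[X]) = C (x i) * X + C 1 := by simp [add_comm]
          rw [this]; exact natDegree_linear_le
        rw [h3]
        simp only [Nat.sub_self, coeff_zero_eq_eval_zero, eval_mul, eval_X, zero_mul]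
        ring

theorem sigma_diagonal (x : Fin n → ℝ) {j : ℕ} (hj : j ≤ n) :
    sigma j (diagonal x) = elemSym Finset.univ x j := by
  have h := coeff_prod_X_sub_C Finset.univ x j (by simpa using hj)
  rw [sigma, if_pos hj, charpoly_diagonal]
  simpa using h

theorem continuous_sigma (j : ℕ) : Continuous (sigma j : Matrix (Fin n) (Fin n) ℝ → ℝ) := by
  by_cases hj : j ≤ n
  · have : (sigma j : Matrix (Fin n) (Fin n) ℝ → ℝ) = fun A => (-1) ^ j *
        MvPolynomial.eval (fun p : Fin n × Fin n => A p.1 p.2)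
          ((Matrix.charpoly.univ ℝ (Fin n)).coeff (n - j)) := by
      funext A
      have := Matrix.charpoly.univ_coeff_eval₂Hom (Fin n) (RingHom.id ℝ)
        (fun p : Fin n × Fin n => A p.1 p.2) (n - j)
      rw [sigma, if_pos hj]
      congr 1
      exact this.symm
    rw [this]
    refine continuous_const.mul ((MvPolynomial.continuous_eval _).comp ?_)
    fun_prop
  · have : (sigma j : Matrix (Fin n) (Fin n) ℝ → ℝ) = fun _ => 0 := by
      funext A; simp [sigma, hj]
    rw [this]; exact continuous_const

/-- `sigma j` is homogeneous of degree `j`. -/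
theorem sigma_smul (j : ℕ) (c : ℝ) (A : Matrix (Fin n) (Fin n) ℝ) :
    sigma j (c • A) = c ^ j * sigma j A := by
  by_cases hj : j ≤ n
  · have h : ∀ A : Matrix (Fin n) (Fin n) ℝ, A.charpoly.coeff (n - j) =
        MvPolynomial.eval (fun p : Fin n × Fin n => A p.1 p.2)
          ((Matrix.charpoly.univ ℝ (Fin n)).coeff (n - j)) := by
      intro A
      exact (Matrix.charpoly.univ_coeff_eval₂Hom (Fin n) (RingHom.id ℝ)
        (fun p : Fin n × Fin n => A p.1 p.2) (n - j)).symm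
    have hh := Matrix.charpoly.univ_coeff_isHomogeneous ℝ (Fin n) (n - j) j (by simp; omega)
    rw [sigma, if_pos hj, sigma, if_pos hj, h, h]
    have : MvPolynomial.eval (fun p : Fin n × Fin n => (c • A) p.1 p.2)
        ((Matrix.charpoly.univ ℝ (Fin n)).coeff (n - j)) =
        c ^ j * MvPolynomial.eval (fun p : Fin n × Fin n => A p.1 p.2)
          ((Matrix.charpoly.univ ℝ (Fin n)).coeff (n - j)) := by
      rw [MvPolynomial.eval_eq', MvPolynomial.eval_eq', Finset.mul_sum]
      refine Finset.sum_congr rfl fun d hd => ?_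
      have hw := hh (MvPolynomial.mem_support_iff.1 hd)
      have hdeg : ∑ i, d i = j := by
        rw [← hw, Finsupp.weight_apply, Finsupp.sum_fintype _ _ (by simp)]; simp
      simp only [Matrix.smul_apply, smul_eq_mul, mul_pow, Finset.prod_mul_distrib,
        Finset.prod_pow_eq_pow_sum, hdeg]
      ring
    rw [this]
    ring
  · simp [sigma, hj]

/-- The Gårding cone `Γ_k` of real symmetric matrices. -/
def coneGamma (n k : ℕ) : Set (Matrix (Fin n) (Fin n) ℝ) :=
  {A | A.IsSymm ∧ ∀ j, 1 ≤ j → j ≤ k → 0 < sigma j A}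

theorem sigma_pos_of_mem {k j : ℕ} {A : Matrix (Fin n) (Fin n) ℝ} (h : A ∈ coneGamma n k)
    (hj : j ≤ k) : 0 < sigma j A := by
  rcases Nat.eq_zero_or_pos j with rfl | h0
  · rw [sigma_zero]; exact one_pos
  · exact h.2 j h0 hj

/-- A real symmetric matrix is orthogonally similar to a diagonal one. -/
theorem exists_orthogonal_diagonalization {A : Matrix (Fin n) (Fin n) ℝ} (hA : A.IsSymm) :
    ∃ (U : Matrix (Fin n) (Fin n) ℝ) (x : Fin n → ℝ), U * Uᵀ = 1 ∧ A = U * diagonal x * Uᵀ := by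
  have hH : A.IsHermitian := by
    rw [Matrix.IsHermitian, conjTranspose_eq_transpose_of_trivial]; exact hA
  refine ⟨hH.eigenvectorUnitary, hH.eigenvalues, ?_, ?_⟩
  · have := (Matrix.mem_unitaryGroup_iff).1 hH.eigenvectorUnitary.2
    rwa [star_eq_conjTranspose, conjTranspose_eq_transpose_of_trivial] at this
  · have := hH.spectral_theorem
    rw [Unitary.conjStarAlgAut_apply] at this
    rw [star_eq_conjTranspose, conjTranspose_eq_transpose_of_trivial] at this
    exact this

theorem conj_mem_coneGamma {k : ℕ} {A U : Matrix (Fin n) (Fin n) ℝ} (h : A ∈ coneGamma n k)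
    (hU : U * Uᵀ = 1) : U * A * Uᵀ ∈ coneGamma n k := by
  refine ⟨?_, fun j h1 hj => ?_⟩
  · have : Aᵀ = A := h.1
    rw [Matrix.IsSymm, transpose_mul, transpose_mul, transpose_transpose, this, Matrix.mul_assoc]
  · rw [sigma_conj hU]; exact h.2 j h1 hj

theorem diagonal_mem_coneGamma_iff {k : ℕ} (hk : k ≤ n) {x : Fin n → ℝ} :
    diagonal x ∈ coneGamma n k ↔ VecCone k Finset.univ x := by
  constructor
  · intro h j hj
    rw [← sigma_diagonal x (hj.trans hk)]
    exact sigma_pos_of_mem h hj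
  · intro h
    refine ⟨isSymm_diagonal x, fun j _ hj => ?_⟩
    rw [sigma_diagonal x (hj.trans hk)]
    exact h j hj

/-- The diagonal of a matrix in `Γ_k` lies in the vector cone: it is the image of the vector of
eigenvalues under a doubly stochastic matrix. -/
theorem diag_mem_vecCone {k : ℕ} (hk : k ≤ n) {A : Matrix (Fin n) (Fin n) ℝ}
    (h : A ∈ coneGamma n k) : VecCone k Finset.univ A.diag := by
  obtain ⟨U, x, hU, rfl⟩ := exists_orthogonal_diagonalization h.1
  have hU' : Uᵀ * U = 1 := mul_eq_one_comm.1 hU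
  have hx : VecCone k Finset.univ x := by
    rw [← diagonal_mem_coneGamma_iff hk]
    have := conj_mem_coneGamma h (U := Uᵀ) (by rw [transpose_transpose]; exact hU')
    rwa [transpose_transpose, show Uᵀ * (U * diagonal x * Uᵀ) * U =
      (Uᵀ * U) * diagonal x * (Uᵀ * U) by simp only [Matrix.mul_assoc], hU', Matrix.one_mul,
      Matrix.mul_one] at this
  have hds : Matrix.of (fun i j => U i j ^ 2) ∈ doublyStochastic ℝ (Fin n) := by
    rw [mem_doublyStochastic_iff_sum]
    refine ⟨fun i j => sq_nonneg _, fun i => ?_, fun j => ?_⟩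
    · have := congrFun (congrFun hU i) i
      simpa [Matrix.mul_apply, sq] using this
    · have := congrFun (congrFun hU' j) j
      simpa [Matrix.mul_apply, sq] using this
  convert hx.mulVec hds using 1
  ext i
  rw [diag_apply, Matrix.mul_apply]
  simp only [mul_diagonal, transpose_apply, mulVec, dotProduct, of_apply]
  refine Finset.sum_congr rfl fun j _ => by ring

/-- `Γ_k` is closed under addition. -/
theorem add_mem_coneGamma {k : ℕ} (hk : k ≤ n) {A B : Matrix (Fin n) (Fin n) ℝ}
    (hA : A ∈ coneGamma n k) (hB : B ∈ coneGamma n k) : A + B ∈ coneGamma n k := by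
  have hsym : (A + B).IsSymm := hA.1.add hB.1
  obtain ⟨U, z, hU, hz⟩ := exists_orthogonal_diagonalization hsym
  have hU' : Uᵀ * U = 1 := mul_eq_one_comm.1 hU
  have hc : ∀ A ∈ coneGamma n k, Uᵀ * A * U ∈ coneGamma n k := fun A hA => by
    have := conj_mem_coneGamma hA (U := Uᵀ) (by rw [transpose_transpose]; exact hU')
    rwa [transpose_transpose] at this
  have hd : Uᵀ * A * U + Uᵀ * B * U = diagonal z := by
    rw [← Matrix.add_mul, ← Matrix.mul_add, hz, show Uᵀ * (U * diagonal z * Uᵀ) * U =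
      (Uᵀ * U) * diagonal z * (Uᵀ * U) by simp only [Matrix.mul_assoc], hU', Matrix.one_mul,
      Matrix.mul_one]
  have hv := (diag_mem_vecCone hk (hc A hA)).add (diag_mem_vecCone hk (hc B hB))
  rw [← Matrix.diag_add, hd, diag_diagonal, ← diagonal_mem_coneGamma_iff hk] at hv
  rw [hz]
  exact conj_mem_coneGamma hv hU

theorem smul_mem_coneGamma {k : ℕ} {A : Matrix (Fin n) (Fin n) ℝ} (hA : A ∈ coneGamma n k) {c : ℝ}
    (hc : 0 < c) : c • A ∈ coneGamma n k :=
  ⟨hA.1.smul c, fun j h1 hj => by rw [sigma_smul]; exact mul_pos (pow_pos hc _) (hA.2 j h1 hj)⟩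

/-- The characteristic polynomial of `1 - c θ θᵀ` depends only on `|θ|`. -/
theorem charpoly_one_sub_vecMulVec (c : ℝ) {θ η : Fin n → ℝ} (h : θ ⬝ᵥ θ = η ⬝ᵥ η) :
    (1 - c • vecMulVec θ θ).charpoly = (1 - c • vecMulVec η η).charpoly := by
  have key : ∀ (θ : Fin n → ℝ) (t : ℝ), (1 - c • vecMulVec θ θ).charpoly.eval t =
      (-1) ^ n * (vecMulVec (c • θ) θ).charpoly.eval (1 - t) := by
    intro θ t
    have hneg := Matrix.det_neg (scalar (Fin n) (1 - t) - vecMulVec (c • θ) θ)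
    rw [Fintype.card_fin] at hneg
    rw [Matrix.eval_charpoly, Matrix.eval_charpoly, ← hneg]
    congr 1
    · rw [smul_vecMulVec]
      ext i j
      simp [Matrix.one_apply, Matrix.scalar_apply, diagonal_apply]
      split_ifs <;> ring
  refine Polynomial.funext fun t => ?_
  rw [key, key, charpoly_vecMulVec, charpoly_vecMulVec, smul_dotProduct, smul_dotProduct, h]

/-- `1 - c θ θᵀ ∈ Γ_k` for a unit vector `θ`, if `c < n / k`. -/
theorem one_sub_vecMulVec_mem_coneGamma {k : ℕ} (hk : k < n) {c : ℝ} (hc : c * k < n)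
    (hc0 : 0 ≤ c) {θ : Fin n → ℝ} (hθ : θ ⬝ᵥ θ = 1) :
    1 - c • vecMulVec θ θ ∈ coneGamma n k := by
  refine ⟨?_, fun j h1 hj => ?_⟩
  · rw [Matrix.IsSymm, transpose_sub, transpose_one, transpose_smul, transpose_vecMulVec]
  let i₀ : Fin n := ⟨0, by omega⟩
  have h := charpoly_one_sub_vecMulVec c (θ := θ) (η := Pi.single i₀ 1) (by rw [hθ]; simp)
  rw [sigma_congr h]
  have hd : (1 - c • vecMulVec (Pi.single i₀ 1) (Pi.single i₀ 1) : Matrix (Fin n) (Fin n) ℝ) =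
      diagonal (fun i => if i = i₀ then 1 - c else 1) := by
    ext i j
    by_cases hi : i = j
    · subst hi
      by_cases h0 : i = i₀ <;> simp [vecMulVec_apply, h0]
    · by_cases h0 : i = i₀ <;> by_cases h2 : j = i₀ <;> simp_all [vecMulVec_apply]
  obtain ⟨m, rfl⟩ : ∃ m, j = m + 1 := ⟨j - 1, by omega⟩
  rw [hd, sigma_diagonal _ (by omega), elemSym_erase (Finset.mem_univ i₀)]
  have hones : ∀ q, elemSym (Finset.univ.erase i₀) (fun i => if i = i₀ then 1 - c else 1) q =
      ((n - 1).choose q : ℝ) := by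
    intro q
    have : ∏ i ∈ Finset.univ.erase i₀, (1 + C ((fun i => if i = i₀ then 1 - c else (1:ℝ)) i) * X) =
        (1 + X) ^ (n - 1) := by
      rw [Finset.prod_congr rfl (g := fun _ => (1 + X : ℝ[X]))]
      · simp
      · intro i hi; simp [Finset.ne_of_mem_erase hi]
    rw [elemSym, this, coeff_one_add_X_pow]
  rw [hones, hones]
  simp only [if_true]
  -- `(m + 1) C(n-1, m+1) = (n - 1 - m) C(n-1, m)`, so the sign is that of `n - c (m + 1)`
  have hch : ((n - 1).choose (m + 1) : ℝ) * (m + 1) = ((n - 1).choose m : ℝ) * (n - 1 - m) := by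
    have := Nat.choose_succ_right_eq (n - 1) m
    have h2 : ((n - 1 - m : ℕ) : ℝ) = n - 1 - m := by
      rw [Nat.cast_sub (by omega), Nat.cast_sub (by omega)]; simp
    rw [← h2]; exact_mod_cast this
  have hpos : (0:ℝ) < ((n - 1).choose m : ℝ) := by
    exact_mod_cast Nat.choose_pos (by omega)
  have hmk : ((m : ℝ) + 1) ≤ k := by exact_mod_cast hj
  have hcm : c * (m + 1) < n := lt_of_le_of_lt (mul_le_mul_of_nonneg_left hmk hc0) hc
  have hm : (0:ℝ) < (m:ℝ) + 1 := by positivity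
  have : 0 < (((n - 1).choose (m + 1) : ℝ) + (1 - c) * (n - 1).choose m) * (m + 1) := by
    have : (((n - 1).choose (m + 1) : ℝ) + (1 - c) * (n - 1).choose m) * (m + 1) =
      (n - 1).choose m * (n - c * (m + 1)) := by
      rw [add_mul, hch]; ring
    rw [this]
    exact mul_pos hpos (by linarith)
  exact pos_of_mul_pos_left this hm.le

/-- Without the symmetry condition, the inequalities that define `Γ_k` are open in all matrices, so
`Γ_k` is relatively open in the symmetric ones. -/
theorem isOpen_sigma_pos (k : ℕ) :
    IsOpen {A : Matrix (Fin n) (Fin n) ℝ | ∀ j, 1 ≤ j → j ≤ k → 0 < sigma j A} := by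
  have : {A : Matrix (Fin n) (Fin n) ℝ | ∀ j, 1 ≤ j → j ≤ k → 0 < sigma j A} =
      ⋂ j ∈ Finset.Icc 1 k, {A | 0 < sigma j A} := by
    ext A; simp
  rw [this]
  exact isOpen_biInter_finset fun j _ => isOpen_lt continuous_const (continuous_sigma j)

end MatrixCone

/-! ### Calculus of partial derivatives -/

section PartialDerivatives

variable {n : ℕ}

local notation "𝔼" => EuclideanSpace ℝ (Fin n)

theorem pd_congr {f g : 𝔼 → ℝ} {y : 𝔼} (h : f =ᶠ[𝓝 y] g) (i : Fin n) : pd i f y = pd i g y := by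
  rw [pd, pd, h.fderiv_eq]

theorem pd_eventuallyEq {f g : 𝔼 → ℝ} {y : 𝔼} (h : f =ᶠ[𝓝 y] g) (i : Fin n) :
    pd i f =ᶠ[𝓝 y] pd i g :=
  h.eventuallyEq_nhds.mono fun _ hz => pd_congr hz i

theorem pd_add {f g : 𝔼 → ℝ} {y : 𝔼} (hf : DifferentiableAt ℝ f y) (hg : DifferentiableAt ℝ g y)
    (i : Fin n) : pd i (fun z => f z + g z) y = pd i f y + pd i g y := by
  simp [pd, fderiv_fun_add hf hg]

theorem pd_sub {f g : 𝔼 → ℝ} {y : 𝔼} (hf : DifferentiableAt ℝ f y) (hg : DifferentiableAt ℝ g y)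
    (i : Fin n) : pd i (fun z => f z - g z) y = pd i f y - pd i g y := by
  simp [pd, fderiv_fun_sub hf hg]

theorem pd_neg (f : 𝔼 → ℝ) (y : 𝔼) (i : Fin n) : pd i (fun z => - f z) y = - pd i f y := by
  simp [pd, fderiv_fun_neg]

theorem pd_mul {f g : 𝔼 → ℝ} {y : 𝔼} (hf : DifferentiableAt ℝ f y) (hg : DifferentiableAt ℝ g y)
    (i : Fin n) : pd i (fun z => f z * g z) y = pd i f y * g y + f y * pd i g y := by
  simp [pd, fderiv_fun_mul hf hg]; ring

theorem pd_const_mul {f : 𝔼 → ℝ} {y : 𝔼} (hf : DifferentiableAt ℝ f y) (c : ℝ) (i : Fin n) :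
    pd i (fun z => c * f z) y = c * pd i f y := by
  simp [pd, fderiv_const_mul hf]

theorem pd_sum {ι : Type*} (s : Finset ι) {f : ι → 𝔼 → ℝ} {y : 𝔼}
    (hf : ∀ a ∈ s, DifferentiableAt ℝ (f a) y) (i : Fin n) :
    pd i (fun z => ∑ a ∈ s, f a z) y = ∑ a ∈ s, pd i (f a) y := by
  simp [pd, fderiv_fun_sum hf]

/-- The chain rule for a scalar outer function. -/
theorem pd_scomp {F : ℝ → ℝ} {F' : ℝ} {f : 𝔼 → ℝ} {y : 𝔼} (hF : HasDerivAt F F' (f y))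
    (hf : DifferentiableAt ℝ f y) (i : Fin n) : pd i (fun z => F (f z)) y = F' * pd i f y := by
  have h := (hF.comp_hasFDerivAt y hf.hasFDerivAt).fderiv
  change fderiv ℝ (fun z => F (f z)) y = _ at h
  simp [pd, h]

theorem pd_exp {f : 𝔼 → ℝ} {y : 𝔼} (hf : DifferentiableAt ℝ f y) (i : Fin n) :
    pd i (fun z => Real.exp (f z)) y = Real.exp (f y) * pd i f y :=
  pd_scomp (Real.hasDerivAt_exp _) hf i

theorem fderiv_apply_eq_sum_pd (f : 𝔼 → ℝ) (y v : 𝔼) :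
    fderiv ℝ f y v = ∑ a, v a * pd a f y := by
  conv_lhs => rw [← (EuclideanSpace.basisFun (Fin n) ℝ).sum_repr v]
  simp [pd]

/-- The Jacobian matrix `∂_i φ^a`. -/
def jac (φ : 𝔼 → 𝔼) (z : 𝔼) : Matrix (Fin n) (Fin n) ℝ :=
  Matrix.of fun a i => pd i (fun x => φ x a) z

theorem pd_coord {φ : 𝔼 → 𝔼} {y : 𝔼} (hφ : DifferentiableAt ℝ φ y) (a i : Fin n) :
    pd i (fun x => φ x a) y = fderiv ℝ φ y (EuclideanSpace.single i 1) a := by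
  have h := ((EuclideanSpace.proj a : 𝔼 →L[ℝ] ℝ).hasFDerivAt.comp y
    hφ.hasFDerivAt).fderiv
  rw [pd]
  change fderiv ℝ (fun x => φ x a) y = _ at h
  rw [h]; rfl

theorem pd_comp {f : 𝔼 → ℝ} {φ : 𝔼 → 𝔼} {y : 𝔼} (hf : DifferentiableAt ℝ f (φ y))
    (hφ : DifferentiableAt ℝ φ y) (i : Fin n) :
    pd i (fun z => f (φ z)) y = ∑ a, jac φ y a i * pd a f (φ y) := by
  have h : fderiv ℝ (fun z => f (φ z)) y = _ := fderiv_comp y hf hφ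
  rw [pd, h, ContinuousLinearMap.comp_apply, fderiv_apply_eq_sum_pd]
  simp [jac, pd_coord hφ]

theorem contDiffAt_coord {m : WithTop ℕ∞} {φ : 𝔼 → 𝔼} {y : 𝔼} (h : ContDiffAt ℝ m φ y)
    (a : Fin n) : ContDiffAt ℝ m (fun z => φ z a) y :=
  (EuclideanSpace.proj a : 𝔼 →L[ℝ] ℝ).contDiff.contDiffAt.comp y h

theorem contDiffAt_pd {m : ℕ} {f : 𝔼 → ℝ} {y : 𝔼} (h : ContDiffAt ℝ (m + 1 : ℕ) f y) (i : Fin n) :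
    ContDiffAt ℝ m (pd i f) y := by
  have := h.fderiv_right (m := (m : WithTop ℕ∞)) (by norm_cast)
  exact this.clm_apply contDiffAt_const

theorem differentiableAt_pd {f : 𝔼 → ℝ} {y : 𝔼} (h : ContDiffAt ℝ 2 f y) (i : Fin n) :
    DifferentiableAt ℝ (pd i f) y :=
  (contDiffAt_pd (m := 1) (by exact_mod_cast h) i).differentiableAt (by norm_num)

theorem eventually_differentiableAt {m : WithTop ℕ∞} {f : 𝔼 → ℝ} {y : 𝔼} (h : ContDiffAt ℝ m f y)
    (hm : 1 ≤ m) : ∀ᶠ z in 𝓝 y, DifferentiableAt ℝ f z := by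
  have h1 : ContDiffAt ℝ 1 f y := h.of_le hm
  exact (h1.eventually (by simp)).mono fun z hz => hz.differentiableAt (by norm_num)

theorem pd_comm {f : 𝔼 → ℝ} {y : 𝔼} (h : ContDiffAt ℝ 2 f y) (i j : Fin n) :
    pd i (pd j f) y = pd j (pd i f) y := by
  have hs := h.isSymmSndFDerivAt (by simp)
  have hd : DifferentiableAt ℝ (fderiv ℝ f) y :=
    (h.fderiv_right (m := 1) (by norm_num)).differentiableAt (by norm_num)
  have key : ∀ i j : Fin n, pd i (pd j f) y = fderiv ℝ (fderiv ℝ f) y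
      (EuclideanSpace.single i 1) (EuclideanSpace.single j 1) := by
    intro i j
    have := hd.hasFDerivAt.clm_apply (hasFDerivAt_const (EuclideanSpace.single j (1:ℝ)) y)
    rw [pd]
    change fderiv ℝ (fun z => fderiv ℝ f z (EuclideanSpace.single j 1)) y _ = _
    rw [this.fderiv]
    simp
  rw [key, key]
  exact hs _ _

/-- The matrix of partial derivatives of the entries of a matrix-valued function. -/
def pdM (i : Fin n) (A : 𝔼 → Matrix (Fin n) (Fin n) ℝ) (y : 𝔼) : Matrix (Fin n) (Fin n) ℝ :=
  Matrix.of fun a b => pd i (fun z => A z a b) y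

theorem pdM_apply (i : Fin n) (A : 𝔼 → Matrix (Fin n) (Fin n) ℝ) (y : 𝔼) (a b : Fin n) :
    pdM i A y a b = pd i (fun z => A z a b) y := rfl

theorem pdM_congr {A B : 𝔼 → Matrix (Fin n) (Fin n) ℝ} {y : 𝔼} (h : A =ᶠ[𝓝 y] B) (i : Fin n) :
    pdM i A y = pdM i B y := by
  ext a b
  exact pd_congr (h.mono fun z hz => by simp only [hz]) i

/-- Entrywise differentiability of a matrix-valued function. -/
def DiffM (A : 𝔼 → Matrix (Fin n) (Fin n) ℝ) (y : 𝔼) : Prop :=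
  ∀ a b, DifferentiableAt ℝ (fun z => A z a b) y

theorem DiffM.mul {A B : 𝔼 → Matrix (Fin n) (Fin n) ℝ} {y : 𝔼} (hA : DiffM A y) (hB : DiffM B y) :
    DiffM (fun z => A z * B z) y := fun a b => by
  simp only [Matrix.mul_apply]
  exact DifferentiableAt.fun_sum fun c _ => (hA a c).mul (hB c b)

theorem pdM_mul {A B : 𝔼 → Matrix (Fin n) (Fin n) ℝ} {y : 𝔼} (hA : DiffM A y) (hB : DiffM B y)
    (i : Fin n) : pdM i (fun z => A z * B z) y = pdM i A y * B y + A y * pdM i B y := by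
  ext a b
  simp only [pdM_apply, Matrix.mul_apply, Matrix.add_apply]
  rw [pd_sum _ fun c _ => (hA a c).fun_mul (hB c b), ← Finset.sum_add_distrib]
  exact Finset.sum_congr rfl fun c _ => pd_mul (hA a c) (hB c b) i

theorem pdM_add {A B : 𝔼 → Matrix (Fin n) (Fin n) ℝ} {y : 𝔼} (hA : DiffM A y) (hB : DiffM B y)
    (i : Fin n) : pdM i (fun z => A z + B z) y = pdM i A y + pdM i B y := by
  ext a b
  exact pd_add (hA a b) (hB a b) i

theorem DiffM.transpose {A : 𝔼 → Matrix (Fin n) (Fin n) ℝ} {y : 𝔼} (hA : DiffM A y) :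
    DiffM (fun z => (A z).transpose) y := fun a b => hA b a

theorem contDiffAt_det {m : WithTop ℕ∞} {A : 𝔼 → Matrix (Fin n) (Fin n) ℝ} {y : 𝔼}
    (h : ∀ a b, ContDiffAt ℝ m (fun z => A z a b) y) : ContDiffAt ℝ m (fun z => (A z).det) y := by
  simp only [Matrix.det_apply]
  refine ContDiffAt.sum fun σ _ => ContDiffAt.const_smul _ ?_
  exact contDiffAt_prod fun i _ => h _ _

/-- The entries of the inverse matrix are as smooth as those of the matrix, by Cramer's rule. -/
theorem contDiffAt_inv_matrix {m : WithTop ℕ∞} {A : 𝔼 → Matrix (Fin n) (Fin n) ℝ} {y : 𝔼}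
    (h : ∀ a b, ContDiffAt ℝ m (fun z => A z a b) y) (hu : (A y).det ≠ 0) (a b : Fin n) :
    ContDiffAt ℝ m (fun z => (A z)⁻¹ a b) y := by
  simp only [Matrix.inv_def, Ring.inverse_eq_inv', Matrix.smul_apply, smul_eq_mul,
    Matrix.adjugate_apply]
  refine ((contDiffAt_det h).inv hu).mul (contDiffAt_det fun c d => ?_)
  by_cases hc : c = b
  · subst hc; simpa using contDiffAt_const
  · simpa [Matrix.updateRow_apply, hc] using h c d

end PartialDerivatives

/-! ### The Schouten tensor of a conformally flat metric -/

section FlatSchouten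

open Matrix

variable {n : ℕ}

local notation "𝔼" => EuclideanSpace ℝ (Fin n)

/-- The gradient of `f`, as a vector of partial derivatives. -/
def grad (f : 𝔼 → ℝ) (y : 𝔼) : Fin n → ℝ := fun i => pd i f y

/-- The Hessian matrix of `f`. -/
def hess (f : 𝔼 → ℝ) (y : 𝔼) : Matrix (Fin n) (Fin n) ℝ := Matrix.of fun i j => pd i (pd j f) y

/-- The expression `H + p ⊗ p - |p|² / 2` in a gradient `p` and a Hessian `H`. -/
def jetSchouten (p : Fin n → ℝ) (H : Matrix (Fin n) (Fin n) ℝ) : Matrix (Fin n) (Fin n) ℝ :=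
  H + vecMulVec p p - ((p ⬝ᵥ p) / 2) • 1

/-- The Schouten tensor of `e^{-2f} |dx|²`. -/
def flatSchouten (f : 𝔼 → ℝ) (y : 𝔼) : Matrix (Fin n) (Fin n) ℝ :=
  jetSchouten (grad f y) (hess f y)

theorem hess_isSymm {f : 𝔼 → ℝ} {y : 𝔼} (h : ContDiffAt ℝ 2 f y) : (hess f y).IsSymm := by
  ext i j
  exact pd_comm h j i

theorem jetSchouten_isSymm (p : Fin n → ℝ) {H : Matrix (Fin n) (Fin n) ℝ} (h : H.IsSymm) :
    (jetSchouten p H).IsSymm := by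
  rw [jetSchouten, Matrix.IsSymm, transpose_sub, transpose_add, transpose_vecMulVec,
    transpose_smul, transpose_one, h]

theorem grad_congr {f g : 𝔼 → ℝ} {y : 𝔼} (h : f =ᶠ[𝓝 y] g) : grad f y = grad g y :=
  funext fun i => pd_congr h i

theorem hess_congr {f g : 𝔼 → ℝ} {y : 𝔼} (h : f =ᶠ[𝓝 y] g) : hess f y = hess g y := by
  ext i j
  exact pd_congr (pd_eventuallyEq h j) i

theorem flatSchouten_congr {f g : 𝔼 → ℝ} {y : 𝔼} (h : f =ᶠ[𝓝 y] g) :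
    flatSchouten f y = flatSchouten g y := by
  rw [flatSchouten, flatSchouten, grad_congr h, hess_congr h]

theorem christoffel_congr {G G' : 𝔼 → Matrix (Fin n) (Fin n) ℝ} {y : 𝔼} (h : G =ᶠ[𝓝 y] G')
    (m i j : Fin n) : christoffel G m i j =ᶠ[𝓝 y] christoffel G' m i j := by
  filter_upwards [h.eventuallyEq_nhds] with z hz
  have e : ∀ a b : Fin n, (fun x => G x a b) =ᶠ[𝓝 z] fun x => G' x a b := fun a b =>
    hz.mono fun x hx => by simp only [hx]
  simp only [christoffel, hz.self_of_nhds, pd_congr (e _ _)]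

theorem ricci_congr {G G' : 𝔼 → Matrix (Fin n) (Fin n) ℝ} {y : 𝔼} (h : G =ᶠ[𝓝 y] G') :
    ricci G y = ricci G' y := by
  ext i j
  simp only [ricci, of_apply, fun a b c => (christoffel_congr h a b c).self_of_nhds,
    fun a b c d => pd_congr (christoffel_congr h a b c) d]

theorem schouten_congr {G G' : 𝔼 → Matrix (Fin n) (Fin n) ℝ} {y : 𝔼} (h : G =ᶠ[𝓝 y] G') :
    schouten G y = schouten G' y := by
  simp only [schouten, scalarCurv, ricci_congr h, h.self_of_nhds]

/-- The Christoffel symbols of `e^{-2f} |dx|²`. -/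
theorem christoffel_conformal {f : 𝔼 → ℝ} {y : 𝔼} (hf : DifferentiableAt ℝ f y) (m i j : Fin n) :
    christoffel (fun z => Real.exp (-2 * f z) • (1 : Matrix (Fin n) (Fin n) ℝ)) m i j y =
      -((if m = j then pd i f y else 0) + (if m = i then pd j f y else 0) -
        (if i = j then pd m f y else 0)) := by
  have hpd : ∀ i a b : Fin n, pd i (fun z => (Real.exp (-2 * f z) •
      (1 : Matrix (Fin n) (Fin n) ℝ)) a b) y =
      (if a = b then 1 else 0) * (Real.exp (-2 * f y) * (-2 * pd i f y)) := by
    intro i a b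
    simp only [Matrix.smul_apply, one_apply, smul_eq_mul, mul_comm _ (ite _ _ _)]
    rw [pd_const_mul (hf.const_mul (-2)).exp, pd_exp (hf.const_mul (-2)), pd_const_mul hf]
  have hinv : (Real.exp (-2 * f y) • (1 : Matrix (Fin n) (Fin n) ℝ))⁻¹ =
      (Real.exp (-2 * f y))⁻¹ • 1 := by
    refine Matrix.inv_eq_right_inv ?_
    rw [smul_mul_smul_comm, mul_inv_cancel₀ (Real.exp_ne_zero _)]; simp
  simp only [christoffel, hpd, hinv]
  simp only [Matrix.smul_apply, one_apply, smul_eq_mul]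
  have hne := Real.exp_ne_zero (-2 * f y)
  rw [Finset.sum_eq_single m]
  · simp only [if_true]
    simp only [eq_comm (a := j) (b := m), eq_comm (a := i) (b := m)]
    split_ifs <;> field_simp <;> ring
  · intro p _ hp
    simp [hp.symm]
  · simp

/-- The quadratic part of the Ricci tensor of a conformally flat metric. -/
theorem sum_christoffel_sq (v : Fin n → ℝ) (i j : Fin n) :
    ∑ m, ∑ p, (-((if m = p then 1 else 0) * v m + v p - (if m = p then 1 else 0) * v m) *
      -((if p = j then 1 else 0) * v i + (if p = i then 1 else 0) * v j -
        (if i = j then 1 else 0) * v p) -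
      -((if m = p then 1 else 0) * v j + (if m = j then 1 else 0) * v p -
        (if j = p then 1 else 0) * v m) *
      -((if p = m then 1 else 0) * v i + (if p = i then 1 else 0) * v m -
        (if i = m then 1 else 0) * v p)) =
      ((n : ℝ) - 2) * (v i * v j) - (if i = j then 1 else 0) * (((n : ℝ) - 2) * ∑ m, v m * v m) := by
  set d : Fin n → Fin n → ℝ := fun a b => if a = b then 1 else 0 with hd
  have hs : ∀ a b, d a b = d b a := fun a b => by simp only [hd, eq_comm]
  have h1 : ∀ (a : Fin n) (g : Fin n → ℝ), ∑ p, d p a * g p = g a := fun a g => by simp [hd]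
  have hdd : ∀ a, d a a = 1 := fun a => by simp [hd]
  have e : ∀ m p, (-(d m p * v m + v p - d m p * v m) * -(d p j * v i + d p i * v j - d i j * v p) -
      -(d m p * v j + d m j * v p - d j p * v m) * -(d p m * v i + d p i * v m - d i m * v p)) =
      d p j * (v p * v i) + d p i * (v p * v j) - d i j * (v p * v p) -
      d p m * (v i * (d p m * v j + d m j * v p - d p j * v m)) -
      d p i * (v m * (d p m * v j + d m j * v p - d p j * v m)) +
      d m i * (v p * (d p m * v j + d m j * v p - d p j * v m)) := by
    intro m p; rw [hs m p, hs j p, hs i m]; ring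
  have e3 : ∑ m, ∑ p, d m i * (v p * (d p m * v j + d m j * v p - d p j * v m)) =
      d i j * ∑ p, v p * v p := by
    rw [Finset.sum_comm]
    simp only [h1]
    have : ∀ p, v p * (d p i * v j + d i j * v p - d p j * v i) =
        d p i * (v p * v j) + d i j * (v p * v p) - d p j * (v p * v i) := fun p => by ring
    simp only [this, Finset.sum_add_distrib, Finset.sum_sub_distrib, h1, ← Finset.mul_sum]
    ring
  have e2 : ∑ m, ∑ p, d p i * (v m * (d p m * v j + d m j * v p - d p j * v m)) =
      2 * (v i * v j) - d i j * ∑ p, v p * v p := by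
    simp only [h1]
    have : ∀ m, v m * (d i m * v j + d m j * v i - d i j * v m) =
        d m i * (v m * v j) + d m j * (v m * v i) - d i j * (v m * v m) := fun m => by
      rw [hs i m]; ring
    simp only [this, Finset.sum_add_distrib, Finset.sum_sub_distrib, h1, ← Finset.mul_sum]
    ring
  have e1 : ∑ m, ∑ p, d p m * (v i * (d p m * v j + d m j * v p - d p j * v m)) =
      n * (v i * v j) := by
    simp only [h1, hdd]
    simp
  change ∑ m, ∑ p, (-(d m p * v m + v p - d m p * v m) *
      -(d p j * v i + d p i * v j - d i j * v p) -
      -(d m p * v j + d m j * v p - d j p * v m) * -(d p m * v i + d p i * v m - d i m * v p)) =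
    ((n : ℝ) - 2) * (v i * v j) - d i j * (((n : ℝ) - 2) * ∑ m, v m * v m)
  simp only [e, Finset.sum_add_distrib, Finset.sum_sub_distrib]
  rw [e1, e2, e3]
  simp only [h1, ← Finset.mul_sum, Finset.sum_const, Finset.card_univ, Fintype.card_fin,
    nsmul_eq_mul]
  ring

/-- The Ricci tensor of `e^{-2f} |dx|²`. -/
theorem ricci_conformal {f : 𝔼 → ℝ} {y : 𝔼} (hf : ContDiffAt ℝ 2 f y) :
    ricci (fun z => Real.exp (-2 * f z) • (1 : Matrix (Fin n) (Fin n) ℝ)) y =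
      ((n : ℝ) - 2) • (hess f y + vecMulVec (grad f y) (grad f y)) +
        ((hess f y).trace - ((n : ℝ) - 2) * (grad f y ⬝ᵥ grad f y)) • 1 := by
  have hd := hf.differentiableAt (by norm_num)
  have hev : ∀ m i j : Fin n, christoffel
      (fun z => Real.exp (-2 * f z) • (1 : Matrix (Fin n) (Fin n) ℝ)) m i j =ᶠ[𝓝 y]
      fun z => -((if m = j then 1 else 0) * pd i f z + (if m = i then 1 else 0) * pd j f z -
        (if i = j then 1 else 0) * pd m f z) := fun m i j =>
    (eventually_differentiableAt hf (by norm_num)).mono fun z hz => by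
      rw [christoffel_conformal hz]; simp only [ite_mul, one_mul, zero_mul]
  have hpd : ∀ q m i j : Fin n, pd q (christoffel
      (fun z => Real.exp (-2 * f z) • (1 : Matrix (Fin n) (Fin n) ℝ)) m i j) y =
      -((if m = j then 1 else 0) * pd q (pd i f) y + (if m = i then 1 else 0) * pd q (pd j f) y -
        (if i = j then 1 else 0) * pd q (pd m f) y) := fun q m i j => by
    have h := fun i => differentiableAt_pd hf i
    rw [pd_congr (hev m i j), pd_neg, pd_sub (((h i).const_mul _).fun_add ((h j).const_mul _))
      ((h m).const_mul _), pd_add ((h i).const_mul _) ((h j).const_mul _), pd_const_mul (h i),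
      pd_const_mul (h j), pd_const_mul (h m)]
  ext i j
  simp only [ricci, of_apply, hpd, fun m i j => (hev m i j).self_of_nhds, if_true, one_mul]
  have hlin : ∑ m, (-((if m = j then 1 else 0) * pd m (pd i f) y +
      (if m = i then 1 else 0) * pd m (pd j f) y - (if i = j then 1 else 0) * pd m (pd m f) y) -
      -(pd j (pd i f) y + (if m = i then 1 else 0) * pd j (pd m f) y -
        (if i = m then 1 else 0) * pd j (pd m f) y)) =
      ((n : ℝ) - 2) * pd i (pd j f) y + (if i = j then 1 else 0) * ∑ m, pd m (pd m f) y := by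
    simp only [ite_mul, zero_mul, one_mul, Finset.sum_sub_distrib,
      Finset.sum_add_distrib, Finset.sum_neg_distrib, Finset.sum_ite_eq, Finset.sum_ite_eq',
      Finset.mem_univ, if_true, Finset.sum_const, Finset.card_univ, Fintype.card_fin,
      nsmul_eq_mul, pd_comm hf j i]
    split_ifs <;> simp <;> ring
  have hquad := sum_christoffel_sq (fun m => pd m f y) i j
  rw [hlin, hquad]
  simp only [Matrix.add_apply, Matrix.smul_apply, hess, of_apply, vecMulVec_apply, grad,
    Matrix.trace, diag_apply, dotProduct, one_apply, smul_eq_mul]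
  ring

/-- The Schouten tensor of `e^{-2f} |dx|²` is `∇²f + ∇f ⊗ ∇f - |∇f|² / 2`. -/
theorem schouten_conformal (hn : 3 ≤ n) {f : 𝔼 → ℝ} {y : 𝔼} (hf : ContDiffAt ℝ 2 f y) :
    schouten (fun z => Real.exp (-2 * f z) • (1 : Matrix (Fin n) (Fin n) ℝ)) y =
      flatSchouten f y := by
  have hn' : (3 : ℝ) ≤ n := by exact_mod_cast hn
  have hinv : (Real.exp (-2 * f y) • (1 : Matrix (Fin n) (Fin n) ℝ))⁻¹ =
      (Real.exp (-2 * f y))⁻¹ • 1 := by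
    refine Matrix.inv_eq_right_inv ?_
    rw [smul_mul_smul_comm, mul_inv_cancel₀ (Real.exp_ne_zero _)]; simp
  have hscal : scalarCurv (fun z => Real.exp (-2 * f z) • (1 : Matrix (Fin n) (Fin n) ℝ)) y =
      (Real.exp (-2 * f y))⁻¹ * ((2 * n - 2) * (hess f y).trace -
        (n - 1) * (n - 2) * (grad f y ⬝ᵥ grad f y)) := by
    have : scalarCurv (fun z => Real.exp (-2 * f z) • (1 : Matrix (Fin n) (Fin n) ℝ)) y =
        (Real.exp (-2 * f y))⁻¹ *
          (ricci (fun z => Real.exp (-2 * f z) • (1 : Matrix (Fin n) (Fin n) ℝ)) y).trace := by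
      simp only [scalarCurv, hinv, Matrix.smul_apply, one_apply, smul_eq_mul, mul_ite, mul_one,
        mul_zero, ite_mul, zero_mul, Finset.sum_ite_eq, Finset.mem_univ, if_true,
        ← Finset.mul_sum, Matrix.trace, diag_apply]
    rw [this, ricci_conformal hf]
    simp only [trace_add, trace_smul, trace_vecMulVec, trace_one, smul_eq_mul, Fintype.card_fin]
    ring
  rw [schouten, hscal, ricci_conformal hf, flatSchouten, jetSchouten]
  have hne := Real.exp_ne_zero (-2 * f y)
  have h1 : (n : ℝ) - 2 ≠ 0 := by linarith
  have h2 : (n : ℝ) - 1 ≠ 0 := by linarith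
  ext i j
  simp only [Matrix.add_apply, Matrix.sub_apply, Matrix.smul_apply, smul_eq_mul]
  field_simp
  ring

end FlatSchouten

/-! ### Invariance of the Ricci tensor under changes of coordinates -/

section Invariance

open Matrix

variable {n : ℕ}

local notation "𝔼" => EuclideanSpace ℝ (Fin n)

/-- The connection matrices `(Γ_i)^m_j = Γ^m_ij`. -/
def connMatrix (G : 𝔼 → Matrix (Fin n) (Fin n) ℝ) (i : Fin n) (z : 𝔼) :
    Matrix (Fin n) (Fin n) ℝ := Matrix.of fun m j => christoffel G m i j z

/-- The curvature matrices `R_ij = ∂_i Γ_j - ∂_j Γ_i + [Γ_i, Γ_j]`. -/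
def curvMatrix (G : 𝔼 → Matrix (Fin n) (Fin n) ℝ) (i j : Fin n) (z : 𝔼) :
    Matrix (Fin n) (Fin n) ℝ :=
  pdM i (connMatrix G j) z - pdM j (connMatrix G i) z +
    (connMatrix G i z * connMatrix G j z - connMatrix G j z * connMatrix G i z)

/-- The Christoffel symbols of the first kind (times two), with rows indexed by the lowered
index. -/
def lowerConn (G : 𝔼 → Matrix (Fin n) (Fin n) ℝ) (i : Fin n) (z : 𝔼) :
    Matrix (Fin n) (Fin n) ℝ :=
  Matrix.of fun p j => pdM i G z j p + pdM j G z i p - pdM p G z i j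

theorem connMatrix_eq (G : 𝔼 → Matrix (Fin n) (Fin n) ℝ) (i : Fin n) (z : 𝔼) :
    connMatrix G i z = (1 / 2 : ℝ) • ((G z)⁻¹ * lowerConn G i z) := by
  ext m j
  simp [connMatrix, christoffel, lowerConn, Matrix.mul_apply, pdM_apply]

theorem jac_apply (φ : 𝔼 → 𝔼) (z : 𝔼) (a i : Fin n) : jac φ z a i = pd i (fun x => φ x a) z := rfl

theorem pdM_jac_symm {φ : 𝔼 → 𝔼} {z : 𝔼} (hφ : ContDiffAt ℝ 2 φ z) (a i j : Fin n) :
    pdM i (jac φ) z a j = pdM j (jac φ) z a i :=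
  pd_comm (contDiffAt_coord hφ a) i j

theorem diffM_jac {φ : 𝔼 → 𝔼} {z : 𝔼} (hφ : ContDiffAt ℝ 2 φ z) : DiffM (jac φ) z := fun a j =>
  differentiableAt_pd (contDiffAt_coord hφ a) j

theorem pdM_comp {G : 𝔼 → Matrix (Fin n) (Fin n) ℝ} {φ : 𝔼 → 𝔼} {z : 𝔼} (hG : DiffM G (φ z))
    (hφ : DifferentiableAt ℝ φ z) (i : Fin n) :
    pdM i (fun x => G (φ x)) z = ∑ b, jac φ z b i • pdM b G (φ z) := by
  ext a c
  rw [Matrix.sum_apply]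
  exact pd_comp (hG a c) hφ i

theorem DiffM.comp {G : 𝔼 → Matrix (Fin n) (Fin n) ℝ} {φ : 𝔼 → 𝔼} {z : 𝔼} (hG : DiffM G (φ z))
    (hφ : DifferentiableAt ℝ φ z) : DiffM (fun x => G (φ x)) z := fun a b =>
  (hG a b).comp z hφ

theorem transpose_mul_sum_mul_apply (J : Matrix (Fin n) (Fin n) ℝ)
    (N : Fin n → Matrix (Fin n) (Fin n) ℝ) (i p j : Fin n) :
    (Jᵀ * (∑ b, J b i • N b) * J) p j = ∑ b, ∑ c, ∑ q, J b i * J c p * J q j * N b c q := by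
  have h : (Jᵀ * (∑ b, J b i • N b) * J) p j =
      ∑ q, ∑ b, ∑ c, J b i * J c p * J q j * N b c q := by
    simp only [Matrix.mul_apply, transpose_apply, Matrix.sum_apply, Matrix.smul_apply, smul_eq_mul,
      Finset.sum_mul, Finset.mul_sum]
    refine Finset.sum_congr rfl fun q _ => Finset.sum_congr rfl fun b _ =>
      Finset.sum_congr rfl fun c _ => by ring
  rw [h, Finset.sum_comm]
  exact Finset.sum_congr rfl fun b _ => Finset.sum_comm

/-- The lowered Christoffel symbols of a pulled-back metric `Jᵀ G J`: besides the pulled-back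
symbols there is a term in the second derivatives of the change of coordinates. -/
theorem lowerConn_pullback {G G' : 𝔼 → Matrix (Fin n) (Fin n) ℝ} {φ : 𝔼 → 𝔼} {z : 𝔼}
    (hφ : ContDiffAt ℝ 2 φ z) (hG : DiffM G (φ z)) (hs : (G (φ z)).IsSymm)
    (hG' : G' =ᶠ[𝓝 z] fun x => (jac φ x)ᵀ * G (φ x) * jac φ x) (i : Fin n) :
    lowerConn G' i z = (jac φ z)ᵀ * (∑ b, jac φ z b i • lowerConn G b (φ z)) * jac φ z +
      (2 : ℝ) • ((jac φ z)ᵀ * G (φ z) * pdM i (jac φ) z) := by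
  have hφd := hφ.differentiableAt (by norm_num)
  have hJ := diffM_jac hφ
  have hGφ := hG.comp hφd
  have hD : ∀ i, pdM i G' z = (pdM i (jac φ) z)ᵀ * G (φ z) * jac φ z +
      (jac φ z)ᵀ * (∑ b, jac φ z b i • pdM b G (φ z)) * jac φ z +
      (jac φ z)ᵀ * G (φ z) * pdM i (jac φ) z := by
    intro i
    rw [pdM_congr hG', pdM_mul (hJ.transpose.mul hGφ) hJ, pdM_mul hJ.transpose hGφ, pdM_comp hG hφd,
      add_mul]
    rfl
  set J := jac φ z
  set L : Fin n → Matrix (Fin n) (Fin n) ℝ := fun i => Jᵀ * G (φ z) * pdM i (jac φ) z with hL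
  have hLT : ∀ i, (pdM i (jac φ) z)ᵀ * G (φ z) * J = (L i)ᵀ := by
    intro i
    simp only [hL, transpose_mul, transpose_transpose, Matrix.mul_assoc]
    rw [hs]
  have hLs : ∀ i j p, L i p j = L j p i := by
    intro i j p
    simp only [hL, Matrix.mul_apply (N := pdM _ _ _), pdM_jac_symm hφ _ i j]
  ext p j
  rw [Matrix.add_apply]
  have hT : (Jᵀ * (∑ b, J b i • lowerConn G b (φ z)) * J) p j =
      (Jᵀ * (∑ b, J b i • pdM b G (φ z)) * J) j p + (Jᵀ * (∑ b, J b j • pdM b G (φ z)) * J) i p -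
      (Jᵀ * (∑ b, J b p • pdM b G (φ z)) * J) i j := by
    simp only [transpose_mul_sum_mul_apply, lowerConn, of_apply, mul_add, mul_sub,
      Finset.sum_add_distrib, Finset.sum_sub_distrib]
    congr 1
    · congr 1
      · refine Finset.sum_congr rfl fun b _ => ?_
        rw [Finset.sum_comm]
        refine Finset.sum_congr rfl fun c _ => Finset.sum_congr rfl fun q _ => by ring
      · rw [Finset.sum_congr rfl fun b _ => Finset.sum_comm, Finset.sum_comm]
        refine Finset.sum_congr rfl fun b _ => Finset.sum_congr rfl fun c _ =>
          Finset.sum_congr rfl fun q _ => by ring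
    · rw [Finset.sum_comm]
      refine Finset.sum_congr rfl fun b _ => Finset.sum_congr rfl fun c _ =>
          Finset.sum_congr rfl fun q _ => by ring
  rw [hT]
  simp only [lowerConn, of_apply, hD, hLT, Matrix.add_apply, Matrix.smul_apply, transpose_apply,
    smul_eq_mul]
  change L i p j + _ + L i j p + (L j p i + _ + L j i p) - (L p j i + _ + L p i j) =
    _ + 2 * L i p j
  rw [hLs j i p, hLs p i j, hLs p j i]
  ring

/-- The gauge transformation law `J Γ'_i = (∑ b, J^b_i Γ_b) J + ∂_i J` of the connection matrices.
-/
theorem connMatrix_pullback {G G' : 𝔼 → Matrix (Fin n) (Fin n) ℝ} {φ : 𝔼 → 𝔼} {z : 𝔼}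
    (hφ : ContDiffAt ℝ 2 φ z) (hJ : IsUnit (jac φ z).det) (hG : DiffM G (φ z))
    (hs : (G (φ z)).IsSymm) (hu : IsUnit (G (φ z)).det)
    (hG' : G' =ᶠ[𝓝 z] fun x => (jac φ x)ᵀ * G (φ x) * jac φ x) (i : Fin n) :
    jac φ z * connMatrix G' i z =
      (∑ b, jac φ z b i • connMatrix G b (φ z)) * jac φ z + pdM i (jac φ) z := by
  have hJT : IsUnit (jac φ z)ᵀ.det := by rwa [det_transpose]
  rw [connMatrix_eq, lowerConn_pullback hφ hG hs hG', hG'.self_of_nhds, Matrix.mul_inv_rev,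
    Matrix.mul_inv_rev]
  simp only [connMatrix_eq]
  set J := jac φ z
  set A := G (φ z)
  have hsum : ∑ b, J b i • ((1 / 2 : ℝ) • (A⁻¹ * lowerConn G b (φ z))) =
      (1 / 2 : ℝ) • (A⁻¹ * ∑ b, J b i • lowerConn G b (φ z)) := by
    rw [Matrix.mul_sum, Finset.smul_sum]
    refine Finset.sum_congr rfl fun b _ => ?_
    rw [smul_comm, Matrix.mul_smul]
  rw [hsum]
  set X := ∑ b, J b i • lowerConn G b (φ z)
  have key : ∀ Y, J * (J⁻¹ * (A⁻¹ * Jᵀ⁻¹) * (Jᵀ * Y)) = A⁻¹ * Y := by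
    intro Y
    simp only [Matrix.mul_assoc]
    rw [Matrix.mul_nonsing_inv_cancel_left _ _ hJ, Matrix.nonsing_inv_mul_cancel_left _ _ hJT]
  rw [Matrix.mul_smul, Matrix.mul_add, Matrix.mul_add, Matrix.mul_smul, Matrix.mul_smul]
  simp only [Matrix.mul_assoc] at key ⊢
  rw [key, key, Matrix.nonsing_inv_mul_cancel_left _ _ hu, smul_add, smul_smul, Matrix.smul_mul,
    Matrix.mul_assoc]
  norm_num

/-- Connection matrices related by the gauge transformation law have similar curvature matrices: the
second derivatives of `J` cancel by symmetry. -/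
theorem curvMatrix_pullback {G G' : 𝔼 → Matrix (Fin n) (Fin n) ℝ} {φ : 𝔼 → 𝔼} {y : 𝔼}
    (hφ : ContDiffAt ℝ 3 φ y)
    (hG : ∀ b, DiffM (connMatrix G b) (φ y)) (hG' : ∀ b, DiffM (connMatrix G' b) y)
    (h : ∀ i, ∀ᶠ z in 𝓝 y, jac φ z * connMatrix G' i z =
      (∑ b, jac φ z b i • connMatrix G b (φ z)) * jac φ z + pdM i (jac φ) z) (k i : Fin n) :
    jac φ y * curvMatrix G' k i y =
      (∑ c, ∑ b, (jac φ y c k * jac φ y b i) • curvMatrix G c b (φ y)) * jac φ y := by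
  have hφ2 : ContDiffAt ℝ 2 φ y := hφ.of_le (by norm_num)
  have hφd := hφ.differentiableAt (by norm_num)
  have hJd := diffM_jac hφ2
  have hHd : ∀ i, DiffM (pdM i (jac φ)) y := fun i a j =>
    differentiableAt_pd (contDiffAt_pd (m := 2) (by exact_mod_cast contDiffAt_coord hφ a) j) i
  have hHs : ∀ i k, pdM k (pdM i (jac φ)) y = pdM i (pdM k (jac φ)) y := by
    intro i k; ext a j
    exact pd_comm (contDiffAt_pd (m := 2) (by exact_mod_cast contDiffAt_coord hφ a) j) k i
  set Ω : Fin n → 𝔼 → Matrix (Fin n) (Fin n) ℝ := fun i z =>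
    ∑ b, jac φ z b i • connMatrix G b (φ z) with hΩ
  have hΩd : ∀ i, DiffM (Ω i) y := by
    intro i a c
    simp only [hΩ, Matrix.sum_apply, Matrix.smul_apply, smul_eq_mul]
    exact DifferentiableAt.fun_sum fun b _ => (hJd b i).mul ((hG b).comp hφd a c)
  have hΩp : ∀ i k, pdM k (Ω i) y = ∑ b, (pdM k (jac φ) y b i • connMatrix G b (φ y) +
      jac φ y b i • ∑ c, jac φ y c k • pdM c (connMatrix G b) (φ y)) := by
    intro i k
    ext a c
    rw [pdM_apply]
    simp only [hΩ, Matrix.sum_apply, Matrix.smul_apply, smul_eq_mul, Matrix.add_apply]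
    rw [pd_sum _ fun b _ => (hJd b i).fun_mul ((hG b).comp hφd a c)]
    refine Finset.sum_congr rfl fun b _ => ?_
    rw [pd_mul (hJd b i) ((hG b).comp hφd a c), pd_comp (hG b a c) hφd]
    rfl
  have hder : ∀ i k, pdM k (jac φ) y * connMatrix G' i y + jac φ y * pdM k (connMatrix G' i) y =
      pdM k (Ω i) y * jac φ y + Ω i y * pdM k (jac φ) y + pdM k (pdM i (jac φ)) y := by
    intro i k
    rw [← pdM_mul hJd (hG' i), pdM_congr (h i), pdM_add ((hΩd i).mul hJd) (hHd i),
      pdM_mul (hΩd i) hJd]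
  have h0 : ∀ i, jac φ y * connMatrix G' i y = Ω i y * jac φ y + pdM i (jac φ) y := fun i =>
    (h i).self_of_nhds
  have hstep : jac φ y * curvMatrix G' k i y =
      (pdM k (Ω i) y - pdM i (Ω k) y + (Ω k y * Ω i y - Ω i y * Ω k y)) * jac φ y := by
    have e1 := hder i k
    have e2 := hder k i
    rw [hHs i k] at e1
    have e3 : jac φ y * (connMatrix G' k y * connMatrix G' i y) = Ω k y * (Ω i y * jac φ y) +
        Ω k y * pdM i (jac φ) y + pdM k (jac φ) y * connMatrix G' i y := by
      rw [← Matrix.mul_assoc, h0, Matrix.add_mul, Matrix.mul_assoc, h0, Matrix.mul_add]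
    have e4 : jac φ y * (connMatrix G' i y * connMatrix G' k y) = Ω i y * (Ω k y * jac φ y) +
        Ω i y * pdM k (jac φ) y + pdM i (jac φ) y * connMatrix G' k y := by
      rw [← Matrix.mul_assoc, h0, Matrix.add_mul, Matrix.mul_assoc, h0, Matrix.mul_add]
    rw [curvMatrix, Matrix.mul_add, Matrix.mul_sub, Matrix.mul_sub, e3, e4,
      eq_sub_of_add_eq' e1, eq_sub_of_add_eq' e2]
    simp only [Matrix.add_mul, Matrix.sub_mul, Matrix.mul_assoc]
    abel
  rw [hstep]
  congr 1
  rw [hΩp, hΩp]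
  simp only [hΩ, Finset.sum_add_distrib, Matrix.sum_mul, Matrix.mul_sum, Finset.smul_sum,
    curvMatrix, smul_add, smul_sub, Finset.sum_sub_distrib, Matrix.smul_mul, Matrix.mul_smul,
    smul_smul, pdM_jac_symm hφ2 _ k i]
  have s1 : ∑ x, ∑ x_1, (jac φ y x i * jac φ y x_1 k) • pdM x_1 (connMatrix G x) (φ y) =
      ∑ c, ∑ b, (jac φ y c k * jac φ y b i) • pdM c (connMatrix G b) (φ y) := by
    rw [Finset.sum_comm]; simp only [mul_comm]
  have s2 : ∑ x, ∑ x_1, (jac φ y x i * jac φ y x_1 k) •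
      (connMatrix G x_1 (φ y) * connMatrix G x (φ y)) =
      ∑ c, ∑ b, (jac φ y c k * jac φ y b i) •
        (connMatrix G c (φ y) * connMatrix G b (φ y)) := by
    rw [Finset.sum_comm]; simp only [mul_comm (jac φ y _ i)]
  rw [s1, s2]
  abel

theorem christoffel_symm {G : 𝔼 → Matrix (Fin n) (Fin n) ℝ} {z : 𝔼}
    (hs : ∀ᶠ x in 𝓝 z, (G x).IsSymm) (m i j : Fin n) :
    christoffel G m i j z = christoffel G m j i z := by
  have : ∀ p a b : Fin n, pd p (fun x => G x a b) z = pd p (fun x => G x b a) z := fun p a b =>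
    pd_congr (hs.mono fun x hx => hx.apply b a) p
  simp only [christoffel, this _ i j]
  congr 1
  refine Finset.sum_congr rfl fun p _ => by ring

/-- The Ricci tensor is a contraction of the curvature matrices. -/
theorem ricci_eq_sum_curvMatrix {G : 𝔼 → Matrix (Fin n) (Fin n) ℝ} {z : 𝔼}
    (hs : ∀ᶠ x in 𝓝 z, (G x).IsSymm) (i j : Fin n) :
    ricci G z i j = ∑ m, curvMatrix G m j z m i := by
  have h1 : ∀ m i j : Fin n, christoffel G m i j =ᶠ[𝓝 z] christoffel G m j i := fun m i j =>
    hs.eventually_nhds.mono fun x hx => christoffel_symm hx m i j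
  simp only [ricci, of_apply, curvMatrix, Matrix.add_apply, Matrix.sub_apply, Matrix.mul_apply,
    pdM_apply, connMatrix, Finset.sum_add_distrib, ← Finset.sum_sub_distrib]
  refine congrArg₂ _ (Finset.sum_congr rfl fun m _ => ?_) (Finset.sum_congr rfl fun m _ =>
    Finset.sum_congr rfl fun p _ => ?_)
  · rw [pd_congr (h1 m i j), pd_congr (h1 m i m)]
  · rw [(h1 p i j).self_of_nhds, (h1 p i m).self_of_nhds]

theorem diffM_connMatrix {G : 𝔼 → Matrix (Fin n) (Fin n) ℝ} {z : 𝔼}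
    (hG : ∀ a b, ContDiffAt ℝ 2 (fun x => G x a b) z) (hu : IsUnit (G z).det) (i : Fin n) :
    DiffM (connMatrix G i) z := by
  intro m j
  simp only [connMatrix, of_apply, christoffel]
  refine DifferentiableAt.const_mul (DifferentiableAt.fun_sum fun p _ => DifferentiableAt.mul ?_ ?_) _
  · exact (contDiffAt_inv_matrix hG hu.ne_zero m p).differentiableAt (by norm_num)
  · exact ((differentiableAt_pd (hG j p) i).add (differentiableAt_pd (hG i p) j)).sub
      (differentiableAt_pd (hG i j) p)

theorem contDiffAt_jac {m : ℕ} {φ : 𝔼 → 𝔼} {z : 𝔼} (hφ : ContDiffAt ℝ (m + 1 : ℕ) φ z)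
    (a i : Fin n) : ContDiffAt ℝ m (fun x => jac φ x a i) z :=
  contDiffAt_pd (contDiffAt_coord hφ a) i

/-- The Ricci tensor transforms as a tensor under changes of coordinates. The proof is the gauge
transformation law `J Γ' = Ω J + ∂J` of the connection matrices, where `Ω` is the pulled-back
connection. -/
theorem ricci_pullback {G G' : 𝔼 → Matrix (Fin n) (Fin n) ℝ} {φ : 𝔼 → 𝔼} {y : 𝔼}
    (hφ : ContDiffAt ℝ 3 φ y) (hJ : IsUnit (jac φ y).det)
    (hG : ∀ a b, ContDiffAt ℝ 2 (fun x => G x a b) (φ y))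
    (hs : ∀ᶠ x in 𝓝 (φ y), (G x).IsSymm) (hu : IsUnit (G (φ y)).det)
    (hG' : G' =ᶠ[𝓝 y] fun x => (jac φ x)ᵀ * G (φ x) * jac φ x) :
    ricci G' y = (jac φ y)ᵀ * ricci G (φ y) * jac φ y := by
  have hφ2 : ContDiffAt ℝ 2 φ y := hφ.of_le (by norm_num)
  have hJc : ∀ a i, ContDiffAt ℝ 2 (fun x => jac φ x a i) y := fun a i =>
    contDiffAt_jac (m := 2) (by exact_mod_cast hφ) a i
  have hGφ : ∀ a b, ContDiffAt ℝ 2 (fun x => G (φ x) a b) y := fun a b => (hG a b).comp y hφ2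
  have hG'c : ∀ a b, ContDiffAt ℝ 2 (fun x => G' x a b) y := fun a b => by
    have : (fun x => G' x a b) =ᶠ[𝓝 y] fun x =>
        ∑ c, (∑ d, jac φ x d a * G (φ x) d c) * jac φ x c b :=
      hG'.mono fun x hx => by simp only [hx, Matrix.mul_apply, transpose_apply]
    refine ContDiffAt.congr_of_eventuallyEq ?_ this
    exact ContDiffAt.sum fun c _ => (ContDiffAt.sum fun d _ => (hJc d a).mul (hGφ d c)).mul (hJc c b)
  have hu' : IsUnit (G' y).det := by
    rw [hG'.self_of_nhds, det_mul, det_mul, det_transpose]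
    exact (hJ.mul hu).mul hJ
  have hs' : ∀ᶠ x in 𝓝 y, (G' x).IsSymm := by
    filter_upwards [hG', hφ.continuousAt.eventually hs] with x hx hsx
    rw [hx, Matrix.IsSymm, transpose_mul, transpose_mul, transpose_transpose, hsx, Matrix.mul_assoc]
  have hev : ∀ᶠ z in 𝓝 y, ContDiffAt ℝ 2 φ z ∧ IsUnit (jac φ z).det ∧ DiffM G (φ z) ∧
      (G (φ z)).IsSymm ∧ IsUnit (G (φ z)).det := by
    have hdetJ : ∀ᶠ z in 𝓝 y, (jac φ z).det ≠ 0 :=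
      (contDiffAt_det hJc).continuousAt.eventually_ne hJ.ne_zero
    have hdetG : ∀ᶠ z in 𝓝 y, (G (φ z)).det ≠ 0 :=
      (contDiffAt_det hGφ).continuousAt.eventually_ne hu.ne_zero
    have hd : ∀ᶠ z in 𝓝 (φ y), DiffM G z := by
      simp only [DiffM, Filter.eventually_all]
      exact fun a b => eventually_differentiableAt (hG a b) (by norm_num)
    filter_upwards [hφ2.eventually (by simp), hdetJ, hdetG, hφ.continuousAt.eventually hd,
      hφ.continuousAt.eventually hs] with z h1 h2 h3 h4 h5
    exact ⟨h1, h2.isUnit, h4, h5, h3.isUnit⟩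
  have hconn : ∀ i, ∀ᶠ z in 𝓝 y, jac φ z * connMatrix G' i z =
      (∑ b, jac φ z b i • connMatrix G b (φ z)) * jac φ z + pdM i (jac φ) z := by
    intro i
    filter_upwards [hev, hG'.eventuallyEq_nhds] with z ⟨h1, h2, h3, h4, h5⟩ h6
    exact connMatrix_pullback h1 h2 h3 h4 h5 h6 i
  have hcurv := curvMatrix_pullback hφ (diffM_connMatrix hG hu) (diffM_connMatrix hG'c hu') hconn
  ext i j
  rw [ricci_eq_sum_curvMatrix hs']
  have hR : ricci G (φ y) = Matrix.of fun i j => ∑ m, curvMatrix G m j (φ y) m i := by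
    ext i j; exact ricci_eq_sum_curvMatrix hs i j
  have hc2 : ∀ m, curvMatrix G' m j y = (jac φ y)⁻¹ *
      ((∑ c, ∑ b, (jac φ y c m * jac φ y b j) • curvMatrix G c b (φ y)) * jac φ y) := fun m => by
    rw [← hcurv, Matrix.nonsing_inv_mul_cancel_left _ _ hJ]
  have hJJ : ∀ a c, ∑ m, jac φ y c m * (jac φ y)⁻¹ m a = if c = a then 1 else 0 := fun a c => by
    rw [← Matrix.mul_apply, Matrix.mul_nonsing_inv _ hJ, Matrix.one_apply]
  rw [hR]
  simp only [hc2]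
  set J := jac φ y
  have e1 : ∀ m, (J⁻¹ * ((∑ c, ∑ b, (J c m * J b j) • curvMatrix G c b (φ y)) * J)) m i =
      ∑ a, ∑ d, ∑ b, ∑ c, (J c m * J⁻¹ m a) * (J b j * curvMatrix G c b (φ y) a d * J d i) := by
    intro m
    simp only [Matrix.mul_apply, Matrix.sum_apply, Matrix.smul_apply, smul_eq_mul, Finset.mul_sum,
      Finset.sum_mul]
    refine Finset.sum_congr rfl fun a _ => ?_
    rw [Finset.sum_comm, Finset.sum_congr rfl fun b _ => Finset.sum_comm, Finset.sum_comm]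
    refine Finset.sum_congr rfl fun d _ => Finset.sum_congr rfl fun b _ =>
      Finset.sum_congr rfl fun c _ => by ring
  simp only [e1]
  have e2 : ∑ m, ∑ a, ∑ d, ∑ b, ∑ c, (J c m * J⁻¹ m a) *
      (J b j * curvMatrix G c b (φ y) a d * J d i) =
      ∑ a, ∑ d, ∑ b, ∑ c, (∑ m, J c m * J⁻¹ m a) *
        (J b j * curvMatrix G c b (φ y) a d * J d i) := by
    simp only [Finset.sum_mul]
    rw [Finset.sum_comm]
    refine Finset.sum_congr rfl fun a _ => ?_
    rw [Finset.sum_comm]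
    refine Finset.sum_congr rfl fun d _ => ?_
    rw [Finset.sum_comm]
    refine Finset.sum_congr rfl fun b _ => ?_
    rw [Finset.sum_comm]
  rw [e2]
  simp only [hJJ, ite_mul, one_mul, zero_mul, Finset.sum_ite_eq', Finset.mem_univ, if_true]
  simp only [Matrix.mul_apply, transpose_apply, of_apply, Finset.sum_mul, Finset.mul_sum]
  rw [Finset.sum_comm, Finset.sum_congr rfl fun d _ => Finset.sum_comm, Finset.sum_comm]
  refine Finset.sum_congr rfl fun b _ => Finset.sum_congr rfl fun d _ =>
    Finset.sum_congr rfl fun a _ => by ring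

/-- The elementary symmetric functions of the Schouten tensor are scalars: they do not depend on
the coordinates. -/
theorem sigma_schouten_pullback {G G' : 𝔼 → Matrix (Fin n) (Fin n) ℝ} {φ : 𝔼 → 𝔼} {y : 𝔼}
    (hφ : ContDiffAt ℝ 3 φ y) (hJ : IsUnit (jac φ y).det)
    (hG : ∀ a b, ContDiffAt ℝ 2 (fun x => G x a b) (φ y))
    (hs : ∀ᶠ x in 𝓝 (φ y), (G x).IsSymm) (hu : IsUnit (G (φ y)).det)
    (hG' : G' =ᶠ[𝓝 y] fun x => (jac φ x)ᵀ * G (φ x) * jac φ x) (j : ℕ) :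
    sigma j ((G' y)⁻¹ * schouten G' y) = sigma j ((G (φ y))⁻¹ * schouten G (φ y)) := by
  have hJT : IsUnit (jac φ y)ᵀ.det := by rwa [det_transpose]
  have hR := ricci_pullback hφ hJ hG hs hu hG'
  have hGy : G' y = (jac φ y)ᵀ * G (φ y) * jac φ y := hG'.self_of_nhds
  have hinv : (G' y)⁻¹ = (jac φ y)⁻¹ * ((G (φ y))⁻¹ * ((jac φ y)ᵀ)⁻¹) := by
    rw [hGy, Matrix.mul_inv_rev, Matrix.mul_inv_rev]
  have key : ∀ Y, (G' y)⁻¹ * ((jac φ y)ᵀ * Y * jac φ y) =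
      (jac φ y)⁻¹ * ((G (φ y))⁻¹ * Y) * jac φ y := by
    intro Y
    rw [hinv]
    simp only [Matrix.mul_assoc]
    rw [Matrix.nonsing_inv_mul_cancel_left _ _ hJT]
  have hscal : ∀ (G : 𝔼 → Matrix (Fin n) (Fin n) ℝ) (z : 𝔼), (G z).IsSymm →
      scalarCurv G z = ((G z)⁻¹ * ricci G z).trace := by
    intro G z hsz
    have hsi : ∀ i j, (G z)⁻¹ i j = (G z)⁻¹ j i := fun i j => by
      have : ((G z)⁻¹)ᵀ = (G z)⁻¹ := by rw [Matrix.transpose_nonsing_inv, hsz]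
      conv_lhs => rw [← this]
      rfl
    simp only [scalarCurv, Matrix.trace, diag_apply, Matrix.mul_apply]
    rw [Finset.sum_comm]
    refine Finset.sum_congr rfl fun j _ => Finset.sum_congr rfl fun i _ => by rw [hsi]
  have hsz := hs.self_of_nhds
  have hsz' : (G' y).IsSymm := by
    rw [hGy, Matrix.IsSymm, transpose_mul, transpose_mul, transpose_transpose, hsz,
      Matrix.mul_assoc]
  have hsc : scalarCurv G' y = scalarCurv G (φ y) := by
    rw [hscal _ _ hsz', hscal _ _ hsz, hR, key, Matrix.trace_mul_comm,
      Matrix.mul_nonsing_inv_cancel_left _ _ hJ]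
  have hS : schouten G' y = (jac φ y)ᵀ * schouten G (φ y) * jac φ y := by
    simp only [schouten, hsc, hR]
    rw [hGy]
    simp only [Matrix.mul_smul, Matrix.smul_mul, Matrix.mul_sub, Matrix.sub_mul]
  rw [hS, key]
  exact sigma_conj (Matrix.nonsing_inv_mul _ hJ) _ j

end Invariance

/-! ### Conformally flat charts -/

section Charts

open Matrix

variable {n : ℕ} {M : Type*} [TopologicalSpace M] [ChartedSpace (EuclideanSpace ℝ (Fin n)) M]

local notation "𝔼" => EuclideanSpace ℝ (Fin n)

theorem jac_comp {ψ φ : 𝔼 → 𝔼} {y : 𝔼} (hψ : DifferentiableAt ℝ ψ (φ y))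
    (hφ : DifferentiableAt ℝ φ y) : jac (fun z => ψ (φ z)) y = jac ψ (φ y) * jac φ y := by
  ext a i
  have h : DifferentiableAt ℝ (fun x => ψ x a) (φ y) :=
    (EuclideanSpace.proj a : 𝔼 →L[ℝ] ℝ).differentiableAt.comp _ hψ
  rw [jac_apply, pd_comp h hφ, Matrix.mul_apply]
  exact Finset.sum_congr rfl fun b _ => mul_comm _ _

theorem jac_id (y : 𝔼) : jac (fun z : 𝔼 => z) y = 1 := by
  ext a i
  rw [jac_apply, pd_coord (φ := fun z => z) differentiableAt_fun_id]
  simp [Matrix.one_apply]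

theorem jac_congr {ψ φ : 𝔼 → 𝔼} {y : 𝔼} (h : ψ =ᶠ[𝓝 y] φ) : jac ψ y = jac φ y := by
  ext a i
  exact pd_congr (h.mono fun z hz => by simp only [hz]) i

theorem det_fderiv_eq (φ : 𝔼 → 𝔼) {y : 𝔼} (hφ : DifferentiableAt ℝ φ y) :
    (fderiv ℝ φ y).det = (jac φ y).det := by
  have : jac φ y = LinearMap.toMatrix (EuclideanSpace.basisFun (Fin n) ℝ).toBasis
      (EuclideanSpace.basisFun (Fin n) ℝ).toBasis (fderiv ℝ φ y : 𝔼 →ₗ[ℝ] 𝔼) := by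
    ext a i
    rw [jac_apply, pd_coord hφ, LinearMap.toMatrix_apply]
    simp
  rw [this, LinearMap.det_toMatrix]

section Manifold

variable [IsManifold (𝓡 n) ∞ M]
  {e c : OpenPartialHomeomorph M (EuclideanSpace ℝ (Fin n))}

theorem contDiffAt_transition (he : e ∈ IsManifold.maximalAtlas (𝓡 n) ∞ M)
    (hc : c ∈ IsManifold.maximalAtlas (𝓡 n) ∞ M) {y : 𝔼} (hy : y ∈ c.target)
    (hye : c.symm y ∈ e.source) : ContDiffAt ℝ ∞ (fun z => e (c.symm z)) y := by
  have h1 := (contMDiffOn_symm_of_mem_maximalAtlas hc).contMDiffAt (c.open_target.mem_nhds hy)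
  have h2 := (contMDiffOn_of_mem_maximalAtlas he).contMDiffAt (e.open_source.mem_nhds hye)
  exact contMDiffAt_iff_contDiffAt.1 (h2.comp y h1)

theorem mdifferentiableAt_chart_symm (he : e ∈ IsManifold.maximalAtlas (𝓡 n) ∞ M) {y : 𝔼}
    (hy : y ∈ e.target) : MDifferentiableAt (𝓡 n) (𝓡 n) e.symm y :=
  ((contMDiffOn_symm_of_mem_maximalAtlas he).contMDiffAt (e.open_target.mem_nhds hy)).mdifferentiableAt
    (by simp)

/-- The Jacobian of a transition map is invertible, by the chain rule for it and its inverse. -/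
theorem isUnit_det_jac_transition (he : e ∈ IsManifold.maximalAtlas (𝓡 n) ∞ M)
    (hc : c ∈ IsManifold.maximalAtlas (𝓡 n) ∞ M) {y : 𝔼} (hy : y ∈ c.target)
    (hye : c.symm y ∈ e.source) : IsUnit (jac (fun z => e (c.symm z)) y).det := by
  have h1 := contDiffAt_transition he hc hy hye
  have h2 : ContDiffAt ℝ ∞ (fun z => c (e.symm z)) (e (c.symm y)) :=
    contDiffAt_transition hc he (e.map_source hye) (by rw [e.left_inv hye]; exact c.map_target hy)
  have h3 := jac_comp (h2.differentiableAt (by simp)) (h1.differentiableAt (by simp))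
  have h4 : (fun z => c (e.symm (e (c.symm z)))) =ᶠ[𝓝 y] fun z => z := by
    have hc' : ContinuousAt c.symm y := c.continuousAt_symm hy
    filter_upwards [c.open_target.mem_nhds hy, hc'.eventually (e.open_source.mem_nhds hye)]
      with z hz hze
    rw [e.left_inv hze, c.right_inv hz]
  rw [jac_congr h4, jac_id] at h3
  have h5 := congrArg Matrix.det h3
  rw [det_one, det_mul] at h5
  exact IsUnit.of_mul_eq_one_right _ h5.symm

/-- The matrices of a field of bilinear forms in two charts. -/
theorem gram_transition (g : FormField n M) (he : e ∈ IsManifold.maximalAtlas (𝓡 n) ∞ M)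
    (hc : c ∈ IsManifold.maximalAtlas (𝓡 n) ∞ M) {y : 𝔼} (hy : y ∈ c.target)
    (hye : c.symm y ∈ e.source) :
    gram g c y = (jac (fun z => e (c.symm z)) y)ᵀ * gram g e (e (c.symm y)) *
      jac (fun z => e (c.symm z)) y := by
  set φ : 𝔼 → 𝔼 := fun z => e (c.symm z) with hφ
  have hφd : DifferentiableAt ℝ φ y :=
    (contDiffAt_transition he hc hy hye).differentiableAt (by simp)
  have hpt : e.symm (φ y) = c.symm y := e.left_inv hye
  have h4 : (c.symm : 𝔼 → M) =ᶠ[𝓝 y] fun z => e.symm (φ z) := by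
    have hc' : ContinuousAt c.symm y := c.continuousAt_symm hy
    filter_upwards [hc'.eventually (e.open_source.mem_nhds hye)] with z hze
    rw [hφ]; simp only [e.left_inv hze]
  have hmd : MDifferentiableAt (𝓡 n) (𝓡 n) φ y := hφd.mdifferentiableAt
  have hme := mdifferentiableAt_chart_symm he (e.map_source hye)
  have hder : (mfderiv (𝓡 n) (𝓡 n) c.symm y : 𝔼 →L[ℝ] 𝔼) =
      (mfderiv (𝓡 n) (𝓡 n) e.symm (φ y) : 𝔼 →L[ℝ] 𝔼).comp (fderiv ℝ φ y) := by
    have h5 := h4.mfderiv_eq (I := 𝓡 n) (I' := 𝓡 n)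
    have h6 := mfderiv_comp (I := 𝓡 n) (I' := 𝓡 n) (I'' := 𝓡 n) y hme hmd
    rw [mfderiv_eq_fderiv] at h6
    exact h5.trans h6
  have hvec : ∀ i, (coordVec c y i : 𝔼) = ∑ a, jac φ y a i • (coordVec e (φ y) a : 𝔼) := by
    intro i
    have h7 : (coordVec c y i : 𝔼) = (mfderiv (𝓡 n) (𝓡 n) e.symm (φ y) : 𝔼 →L[ℝ] 𝔼)
        (fderiv ℝ φ y (EuclideanSpace.single i 1)) := by
      change (mfderiv (𝓡 n) (𝓡 n) c.symm y : 𝔼 →L[ℝ] 𝔼) (EuclideanSpace.single i 1) = _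
      rw [hder]; rfl
    have h8 : fderiv ℝ φ y (EuclideanSpace.single i 1) =
        ∑ a, jac φ y a i • (EuclideanSpace.single a (1:ℝ) : 𝔼) := by
      ext b
      rw [← pd_coord hφd]
      simp [jac_apply, Pi.single_apply]
    have h9 : ∀ A : 𝔼 →L[ℝ] 𝔼, A (∑ a, jac φ y a i • (EuclideanSpace.single a (1:ℝ) : 𝔼)) =
        ∑ a, jac φ y a i • A (EuclideanSpace.single a (1:ℝ)) := fun A => by
      rw [map_sum]; simp only [map_smul]
    rw [h7, h8]
    exact h9 _
  have hg : ∀ v w : 𝔼, (g (c.symm y) : 𝔼 →L[ℝ] 𝔼 →L[ℝ] ℝ) v w =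
      (g (e.symm (φ y)) : 𝔼 →L[ℝ] 𝔼 →L[ℝ] ℝ) v w := by
    rw [hpt]; intro v w; rfl
  ext i j
  have h9 : gram g c y i j = (g (e.symm (φ y)) : 𝔼 →L[ℝ] 𝔼 →L[ℝ] ℝ)
      (coordVec c y i : 𝔼) (coordVec c y j : 𝔼) := hg _ _
  have h10 : ∀ (B : 𝔼 →L[ℝ] 𝔼 →L[ℝ] ℝ) (v : Fin n → 𝔼) (x z : Fin n → ℝ),
      B (∑ a, x a • v a) (∑ b, z b • v b) = ∑ b, ∑ a, x a * B (v a) (v b) * z b := by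
    intro B v x z
    simp only [map_sum, map_smul, _root_.sum_apply, _root_.smul_apply, smul_eq_mul,
      Finset.mul_sum]
    refine Finset.sum_congr rfl fun b _ => Finset.sum_congr rfl fun a _ => by ring
  rw [h9, hvec, hvec]
  refine (h10 _ _ _ _).trans ?_
  simp only [Matrix.mul_apply, transpose_apply, Finset.sum_mul]
  rfl

/-- The coordinates `e` are conformally flat for `g`, with conformal factor `e^{-2f}`. -/
def IsFlatIn (g : FormField n M) (e : OpenPartialHomeomorph M (EuclideanSpace ℝ (Fin n)))
    (f : 𝔼 → ℝ) : Prop :=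
  ∀ y ∈ e.target, gram g e y = Real.exp (-2 * f y) • 1

theorem gram_conformalChange (u : M → ℝ) (g : FormField n M)
    (e : OpenPartialHomeomorph M (EuclideanSpace ℝ (Fin n))) (y : 𝔼) :
    gram (conformalChange u g) e y = Real.exp (-2 * u (e.symm y)) • gram g e y := rfl

theorem IsFlatIn.conformalChange {g : FormField n M} {w : 𝔼 → ℝ} (h : IsFlatIn g e w)
    (u : M → ℝ) : IsFlatIn (conformalChange u g) e fun y => u (e.symm y) + w y := by
  intro y hy
  rw [gram_conformalChange, h y hy, smul_smul, ← Real.exp_add]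
  congr 2
  ring

theorem IsFlatIn.gram_eventuallyEq {g : FormField n M} {f : 𝔼 → ℝ} (h : IsFlatIn g e f)
    (he : e ∈ IsManifold.maximalAtlas (𝓡 n) ∞ M)
    (hc : c ∈ IsManifold.maximalAtlas (𝓡 n) ∞ M) {y : 𝔼} (hy : y ∈ c.target)
    (hye : c.symm y ∈ e.source) :
    gram g c y = (jac (fun z => e (c.symm z)) y)ᵀ * (Real.exp (-2 * f (e (c.symm y))) • 1) *
      jac (fun z => e (c.symm z)) y := by
  rw [gram_transition g he hc hy hye, h _ (e.map_source hye)]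

/-- The `σ_j`-curvature `σ_j(g⁻¹ S_g)` of `g = e^{-2f} |dx|²`. -/
def flatSigma (j : ℕ) (f : 𝔼 → ℝ) (y : 𝔼) : ℝ :=
  Real.exp (2 * j * f y) * sigma j (flatSchouten f y)

/-- `sigmaCurv` is computed in the preferred chart at the point, but any conformally flat chart
gives the same value. -/
theorem sigmaCurv_eq_flatSigma (hn : 3 ≤ n) {g : FormField n M} {f : 𝔼 → ℝ} (h : IsFlatIn g e f)
    (he : e ∈ IsManifold.maximalAtlas (𝓡 n) ∞ M) {x : M} (hx : x ∈ e.source)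
    (hf : ContDiffAt ℝ 2 f (e x)) (j : ℕ) : sigmaCurv j g x = flatSigma j f (e x) := by
  set c := chartAt (EuclideanSpace ℝ (Fin n)) x with hcdef
  have hc : c ∈ IsManifold.maximalAtlas (𝓡 n) ∞ M := IsManifold.chart_mem_maximalAtlas x
  have hxc : x ∈ c.source := mem_chart_source _ x
  have hy : c x ∈ c.target := c.map_source hxc
  have hback : c.symm (c x) = x := c.left_inv hxc
  have hye : c.symm (c x) ∈ e.source := by rwa [hback]
  set φ : 𝔼 → 𝔼 := fun z => e (c.symm z) with hφ
  have hφx : φ (c x) = e x := by simp only [hφ, hback]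
  set G : 𝔼 → Matrix (Fin n) (Fin n) ℝ := fun z => Real.exp (-2 * f z) • 1 with hG
  have hev : gram g c =ᶠ[𝓝 (c x)] fun z => (jac φ z)ᵀ * G (φ z) * jac φ z := by
    filter_upwards [c.open_target.mem_nhds hy,
      (c.continuousAt_symm hy).eventually (e.open_source.mem_nhds hye)] with z hz hze
    exact h.gram_eventuallyEq he hc hz hze
  have hGc : ∀ a b, ContDiffAt ℝ 2 (fun z => G z a b) (φ (c x)) := fun a b => by
    rw [hφx]
    simp only [hG, Matrix.smul_apply, smul_eq_mul]
    exact ((contDiffAt_const.mul hf).exp).mul contDiffAt_const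
  have key := sigma_schouten_pullback
    ((contDiffAt_transition he hc hy hye).of_le (by norm_cast))
    (isUnit_det_jac_transition he hc hy hye) hGc
    (Filter.Eventually.of_forall fun z => by
      simp only [hG]; rw [Matrix.IsSymm, transpose_smul, transpose_one])
    (by
      simp only [hG, det_smul, det_one, mul_one]
      exact (pow_pos (Real.exp_pos _) _).ne'.isUnit) hev j
  simp only [hback] at key
  have hinv : (G (e x))⁻¹ = Real.exp (2 * f (e x)) • 1 := by
    refine Matrix.inv_eq_right_inv ?_
    rw [hG, smul_mul_smul_comm, ← Real.exp_add]; simp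
  change sigma j ((gram g c (c x))⁻¹ * schouten (gram g c) (c x)) = _
  rw [key, hinv, schouten_conformal hn hf, Matrix.smul_mul, Matrix.one_mul, sigma_smul,
    flatSigma, ← Real.exp_nat_mul]
  congr 2
  ring

end Manifold

end Charts

/-! ### The Riemannian measure in a conformally flat chart -/

section Measure

open Matrix MeasureTheory

variable {n : ℕ} {M : Type*} [TopologicalSpace M] [ChartedSpace (EuclideanSpace ℝ (Fin n)) M]

local notation "𝔼" => EuclideanSpace ℝ (Fin n)

section Chart

variable [MeasurableSpace M] [BorelSpace M]

theorem measurableSet_preimage_chart (e : OpenPartialHomeomorph M (EuclideanSpace ℝ (Fin n)))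
    {A : Set M} (hA : MeasurableSet A) : MeasurableSet (e.symm ⁻¹' A ∩ e.target) := by
  have h1 : Measurable (e.target.domRestrict e.symm) :=
    (continuousOn_iff_continuous_domRestrict.1 e.continuousOn_symm).measurable
  have h2 := MeasurableSet.subtype_image e.open_target.measurableSet (h1 hA)
  convert h2 using 1
  ext y
  simp only [Set.mem_inter_iff, Set.mem_preimage, Set.mem_image, Subtype.exists,
    exists_and_right, exists_eq_right]
  exact ⟨fun h => ⟨h.2, h.1⟩, fun ⟨h1, h2⟩ => ⟨h2, h1⟩⟩

theorem aemeasurable_chart_symm (e : OpenPartialHomeomorph M (EuclideanSpace ℝ (Fin n)))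
    (d : 𝔼 → ℝ≥0∞) :
    AEMeasurable e.symm ((volume.restrict e.target).withDensity d) :=
  (e.continuousOn_symm.aemeasurable e.open_target.measurableSet).mono_ac
    (withDensity_absolutelyContinuous _ _)

theorem map_chart_symm_apply (e : OpenPartialHomeomorph M (EuclideanSpace ℝ (Fin n)))
    (d : 𝔼 → ℝ≥0∞) {A : Set M} (hA : MeasurableSet A) :
    (((volume.restrict e.target).withDensity d).map e.symm) A =
      ∫⁻ y in e.symm ⁻¹' A ∩ e.target, d y := by
  rw [Measure.map_apply_of_aemeasurable (aemeasurable_chart_symm e d) hA, withDensity_apply',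
    Measure.restrict_restrict' e.open_target.measurableSet]

variable [IsManifold (𝓡 n) ∞ M] {e c : OpenPartialHomeomorph M (EuclideanSpace ℝ (Fin n))}

/-- Change of variables between two charts. -/
theorem lintegral_transition (he : e ∈ IsManifold.maximalAtlas (𝓡 n) ∞ M)
    (hc : c ∈ IsManifold.maximalAtlas (𝓡 n) ∞ M) {A : Set M} (hA : MeasurableSet A)
    (hAe : A ⊆ e.source) (hAc : A ⊆ c.source) (h : 𝔼 → ℝ≥0∞) :
    ∫⁻ y in e.symm ⁻¹' A ∩ e.target, h y = ∫⁻ y in c.symm ⁻¹' A ∩ c.target,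
      ENNReal.ofReal |(jac (fun z => e (c.symm z)) y).det| * h (e (c.symm y)) := by
  set φ : 𝔼 → 𝔼 := fun z => e (c.symm z) with hφ
  set s := c.symm ⁻¹' A ∩ c.target with hs
  have hd : ∀ y ∈ s, DifferentiableAt ℝ φ y := fun y hy =>
    (contDiffAt_transition he hc hy.2 (hAe hy.1)).differentiableAt (by simp)
  have himg : φ '' s = e.symm ⁻¹' A ∩ e.target := by
    ext z
    constructor
    · rintro ⟨y, hy, rfl⟩
      refine ⟨?_, e.map_source (hAe hy.1)⟩
      simp only [hφ, Set.mem_preimage, e.left_inv (hAe hy.1)]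
      exact hy.1
    · rintro ⟨hz, hzt⟩
      refine ⟨c (e.symm z), ⟨?_, c.map_source (hAc hz)⟩, ?_⟩
      · simp only [Set.mem_preimage, c.left_inv (hAc hz)]; exact hz
      · simp only [hφ, c.left_inv (hAc hz), e.right_inv hzt]
  have hinj : Set.InjOn φ s := by
    intro y hy z hz hyz
    have h1 := e.injOn (hAe hy.1) (hAe hz.1) hyz
    exact c.symm.injOn hy.2 hz.2 h1
  rw [← himg, lintegral_image_eq_lintegral_abs_det_fderiv_mul volume
    (measurableSet_preimage_chart c hA) (fun y hy => (hd y hy).hasFDerivAt.hasFDerivWithinAt) hinj]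
  refine setLIntegral_congr_fun (measurableSet_preimage_chart c hA) fun y hy => ?_
  simp only [det_fderiv_eq φ (hd y hy)]
  rfl

end Chart

variable [IsManifold (𝓡 n) ∞ M] [CompactSpace M] [T2Space M] [MeasurableSpace M] [BorelSpace M]
  {e c : OpenPartialHomeomorph M (EuclideanSpace ℝ (Fin n))}

theorem IsFlatIn.sqrt_det_gram {g : FormField n M} {f : 𝔼 → ℝ} (h : IsFlatIn g e f)
    (he : e ∈ IsManifold.maximalAtlas (𝓡 n) ∞ M)
    (hc : c ∈ IsManifold.maximalAtlas (𝓡 n) ∞ M) {y : 𝔼} (hy : y ∈ c.target)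
    (hye : c.symm y ∈ e.source) :
    √((gram g c y).det) = |(jac (fun z => e (c.symm z)) y).det| *
      Real.exp (-n * f (e (c.symm y))) := by
  rw [h.gram_eventuallyEq he hc hy hye, det_mul, det_mul, det_transpose, det_smul, det_one, mul_one,
    Fintype.card_fin, ← Real.exp_nat_mul]
  have : (jac (fun z => e (c.symm z)) y).det * Real.exp (n * (-2 * f (e (c.symm y)))) *
      (jac (fun z => e (c.symm z)) y).det = (|(jac (fun z => e (c.symm z)) y).det| *
      Real.exp (-n * f (e (c.symm y)))) ^ 2 := by
    rw [mul_pow, sq_abs, ← Real.exp_nat_mul]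
    have : (n : ℝ) * (-2 * f (e (c.symm y))) = (2 : ℕ) * (-n * f (e (c.symm y))) := by
      push_cast; ring
    rw [this]; ring
  rw [this, Real.sqrt_sq (by positivity)]

/-- In a conformally flat chart the Riemannian measure is `e^{-n f} dx`. -/
theorem volumeMeasure_restrict_source {g : FormField n M} {f : 𝔼 → ℝ} (h : IsFlatIn g e f)
    (he : e ∈ IsManifold.maximalAtlas (𝓡 n) ∞ M) (hf : ContinuousOn f e.target) :
    (volumeMeasure g).restrict e.source = ((volume.restrict e.target).withDensity
      fun y => ENNReal.ofReal (Real.exp (-n * f y))).map e.symm := by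
  ext A hA
  have hB : MeasurableSet (A ∩ e.source) := hA.inter e.open_source.measurableSet
  rw [Measure.restrict_apply hA, map_chart_symm_apply e _ hA, volumeMeasure,
    Measure.sum_apply _ hB]
  have hS := measurableSet_preimage_chart e hA
  set S := e.symm ⁻¹' A ∩ e.target with hSdef
  have hSB : e.symm ⁻¹' (A ∩ e.source) ∩ e.target = S := by
    ext z
    exact ⟨fun hz => ⟨hz.1.1, hz.2⟩, fun hz => ⟨⟨hz.1, e.map_target hz.2⟩, hz.2⟩⟩
  set ρ := chartPartition n M with hρ
  set H : M → 𝔼 → ℝ≥0∞ := fun i z =>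
    ENNReal.ofReal (ρ i (e.symm z) * Real.exp (-n * f z)) with hH
  have hterm : ∀ i : M, ((((volume : Measure 𝔼).restrict
      (chartAt (EuclideanSpace ℝ (Fin n)) i).target).withDensity fun y =>
        ENNReal.ofReal (ρ i ((chartAt (EuclideanSpace ℝ (Fin n)) i).symm y) *
          √((gram g (chartAt (EuclideanSpace ℝ (Fin n)) i) y).det))).map
        (chartAt (EuclideanSpace ℝ (Fin n)) i).symm) (A ∩ e.source) = ∫⁻ z in S, H i z := by
    intro i
    set c := chartAt (EuclideanSpace ℝ (Fin n)) i
    have hc : c ∈ IsManifold.maximalAtlas (𝓡 n) ∞ M := IsManifold.chart_mem_maximalAtlas i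
    have hC : MeasurableSet (A ∩ e.source ∩ c.source) := hB.inter c.open_source.measurableSet
    rw [map_chart_symm_apply c _ hB]
    have h1 : c.symm ⁻¹' (A ∩ e.source) ∩ c.target =
        c.symm ⁻¹' (A ∩ e.source ∩ c.source) ∩ c.target := by
      ext z
      exact ⟨fun hz => ⟨⟨hz.1, c.map_target hz.2⟩, hz.2⟩, fun hz => ⟨hz.1.1, hz.2⟩⟩
    have h2 : ∫⁻ z in S, H i z =
        ∫⁻ z in e.symm ⁻¹' (A ∩ e.source ∩ c.source) ∩ e.target, H i z := by
      have hm := measurableSet_preimage_chart e hC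
      rw [← lintegral_indicator hS, ← lintegral_indicator hm]
      congr 1
      ext z
      by_cases hz : z ∈ S
      · by_cases hzc : e.symm z ∈ c.source
        · rw [Set.indicator_of_mem hz, Set.indicator_of_mem]
          exact ⟨⟨⟨hz.1, e.map_target hz.2⟩, hzc⟩, hz.2⟩
        · have h0 : ρ i (e.symm z) = 0 := by
            by_contra hne
            exact hzc (chartPartition_isSubordinate n M i (subset_tsupport _ hne))
          rw [Set.indicator_of_mem hz, Set.indicator_of_notMem fun hh => hzc hh.1.2]
          simp [hH, h0]
      · rw [Set.indicator_of_notMem hz, Set.indicator_of_notMem fun hh => hz ⟨hh.1.1.1, hh.2⟩]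
    rw [h1, h2, lintegral_transition he hc hC (fun x hx => hx.1.2) (fun x hx => hx.2)]
    refine setLIntegral_congr_fun (measurableSet_preimage_chart c hC) fun y hy => ?_
    simp only [hH, h.sqrt_det_gram he hc hy.2 hy.1.1.2, e.left_inv hy.1.1.2]
    rw [← ENNReal.ofReal_mul (abs_nonneg _)]
    congr 1
    ring
  have hfin : {i | (Function.support (ρ i)).Nonempty}.Finite :=
    ρ.locallyFinite.finite_nonempty_of_compact
  have hzero : ∀ i ∉ hfin.toFinset, ∀ x, ρ i x = 0 := by
    intro i hi x
    by_contra hne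
    exact hi (hfin.mem_toFinset.2 ⟨x, hne⟩)
  calc _ = ∑' i, ∫⁻ z in S, H i z := tsum_congr hterm
    _ = ∑ i ∈ hfin.toFinset, ∫⁻ z in S, H i z := by
        refine tsum_eq_sum fun i hi => ?_
        simp [hH, hzero i hi]
    _ = ∫⁻ z in S, ∑ i ∈ hfin.toFinset, H i z := by
        rw [lintegral_finsetSum' _ fun i _ => ?_]
        have hcont : ContinuousOn (fun z => ρ i (e.symm z) * Real.exp (-n * f z)) e.target :=
          ((ρ i).continuous.comp_continuousOn e.continuousOn_symm).mul
            (Real.continuous_exp.comp_continuousOn (continuousOn_const.mul hf))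
        exact ((hcont.aemeasurable e.open_target.measurableSet).mono_measure
          (Measure.restrict_mono Set.inter_subset_right le_rfl)).ennreal_ofReal
    _ = _ := by
        refine setLIntegral_congr_fun hS fun z hz => ?_
        simp only [hH]
        rw [← ENNReal.ofReal_sum_of_nonneg fun i _ => mul_nonneg (ρ.nonneg i _) (Real.exp_pos _).le,
          ← Finset.sum_mul]
        have h1 : ∑ i ∈ hfin.toFinset, ρ i (e.symm z) = 1 := by
          rw [← ρ.sum_eq_one (Set.mem_univ (e.symm z)), finsum_eq_sum_of_support_subset]
          intro i hi
          by_contra hne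
          exact hi (hzero i hne _)
        rw [h1, one_mul]

/-- Every point has a chart in which `g` is conformally flat, with a `C²` factor. -/
def HasFlatCharts (g : FormField n M) : Prop :=
  ∀ p : M, ∃ e ∈ IsManifold.maximalAtlas (𝓡 n) ∞ M, p ∈ e.source ∧
    ∃ f : 𝔼 → ℝ, ContDiffOn ℝ 2 f e.target ∧ IsFlatIn g e f

theorem continuousAt_flatSchouten {f : 𝔼 → ℝ} {y : 𝔼} (hf : ContDiffAt ℝ 2 f y) :
    ContinuousAt (flatSchouten f) y := by
  have h1 : ∀ i, ContinuousAt (pd i f) y := fun i => (differentiableAt_pd hf i).continuousAt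
  have h2 : ∀ i j, ContinuousAt (pd i (pd j f)) y := fun i j =>
    (contDiffAt_pd (m := 0) (contDiffAt_pd (m := 1) (by exact_mod_cast hf) j) i).continuousAt
  have hg : ContinuousAt (grad f) y := continuousAt_pi.2 h1
  have hh : ContinuousAt (hess f) y := continuousAt_pi.2 fun i => continuousAt_pi.2 fun j => h2 i j
  have hv : ContinuousAt (fun z => vecMulVec (grad f z) (grad f z)) y :=
    continuousAt_pi.2 fun i => continuousAt_pi.2 fun j => (h1 i).mul (h1 j)
  have hd : ContinuousAt (fun z => grad f z ⬝ᵥ grad f z) y :=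
    tendsto_finsetSum _ fun i _ => (h1 i).mul (h1 i)
  exact (hh.add hv).sub ((hd.div_const 2).smul continuousAt_const)

theorem continuousAt_flatSigma {f : 𝔼 → ℝ} {y : 𝔼} (hf : ContDiffAt ℝ 2 f y) (j : ℕ) :
    ContinuousAt (flatSigma j f) y :=
  ((continuousAt_const.mul hf.continuousAt).rexp).mul
    ((continuous_sigma j).continuousAt.comp (continuousAt_flatSchouten hf))

theorem HasFlatCharts.continuous_sigmaCurv (hn : 3 ≤ n) {g : FormField n M} (h : HasFlatCharts g)
    (j : ℕ) : Continuous (sigmaCurv j g) := by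
  rw [continuous_iff_continuousAt]
  intro p
  obtain ⟨e, he, hp, f, hf, hflat⟩ := h p
  have hfa : ∀ x ∈ e.source, ContDiffAt ℝ 2 f (e x) := fun x hx =>
    hf.contDiffAt (e.open_target.mem_nhds (e.map_source hx))
  have hev : sigmaCurv j g =ᶠ[𝓝 p] fun x => flatSigma j f (e x) := by
    filter_upwards [e.open_source.mem_nhds hp] with x hx
    exact sigmaCurv_eq_flatSigma hn hflat he hx (hfa x hx) j
  refine ContinuousAt.congr ?_ hev.symm
  exact (continuousAt_flatSigma (hfa p hp) j).comp (f := e) (e.continuousAt hp)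

theorem HasFlatCharts.isFiniteMeasure {g : FormField n M} (h : HasFlatCharts g) :
    IsFiniteMeasure (volumeMeasure g) := by
  refine ⟨isCompact_univ.measure_lt_top_of_nhdsWithin fun p _ => ?_⟩
  rw [nhdsWithin_univ]
  obtain ⟨e, he, hp, f, hf, hflat⟩ := h p
  obtain ⟨K, hK, hKe, hKc⟩ := local_compact_nhds (e.open_target.mem_nhds (e.map_source hp))
  refine ⟨e.source ∩ e ⁻¹' (interior K), ?_, ?_⟩
  · refine Filter.inter_mem (e.open_source.mem_nhds hp) ?_
    exact (e.continuousAt hp).preimage_mem_nhds (interior_mem_nhds.2 hK)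
  · have hU : IsOpen (e.source ∩ e ⁻¹' (interior K)) :=
      e.isOpen_inter_preimage isOpen_interior
    have h1 : volumeMeasure g (e.source ∩ e ⁻¹' (interior K)) =
        (volumeMeasure g).restrict e.source (e.source ∩ e ⁻¹' (interior K)) := by
      rw [Measure.restrict_apply hU.measurableSet]
      congr 1
      ext x; simp only [Set.mem_inter_iff]; tauto
    rw [h1, volumeMeasure_restrict_source hflat he hf.continuousOn,
      map_chart_symm_apply _ _ hU.measurableSet]
    have hcont : ContinuousOn (fun y => Real.exp (-n * f y)) K :=
      Real.continuous_exp.comp_continuousOn (continuousOn_const.mul (hf.continuousOn.mono hKe))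
    have hint := hcont.integrableOn_compact (μ := volume) hKc
    refine lt_of_le_of_lt (lintegral_mono_set (t := K) ?_) hint.lintegral_lt_top
    rintro y ⟨⟨hy1, hy2⟩, hy3⟩
    rw [Set.mem_preimage, e.right_inv hy3] at hy2
    exact interior_subset hy2

theorem HasFlatCharts.integrable_sigmaCurv (hn : 3 ≤ n) {g : FormField n M} (h : HasFlatCharts g)
    (j : ℕ) : Integrable (sigmaCurv j g) (volumeMeasure g) := by
  have := h.isFiniteMeasure
  have hc := h.continuous_sigmaCurv hn j
  exact hc.integrable_of_hasCompactSupport (HasCompactSupport.of_compactSpace _)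

/-- The density of `σ_j(g) dg` for `g = e^{-2f} |dx|²`. -/
def flatDensity (j : ℕ) (f : 𝔼 → ℝ) (y : 𝔼) : ℝ :=
  Real.exp (-((n : ℝ) - 2 * j) * f y) * sigma j (flatSchouten f y)

/-- The `σ_j`-integral over a subset of a conformally flat chart. -/
theorem setIntegral_sigmaCurv (hn : 3 ≤ n) {g : FormField n M} (hg : HasFlatCharts g) {f : 𝔼 → ℝ}
    (h : IsFlatIn g e f) (he : e ∈ IsManifold.maximalAtlas (𝓡 n) ∞ M)
    (hf : ContDiffOn ℝ 2 f e.target) {A : Set 𝔼} (hA : MeasurableSet A) (hAe : A ⊆ e.target)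
    (hAM : MeasurableSet (e.symm '' A)) (j : ℕ) :
    ∫ x in e.symm '' A, sigmaCurv j g x ∂(volumeMeasure g) = ∫ y in A, flatDensity j f y := by
  have hsub : e.symm '' A ⊆ e.source := by
    rintro _ ⟨y, hy, rfl⟩; exact e.map_target (hAe hy)
  have h1 : (volumeMeasure g).restrict (e.symm '' A) =
      (((volume.restrict e.target).withDensity
        fun y => ENNReal.ofReal (Real.exp (-n * f y))).map e.symm).restrict (e.symm '' A) := by
    rw [← volumeMeasure_restrict_source h he hf.continuousOn, Measure.restrict_restrict hAM,
      Set.inter_eq_left.2 hsub]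
  have hcm := (hg.continuous_sigmaCurv hn j).measurable
  rw [h1, ← integral_indicator hAM, integral_map (aemeasurable_chart_symm e _)
    ((hcm.indicator hAM).aestronglyMeasurable)]
  have hdm : AEMeasurable (fun y => Real.toNNReal (Real.exp (-n * f y)))
      (volume.restrict e.target) :=
    (((Real.continuous_exp.comp_continuousOn (continuousOn_const.mul hf.continuousOn)).aemeasurable
      e.open_target.measurableSet)).real_toNNReal
  have h2 := integral_withDensity_eq_integral_smul₀ (μ := volume.restrict e.target) hdm
    (fun y => (e.symm '' A).indicator (sigmaCurv j g) (e.symm y))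
  change ∫ y, _ ∂((volume.restrict e.target).withDensity
    fun y => ((Real.toNNReal (Real.exp (-n * f y)) : ℝ≥0) : ℝ≥0∞)) = _
  rw [h2, ← integral_indicator e.open_target.measurableSet, ← integral_indicator hA]
  congr 1
  ext y
  by_cases hy : y ∈ A
  · have hyt := hAe hy
    rw [Set.indicator_of_mem hyt, Set.indicator_of_mem hy,
      Set.indicator_of_mem (Set.mem_image_of_mem _ hy),
      sigmaCurv_eq_flatSigma hn h he (e.map_target hyt)
        (by rw [e.right_inv hyt]; exact hf.contDiffAt (e.open_target.mem_nhds hyt)), e.right_inv hyt,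
      flatSigma, flatDensity, NNReal.smul_def, Real.coe_toNNReal _ (Real.exp_pos _).le, smul_eq_mul,
      ← mul_assoc, ← Real.exp_add]
    congr 2
    ring
  · rw [Set.indicator_of_notMem hy]
    by_cases hyt : y ∈ e.target
    · rw [Set.indicator_of_mem hyt, Set.indicator_of_notMem, smul_zero]
      rintro ⟨z, hz, hzy⟩
      exact hy (e.symm.injOn (hAe hz) hyt hzy ▸ hz)
    · rw [Set.indicator_of_notMem hyt]

/-- The `σ_j`-integral over `A` depends on the metric on `A` only, once the curvatures agree there:
as `A` need not be open, equality of the metrics on `A` does not give that of the curvatures. -/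
theorem setIntegral_sigmaCurv_congr {g g' : FormField n M} {A : Set M} (hA : MeasurableSet A)
    (hg : ∀ x ∈ A, g x = g' x) (j : ℕ) (hs : ∀ x ∈ A, sigmaCurv j g x = sigmaCurv j g' x) :
    ∫ x in A, sigmaCurv j g x ∂(volumeMeasure g) =
      ∫ x in A, sigmaCurv j g' x ∂(volumeMeasure g') := by
  have hm : (volumeMeasure g).restrict A = (volumeMeasure g').restrict A := by
    ext B hB
    rw [Measure.restrict_apply hB, Measure.restrict_apply hB, volumeMeasure, volumeMeasure,
      Measure.sum_apply _ (hB.inter hA), Measure.sum_apply _ (hB.inter hA)]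
    refine tsum_congr fun i => ?_
    rw [map_chart_symm_apply _ _ (hB.inter hA), map_chart_symm_apply _ _ (hB.inter hA)]
    refine setLIntegral_congr_fun (measurableSet_preimage_chart _ (hB.inter hA)) fun y hy => ?_
    have : gram g (chartAt (EuclideanSpace ℝ (Fin n)) i) y =
        gram g' (chartAt (EuclideanSpace ℝ (Fin n)) i) y := by
      simp only [gram, hg _ hy.1.2]
    simp only [this]
  rw [hm]
  exact setIntegral_congr_fun hA hs

end Measure

/-! ### Soft minima of conformal factors -/

section SoftMin

open Matrix

variable {n : ℕ}

local notation "𝔼" => EuclideanSpace ℝ (Fin n)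

theorem grad_add {f g : 𝔼 → ℝ} {y : 𝔼} (hf : ContDiffAt ℝ 2 f y) (hg : ContDiffAt ℝ 2 g y) :
    grad (fun z => f z + g z) y = grad f y + grad g y :=
  funext fun i => pd_add (hf.differentiableAt (by norm_num)) (hg.differentiableAt (by norm_num)) i

theorem hess_add {f g : 𝔼 → ℝ} {y : 𝔼} (hf : ContDiffAt ℝ 2 f y) (hg : ContDiffAt ℝ 2 g y) :
    hess (fun z => f z + g z) y = hess f y + hess g y := by
  ext i j
  have h1 : pd j (fun z => f z + g z) =ᶠ[𝓝 y] fun z => pd j f z + pd j g z := by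
    filter_upwards [eventually_differentiableAt hf (by norm_num),
      eventually_differentiableAt hg (by norm_num)] with z h1 h2
    exact pd_add h1 h2 j
  change pd i (pd j fun z => f z + g z) y = pd i (pd j f) y + pd i (pd j g) y
  rw [pd_congr h1, pd_add (differentiableAt_pd hf j) (differentiableAt_pd hg j)]

theorem grad_const_mul {f : 𝔼 → ℝ} {y : 𝔼} (hf : ContDiffAt ℝ 2 f y) (c : ℝ) :
    grad (fun z => c * f z) y = c • grad f y :=
  funext fun i => pd_const_mul (hf.differentiableAt (by norm_num)) c i

theorem hess_const_mul {f : 𝔼 → ℝ} {y : 𝔼} (hf : ContDiffAt ℝ 2 f y) (c : ℝ) :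
    hess (fun z => c * f z) y = c • hess f y := by
  ext i j
  have h1 : pd j (fun z => c * f z) =ᶠ[𝓝 y] fun z => c * pd j f z := by
    filter_upwards [eventually_differentiableAt hf (by norm_num)] with z h1
    exact pd_const_mul h1 c j
  change pd i (pd j fun z => c * f z) y = c * pd i (pd j f) y
  rw [pd_congr h1, pd_const_mul (differentiableAt_pd hf j)]

theorem grad_sub {f g : 𝔼 → ℝ} {y : 𝔼} (hf : ContDiffAt ℝ 2 f y) (hg : ContDiffAt ℝ 2 g y) :
    grad (fun z => f z - g z) y = grad f y - grad g y :=
  funext fun i => pd_sub (hf.differentiableAt (by norm_num)) (hg.differentiableAt (by norm_num)) i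

theorem hess_sub {f g : 𝔼 → ℝ} {y : 𝔼} (hf : ContDiffAt ℝ 2 f y) (hg : ContDiffAt ℝ 2 g y) :
    hess (fun z => f z - g z) y = hess f y - hess g y := by
  have h := hess_add hf (hg.neg)
  have h2 := hess_const_mul hg (-1)
  simp only [neg_one_mul, neg_smul, one_smul] at h2
  have h3 : (fun z => f z + -g z) = fun z => f z - g z := by
    funext z; simp [sub_eq_add_neg]
  rw [← h3, h]
  change hess f y + hess (fun z => - g z) y = _
  rw [h2, sub_eq_add_neg]

theorem grad_mul {f g : 𝔼 → ℝ} {y : 𝔼} (hf : ContDiffAt ℝ 2 f y) (hg : ContDiffAt ℝ 2 g y) :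
    grad (fun z => f z * g z) y = g y • grad f y + f y • grad g y := by
  funext i
  have := pd_mul (hf.differentiableAt (by norm_num)) (hg.differentiableAt (by norm_num)) i
  simp only [grad, this, Pi.add_apply, Pi.smul_apply, smul_eq_mul]
  ring

theorem hess_mul {f g : 𝔼 → ℝ} {y : 𝔼} (hf : ContDiffAt ℝ 2 f y) (hg : ContDiffAt ℝ 2 g y) :
    hess (fun z => f z * g z) y = g y • hess f y + f y • hess g y +
      (vecMulVec (grad f y) (grad g y) + vecMulVec (grad g y) (grad f y)) := by
  ext i j
  have h1 : pd j (fun z => f z * g z) =ᶠ[𝓝 y] fun z => pd j f z * g z + f z * pd j g z := by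
    filter_upwards [eventually_differentiableAt hf (by norm_num),
      eventually_differentiableAt hg (by norm_num)] with z h1 h2
    exact pd_mul h1 h2 j
  have hfd := hf.differentiableAt (by norm_num : (2 : WithTop ℕ∞) ≠ 0)
  have hgd := hg.differentiableAt (by norm_num : (2 : WithTop ℕ∞) ≠ 0)
  change pd i (pd j fun z => f z * g z) y = _
  rw [pd_congr h1, pd_add ((differentiableAt_pd hf j).fun_mul hgd)
    (hfd.fun_mul (differentiableAt_pd hg j)), pd_mul (differentiableAt_pd hf j) hgd,
    pd_mul hfd (differentiableAt_pd hg j)]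
  simp only [Matrix.add_apply, Matrix.smul_apply, hess, of_apply, vecMulVec_apply, grad,
    smul_eq_mul]
  ring

theorem grad_scomp {F : ℝ → ℝ} {F' : ℝ} {f : 𝔼 → ℝ} {y : 𝔼} (hF : HasDerivAt F F' (f y))
    (hf : ContDiffAt ℝ 2 f y) : grad (fun z => F (f z)) y = F' • grad f y :=
  funext fun i => pd_scomp hF (hf.differentiableAt (by norm_num)) i

theorem hess_scomp {F F' : ℝ → ℝ} {F'' : ℝ} {f : 𝔼 → ℝ} {y : 𝔼}
    (hF : ∀ᶠ t in 𝓝 (f y), HasDerivAt F (F' t) t) (hF' : HasDerivAt F' F'' (f y))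
    (hf : ContDiffAt ℝ 2 f y) : hess (fun z => F (f z)) y =
      F' (f y) • hess f y + F'' • vecMulVec (grad f y) (grad f y) := by
  ext i j
  have hfd := hf.differentiableAt (by norm_num : (2 : WithTop ℕ∞) ≠ 0)
  have h1 : pd j (fun z => F (f z)) =ᶠ[𝓝 y] fun z => F' (f z) * pd j f z := by
    filter_upwards [eventually_differentiableAt hf (by norm_num),
      hf.continuousAt.eventually hF] with z h1 h2
    exact pd_scomp h2 h1 j
  have hd : DifferentiableAt ℝ (fun z => F' (f z)) y := hF'.differentiableAt.comp y hfd
  change pd i (pd j fun z => F (f z)) y = _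
  rw [pd_congr h1, pd_mul hd (differentiableAt_pd hf j), pd_scomp hF' hfd]
  simp only [Matrix.add_apply, Matrix.smul_apply, hess, of_apply, vecMulVec_apply, grad,
    smul_eq_mul]
  ring

/-- Behaviour of the flat Schouten tensor under a dilation of the coordinates. -/
theorem flatSchouten_affine {f : 𝔼 → ℝ} (x₀ : 𝔼) (r c : ℝ) {y : 𝔼}
    (hf : ContDiffAt ℝ 2 f (x₀ + r • y)) :
    grad (fun z => f (x₀ + r • z) + c) y = r • grad f (x₀ + r • y) ∧
    hess (fun z => f (x₀ + r • z) + c) y = r ^ 2 • hess f (x₀ + r • y) ∧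
    flatSchouten (fun z => f (x₀ + r • z) + c) y = r ^ 2 • flatSchouten f (x₀ + r • y) := by
  have hlin : ∀ y : 𝔼, HasFDerivAt (fun z : 𝔼 => x₀ + r • z) (r • ContinuousLinearMap.id ℝ 𝔼) y :=
    fun y => ((hasFDerivAt_id y).const_smul r).const_add x₀
  have hpd : ∀ {f : 𝔼 → ℝ} {y : 𝔼} (c : ℝ), DifferentiableAt ℝ f (x₀ + r • y) → ∀ i,
      pd i (fun z => f (x₀ + r • z) + c) y = r * pd i f (x₀ + r • y) := by
    intro f y c hf i
    have h1 := (hf.hasFDerivAt.comp y (hlin y)).add_const c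
    have h2 : fderiv ℝ (fun z => f (x₀ + r • z) + c) y = _ := h1.fderiv
    rw [pd, h2]; simp [pd]
  have hg : grad (fun z => f (x₀ + r • z) + c) y = r • grad f (x₀ + r • y) :=
    funext fun i => hpd c (hf.differentiableAt (by norm_num)) i
  have hh : hess (fun z => f (x₀ + r • z) + c) y = r ^ 2 • hess f (x₀ + r • y) := by
    ext i j
    have h1 : pd j (fun z => f (x₀ + r • z) + c) =ᶠ[𝓝 y]
        fun z => r * (pd j f (x₀ + r • z) + 0) := by
      have hc : ContinuousAt (fun z : 𝔼 => x₀ + r • z) y := (hlin y).continuousAt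
      filter_upwards [hc.eventually (eventually_differentiableAt hf (by norm_num))] with z hz
      rw [hpd c hz j, add_zero]
    have h2 : DifferentiableAt ℝ (fun z => pd j f (x₀ + r • z) + 0) y :=
      ((differentiableAt_pd hf j).comp y (hlin y).differentiableAt).add_const 0
    change pd i (pd j fun z => f (x₀ + r • z) + c) y = _
    rw [pd_congr h1, pd_const_mul h2, hpd 0 (differentiableAt_pd hf j)]
    simp only [Matrix.smul_apply, hess, of_apply, smul_eq_mul]
    ring
  refine ⟨hg, hh, ?_⟩
  rw [flatSchouten, flatSchouten, hg, hh, jetSchouten, jetSchouten]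
  ext i j
  simp only [Matrix.add_apply, Matrix.sub_apply, Matrix.smul_apply, vecMulVec_apply, smul_eq_mul,
    Pi.smul_apply, smul_dotProduct, dotProduct_smul]
  ring

/-- The derivative is written in terms of `a = (1 + e^t)⁻¹`, the weight of the first factor in a
soft minimum. -/
theorem hasDerivAt_softplus (κ t : ℝ) : HasDerivAt (fun t => -(κ⁻¹ * Real.log (1 + Real.exp t)))
    (-(κ⁻¹ * (1 - (1 + Real.exp t)⁻¹))) t := by
  have hpos : 0 < 1 + Real.exp t := by positivity
  have h := ((((Real.hasDerivAt_exp t).const_add 1).log hpos.ne').const_mul κ⁻¹).fun_neg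
  have e : 1 - (1 + Real.exp t)⁻¹ = Real.exp t / (1 + Real.exp t) := by
    field_simp; ring
  rw [e]
  exact h

theorem hasDerivAt_softplus_deriv (κ t : ℝ) :
    HasDerivAt (fun t => -(κ⁻¹ * (1 - (1 + Real.exp t)⁻¹)))
      (-(κ⁻¹ * ((1 + Real.exp t)⁻¹ * (1 - (1 + Real.exp t)⁻¹)))) t := by
  have hpos : 0 < 1 + Real.exp t := by positivity
  have h := (((((Real.hasDerivAt_exp t).const_add 1).fun_inv hpos.ne').const_sub 1).const_mul
    κ⁻¹).fun_neg
  have e : (1 + Real.exp t)⁻¹ * (1 - (1 + Real.exp t)⁻¹) =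
      -(-Real.exp t / (1 + Real.exp t) ^ 2) := by
    field_simp; ring
  rw [e]
  exact h

/-- The Schouten tensor of the soft minimum
`f = -κ⁻¹ log (e^{-κ f₁} + e^{-κ f₂}) = f₁ - κ⁻¹ log (1 + e^{κ (f₁ - f₂)})` of two conformal
factors. -/
theorem flatSchouten_softMin {κ : ℝ} (hκ : κ ≠ 0) {f₁ f₂ : 𝔼 → ℝ} {y : 𝔼}
    (h₁ : ContDiffAt ℝ 2 f₁ y) (h₂ : ContDiffAt ℝ 2 f₂ y) {a : ℝ}
    (ha : a = (1 + Real.exp (κ * (f₁ y - f₂ y)))⁻¹) {d : Fin n → ℝ}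
    (hd : d = grad f₁ y - grad f₂ y) :
    flatSchouten (fun z => f₁ z + -(κ⁻¹ * Real.log (1 + Real.exp (κ * (f₁ z - f₂ z))))) y =
      a • flatSchouten f₁ y + (1 - a) • flatSchouten f₂ y +
        (a * (1 - a) / 2) • ((d ⬝ᵥ d) • 1 - (2 + 2 * κ) • vecMulVec d d) := by
  have hp : ContDiffAt ℝ 2 (fun z => κ * (f₁ z - f₂ z)) y := contDiffAt_const.mul (h₁.sub h₂)
  have hgp : grad (fun z => κ * (f₁ z - f₂ z)) y = κ • d := by
    rw [grad_const_mul (h₁.sub h₂), grad_sub h₁ h₂, hd]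
  have hhp : hess (fun z => κ * (f₁ z - f₂ z)) y = κ • (hess f₁ y - hess f₂ y) := by
    rw [hess_const_mul (h₁.sub h₂), hess_sub h₁ h₂]
  have hη : ContDiffAt ℝ 2 (fun z => -(κ⁻¹ * Real.log (1 + Real.exp (κ * (f₁ z - f₂ z))))) y :=
    (contDiffAt_const.mul ((contDiffAt_const.add hp.exp).log (by positivity))).neg
  have hg := grad_add h₁ hη
  have hh := hess_add h₁ hη
  rw [grad_scomp (F := fun t => -(κ⁻¹ * Real.log (1 + Real.exp t)))
    (hasDerivAt_softplus κ _) hp, hgp, ← ha] at hg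
  rw [hess_scomp (F := fun t => -(κ⁻¹ * Real.log (1 + Real.exp t)))
    (Filter.Eventually.of_forall fun t => hasDerivAt_softplus κ t)
    (hasDerivAt_softplus_deriv κ _) hp, hgp, hhp, ← ha] at hh
  have e1 : ∀ i, grad f₁ y i = grad f₂ y i + d i := fun i => by simp [hd]
  have e2 : grad f₁ y = grad f₂ y + d := funext e1
  rw [flatSchouten, hg, hh, flatSchouten, flatSchouten, jetSchouten, jetSchouten, jetSchouten, e2]
  ext i j
  simp only [Matrix.add_apply, Matrix.sub_apply, Matrix.smul_apply, vecMulVec_apply, smul_eq_mul,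
    Pi.smul_apply, Pi.add_apply, smul_dotProduct, dotProduct_smul, add_dotProduct, dotProduct_add,
    dotProduct_comm d (grad f₂ y)]
  field_simp
  ring

/-- The gluing lemma: a soft minimum of two conformal factors with Schouten tensor in `Γ_k` has its
Schouten tensor in `Γ_k`, if the parameter `κ` is small. The difference from the convex combination
of the two tensors is a multiple of `1 - (2 + 2κ) θ θᵀ` with a unit vector `θ`. Such a `κ` exists
exactly when `k < n / 2`. -/
theorem softMin_mem_coneGamma {k : ℕ} (hk : 1 ≤ k) {κ : ℝ} (hκ : 0 < κ)
    (hκn : (2 + 2 * κ) * k < n) {f₁ f₂ : 𝔼 → ℝ} {y : 𝔼}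
    (h₁ : ContDiffAt ℝ 2 f₁ y) (h₂ : ContDiffAt ℝ 2 f₂ y)
    (m₁ : flatSchouten f₁ y ∈ coneGamma n k) (m₂ : flatSchouten f₂ y ∈ coneGamma n k) :
    flatSchouten (fun z => f₁ z + -(κ⁻¹ * Real.log (1 + Real.exp (κ * (f₁ z - f₂ z))))) y ∈
      coneGamma n k := by
  have hkr : (1 : ℝ) ≤ k := by exact_mod_cast hk
  have hkn : k < n := by
    have : (k : ℝ) < n := by nlinarith
    exact_mod_cast this
  rw [flatSchouten_softMin hκ.ne' h₁ h₂ rfl rfl]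
  set a := (1 + Real.exp (κ * (f₁ y - f₂ y)))⁻¹ with ha
  set d := grad f₁ y - grad f₂ y
  have hE := Real.exp_pos (κ * (f₁ y - f₂ y))
  have ha0 : 0 < a := by positivity
  have ha1 : a < 1 := inv_lt_one_of_one_lt₀ (by linarith)
  have hb : 0 < 1 - a := by linarith
  have hsum := add_mem_coneGamma hkn.le (smul_mem_coneGamma m₁ ha0) (smul_mem_coneGamma m₂ hb)
  by_cases hd : d ⬝ᵥ d = 0
  · have hd0 : d = 0 := dotProduct_self_eq_zero.1 hd
    have : vecMulVec d d = 0 := by rw [hd0]; ext i j; simp [vecMulVec_apply]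
    rw [hd, this]
    simpa using hsum
  · have hdd : 0 < d ⬝ᵥ d :=
      lt_of_le_of_ne (Finset.sum_nonneg fun i _ => mul_self_nonneg _) (Ne.symm hd)
    refine add_mem_coneGamma hkn.le hsum (smul_mem_coneGamma ?_ (by positivity))
    set s := √(d ⬝ᵥ d) with hs
    have hs0 : 0 < s := Real.sqrt_pos.2 hdd
    have hss : s * s = d ⬝ᵥ d := Real.mul_self_sqrt hdd.le
    have hθ : (s⁻¹ • d) ⬝ᵥ (s⁻¹ • d) = 1 := by
      rw [smul_dotProduct, dotProduct_smul, ← hss]; simp; field_simp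
    have hm := smul_mem_coneGamma (one_sub_vecMulVec_mem_coneGamma hkn hκn (by positivity) hθ) hdd
    convert hm using 1
    ext i j
    simp only [Matrix.sub_apply, Matrix.smul_apply, vecMulVec_apply, smul_eq_mul, Pi.smul_apply]
    rw [← hss]
    field_simp

end SoftMin

/-! ### Gluing a bubble into a flat chart -/

section Gluing

open Matrix MeasureTheory

variable {n : ℕ}

local notation "𝔼" => EuclideanSpace ℝ (Fin n)

/-- The 2-jet of a function at a point: value, gradient, Hessian. -/
abbrev Jet (n : ℕ) : Type := ℝ × (Fin n → ℝ) × Matrix (Fin n) (Fin n) ℝ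

/-- The 2-jet of `f` at `y`. -/
def jet (f : 𝔼 → ℝ) (y : 𝔼) : Jet n := (f y, grad f y, hess f y)

/-- The 2-jet of a product. -/
def Jet.mul (X Y : Jet n) : Jet n :=
  (X.1 * Y.1, Y.1 • X.2.1 + X.1 • Y.2.1, Y.1 • X.2.2 + X.1 • Y.2.2 +
    (vecMulVec X.2.1 Y.2.1 + vecMulVec Y.2.1 X.2.1))

/-- The 2-jet of `e^f`. -/
def Jet.exp (X : Jet n) : Jet n :=
  (Real.exp X.1, Real.exp X.1 • X.2.1,
    Real.exp X.1 • X.2.2 + Real.exp X.1 • vecMulVec X.2.1 X.2.1)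

theorem jet_mul {f g : 𝔼 → ℝ} {y : 𝔼} (hf : ContDiffAt ℝ 2 f y) (hg : ContDiffAt ℝ 2 g y) :
    jet (fun z => f z * g z) y = (jet f y).mul (jet g y) := by
  simp only [jet, Jet.mul, grad_mul hf hg, hess_mul hf hg]

theorem jet_exp {f : 𝔼 → ℝ} {y : 𝔼} (hf : ContDiffAt ℝ 2 f y) :
    jet (fun z => Real.exp (f z)) y = (jet f y).exp := by
  simp only [jet, Jet.exp, grad_scomp (Real.hasDerivAt_exp _) hf,
    hess_scomp (Filter.Eventually.of_forall Real.hasDerivAt_exp) (Real.hasDerivAt_exp _) hf]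

theorem jet_smul_sub {f g : 𝔼 → ℝ} {y : 𝔼} (κ : ℝ) (hf : ContDiffAt ℝ 2 f y)
    (hg : ContDiffAt ℝ 2 g y) :
    jet (fun z => κ * (f z - g z)) y = κ • (jet f y - jet g y) := by
  simp only [jet, grad_const_mul (hf.sub hg), hess_const_mul (hf.sub hg), grad_sub hf hg,
    hess_sub hf hg]
  rfl

theorem Jet.continuous_mul : Continuous fun p : Jet n × Jet n => p.1.mul p.2 := by
  have h1 : Continuous fun p : Jet n × Jet n => p.1.1 := by fun_prop
  have h2 : Continuous fun p : Jet n × Jet n => p.2.1 := by fun_prop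
  have h3 : Continuous fun p : Jet n × Jet n => p.1.2.1 := by fun_prop
  have h4 : Continuous fun p : Jet n × Jet n => p.2.2.1 := by fun_prop
  have h5 : Continuous fun p : Jet n × Jet n => p.1.2.2 := by fun_prop
  have h6 : Continuous fun p : Jet n × Jet n => p.2.2.2 := by fun_prop
  exact (h1.mul h2).prodMk (((h2.smul h3).add (h1.smul h4)).prodMk
    (((h2.smul h5).add (h1.smul h6)).add ((h3.matrix_vecMulVec h4).add (h4.matrix_vecMulVec h3))))

theorem Jet.continuous_exp : Continuous fun p : Jet n => p.exp := by
  have h1 : Continuous fun p : Jet n => Real.exp p.1 := by fun_prop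
  have h3 : Continuous fun p : Jet n => p.2.1 := by fun_prop
  have h5 : Continuous fun p : Jet n => p.2.2 := by fun_prop
  exact h1.prodMk ((h1.smul h3).prodMk ((h1.smul h5).add (h1.smul (h3.matrix_vecMulVec h3))))

/-- The 2-jet of `χ e^{κ (f - g)}`. -/
def glueZeta (κ : ℝ) (p : Jet n × Jet n × Jet n) : Jet n :=
  p.1.mul (Jet.exp (κ • (p.2.1 - p.2.2)))

theorem continuous_glueZeta (κ : ℝ) : Continuous (glueZeta (n := n) κ) := by
  unfold glueZeta
  refine Jet.continuous_mul.comp (f := fun p : Jet n × Jet n × Jet n =>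
    (p.1, Jet.exp (κ • (p.2.1 - p.2.2)))) (continuous_fst.prodMk (Jet.continuous_exp.comp ?_))
  have h1 : Continuous fun p : Jet n × Jet n × Jet n => p.2.1 := by fun_prop
  have h2 : Continuous fun p : Jet n × Jet n × Jet n => p.2.2 := by fun_prop
  exact (h1.sub h2).const_smul κ

/-- The flat Schouten tensor of `f - κ⁻¹ log (1 + ε ζ)`, in terms of 2-jets. -/
def glueSchouten (κ ε : ℝ) (A Z : Jet n) : Matrix (Fin n) (Fin n) ℝ :=
  jetSchouten (A.2.1 + (-(κ⁻¹ * (ε / (1 + ε * Z.1)))) • Z.2.1)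
    (A.2.2 + ((-(κ⁻¹ * (ε / (1 + ε * Z.1)))) • Z.2.2 +
      (κ⁻¹ * (ε ^ 2 / (1 + ε * Z.1) ^ 2)) • vecMulVec Z.2.1 Z.2.1))

theorem flatSchouten_eq_glueSchouten {κ ε : ℝ} {f ζ : 𝔼 → ℝ} {y : 𝔼} (hf : ContDiffAt ℝ 2 f y)
    (hζ : ContDiffAt ℝ 2 ζ y) (hpos : 0 < 1 + ε * ζ y) :
    flatSchouten (fun z => f z + -(κ⁻¹ * Real.log (1 + ε * ζ z))) y =
      glueSchouten κ ε (jet f y) (jet ζ y) := by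
  have hη : ContDiffAt ℝ 2 (fun z => -(κ⁻¹ * Real.log (1 + ε * ζ z))) y :=
    (contDiffAt_const.mul ((contDiffAt_const.add (contDiffAt_const.mul hζ)).log hpos.ne')).neg
  have hd : ∀ t, 0 < 1 + ε * t → HasDerivAt (fun t => -(κ⁻¹ * Real.log (1 + ε * t)))
      (-(κ⁻¹ * (ε / (1 + ε * t)))) t := by
    intro t ht
    have h := (((((hasDerivAt_id t).const_mul ε).const_add 1).log ht.ne').const_mul κ⁻¹).fun_neg
    simpa using h
  have hd2 : HasDerivAt (fun t => -(κ⁻¹ * (ε / (1 + ε * t))))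
      (κ⁻¹ * (ε ^ 2 / (1 + ε * ζ y) ^ 2)) (ζ y) := by
    have e : (fun t => -(κ⁻¹ * (ε / (1 + ε * t)))) = fun t => -((κ⁻¹ * ε) * (1 + ε * id t)⁻¹) := by
      funext t
      rw [div_eq_mul_inv, mul_assoc, id]
    have h := (((((hasDerivAt_id (ζ y)).const_mul ε).const_add 1).fun_inv
      hpos.ne').const_mul (κ⁻¹ * ε)).fun_neg
    rw [e]
    refine h.congr_deriv ?_
    simp only [id]
    ring
  have hev : ∀ᶠ t in 𝓝 (ζ y), HasDerivAt (fun t => -(κ⁻¹ * Real.log (1 + ε * t)))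
      (-(κ⁻¹ * (ε / (1 + ε * t)))) t := by
    have hc : ContinuousAt (fun t => 1 + ε * t) (ζ y) := by fun_prop
    filter_upwards [hc.eventually (lt_mem_nhds hpos)] with t ht
    exact hd t ht
  rw [flatSchouten, grad_add hf hη, hess_add hf hη,
    grad_scomp (F := fun t => -(κ⁻¹ * Real.log (1 + ε * t))) (hd _ hpos) hζ,
    hess_scomp (F := fun t => -(κ⁻¹ * Real.log (1 + ε * t))) hev hd2 hζ]
  rfl

theorem continuous_jetSchouten :
    Continuous fun p : (Fin n → ℝ) × Matrix (Fin n) (Fin n) ℝ => jetSchouten p.1 p.2 := by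
  unfold jetSchouten
  exact (continuous_snd.add (continuous_fst.matrix_vecMulVec continuous_fst)).sub
    (((continuous_fst.dotProduct continuous_fst).div_const 2).smul continuous_const)

theorem continuousAt_glueSchouten (κ : ℝ) {X : Type*} [TopologicalSpace X] {ε : X → ℝ}
    {A Z : X → Jet n} {x : X} (hε : ContinuousAt ε x) (hA : ContinuousAt A x)
    (hZ : ContinuousAt Z x) (hx : 1 + ε x * (Z x).1 ≠ 0) :
    ContinuousAt (fun x => glueSchouten κ (ε x) (A x) (Z x)) x := by
  have h1 : ContinuousAt (fun x => (A x).2.1) x := hA.snd.fst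
  have h2 : ContinuousAt (fun x => (A x).2.2) x := hA.snd.snd
  have h3 : ContinuousAt (fun x => (Z x).2.1) x := hZ.snd.fst
  have h4 : ContinuousAt (fun x => (Z x).2.2) x := hZ.snd.snd
  have hden : ContinuousAt (fun x => 1 + ε x * (Z x).1) x :=
    continuousAt_const.add (hε.mul hZ.fst)
  have hc : ContinuousAt (fun x => -(κ⁻¹ * (ε x / (1 + ε x * (Z x).1)))) x :=
    (continuousAt_const.mul (hε.div hden hx)).neg
  have hb : ContinuousAt (fun x => κ⁻¹ * (ε x ^ 2 / (1 + ε x * (Z x).1) ^ 2)) x :=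
    continuousAt_const.mul ((hε.pow 2).div (hden.pow 2) (pow_ne_zero 2 hx))
  have h5 : ContinuousAt (fun x => vecMulVec (Z x).2.1 (Z x).2.1) x :=
    (continuous_fst.matrix_vecMulVec continuous_snd).continuousAt.comp
      (f := fun x => ((Z x).2.1, (Z x).2.1)) (h3.prodMk h3)
  unfold glueSchouten
  exact continuous_jetSchouten.continuousAt.comp (f := fun x =>
    ((A x).2.1 + (-(κ⁻¹ * (ε x / (1 + ε x * (Z x).1)))) • (Z x).2.1,
    (A x).2.2 + ((-(κ⁻¹ * (ε x / (1 + ε x * (Z x).1)))) • (Z x).2.2 +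
      (κ⁻¹ * (ε x ^ 2 / (1 + ε x * (Z x).1) ^ 2)) • vecMulVec (Z x).2.1 (Z x).2.1)))
    ((h1.add (hc.smul h3)).prodMk (h2.add ((hc.smul h4).add (hb.smul h5))))

/-- For `ε` small the gluing keeps the Schouten tensor in `Γ_k`, uniformly over a compact set of
2-jets. -/
theorem exists_glue_pos {k : ℕ} (κ : ℝ) {K : Set (Jet n × Jet n × Jet n)} (hK : IsCompact K)
    (hpos : ∀ p ∈ K, ∀ j, 1 ≤ j → j ≤ k → 0 < sigma j (jetSchouten p.2.1.2.1 p.2.1.2.2)) :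
    ∃ ε > 0, ∀ p ∈ K, ∀ j, 1 ≤ j → j ≤ k →
      0 < sigma j (glueSchouten κ ε p.2.1 (glueZeta κ p)) := by
  have h : ∀ᶠ ε in 𝓝 (0:ℝ), ∀ p ∈ K, ∀ j, 1 ≤ j → j ≤ k →
      0 < sigma j (glueSchouten κ ε p.2.1 (glueZeta κ p)) := by
    refine hK.eventually_forall_of_forall_eventually fun p hp => ?_
    have hc : ContinuousAt (fun z : ℝ × (Jet n × Jet n × Jet n) =>
        glueSchouten κ z.1 z.2.2.1 (glueZeta κ z.2)) ((0:ℝ), p) :=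
      continuousAt_glueSchouten κ continuousAt_fst
        (by fun_prop : Continuous fun z : ℝ × (Jet n × Jet n × Jet n) => z.2.2.1).continuousAt
        ((continuous_glueZeta κ).comp continuous_snd).continuousAt (by simp)
    refine hc.eventually ((isOpen_sigma_pos k).mem_nhds ?_)
    have h0 : glueSchouten κ 0 p.2.1 (glueZeta κ p) = jetSchouten p.2.1.2.1 p.2.1.2.2 := by
      simp [glueSchouten]
    simp only [Set.mem_ofPred_eq, h0]
    exact hpos p hp
  have h2 := (h.filter_mono nhdsWithin_le_nhds).and (self_mem_nhdsWithin (s := Set.Ioi (0:ℝ)))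
  obtain ⟨ε, hε, hε0⟩ := h2.exists
  exact ⟨ε, hε0, hε⟩

/-- The glued Schouten tensors are bounded over a compact set of 2-jets with non-negative cut-off.
-/
theorem exists_glue_bound (κ : ℝ) {ε : ℝ} (hε : 0 < ε) {K : Set (Jet n × Jet n × Jet n)}
    (hK : IsCompact K) (h0 : ∀ p ∈ K, 0 ≤ p.1.1) :
    ∃ C, ∀ p ∈ K, ∀ i j, |glueSchouten κ ε p.2.1 (glueZeta κ p) i j| ≤ C := by
  have hc : ContinuousOn (fun p : Jet n × Jet n × Jet n =>
      glueSchouten κ ε p.2.1 (glueZeta κ p)) K := by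
    intro p hp
    refine ContinuousAt.continuousWithinAt ?_
    have hz : 0 ≤ (glueZeta κ p).1 := mul_nonneg (h0 p hp) (Real.exp_pos _).le
    exact continuousAt_glueSchouten κ continuousAt_const
      (by fun_prop : Continuous fun p : Jet n × Jet n × Jet n => p.2.1).continuousAt
      (continuous_glueZeta κ).continuousAt (by positivity)
  have hb : ∀ i j, ∃ C, ∀ p ∈ K, ‖glueSchouten κ ε p.2.1 (glueZeta κ p) i j‖ ≤ C := fun i j =>
    hK.exists_bound_of_continuousOn (f := fun p => glueSchouten κ ε p.2.1 (glueZeta κ p) i j)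
      fun p hp => ((continuous_apply_apply i j).continuousAt).comp_continuousWithinAt (hc p hp)
  choose C hC using hb
  refine ⟨∑ i, ∑ j, |C i j|, fun p hp i j => (hC i j p hp).trans ((le_abs_self _).trans ?_)⟩
  exact (Finset.single_le_sum (f := fun j => |C i j|) (fun j _ => abs_nonneg _)
    (Finset.mem_univ j)).trans (Finset.single_le_sum (f := fun i => ∑ j, |C i j|)
      (fun i _ => Finset.sum_nonneg fun j _ => abs_nonneg _) (Finset.mem_univ i))

theorem continuousAt_jet {f : 𝔼 → ℝ} {y : 𝔼} (hf : ContDiffAt ℝ 2 f y) : ContinuousAt (jet f) y :=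
  hf.continuousAt.prodMk ((continuousAt_pi.2 fun i => (differentiableAt_pd hf i).continuousAt).prodMk
    (continuousAt_pi.2 fun i => continuousAt_pi.2 fun j => (contDiffAt_pd (m := 0)
      (contDiffAt_pd (m := 1) (by exact_mod_cast hf) j) i).continuousAt))

end Gluing

section GlueFlat

open Matrix MeasureTheory Metric

variable {n : ℕ}

local notation "𝔼" => EuclideanSpace ℝ (Fin n)

/-- The conformal factor `e^{-2v}` is that of a metric on `ℝⁿ` with Schouten tensor in `Γ_k`, which
at infinity behaves like the round metric in stereographic coordinates. -/
structure IsBubble (k : ℕ) (C : ℝ) (v : 𝔼 → ℝ) : Prop where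
  contDiff : ContDiff ℝ 2 v
  mem_cone : ∀ y, flatSchouten v y ∈ coneGamma n k
  abs_sub_log_le : ∀ y, |v y - 2 * Real.log (1 + ‖y‖)| ≤ C
  abs_grad_le : ∀ y i, |grad v y i| ≤ C * (1 + ‖y‖)⁻¹
  abs_hess_le : ∀ y i j, |hess v y i j| ≤ C * ((1 + ‖y‖)⁻¹) ^ 2

theorem IsBubble.nonneg {k : ℕ} {C : ℝ} {v : 𝔼 → ℝ} (h : IsBubble k C v) : 0 ≤ C :=
  (abs_nonneg _).trans (h.abs_sub_log_le 0)

theorem flatSchouten_dilate {f : 𝔼 → ℝ} (r c : ℝ) {y : 𝔼} (hf : ContDiffAt ℝ 2 f (r • y)) :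
    grad (fun z => f (r • z) + c) y = r • grad f (r • y) ∧
    hess (fun z => f (r • z) + c) y = r ^ 2 • hess f (r • y) ∧
    flatSchouten (fun z => f (r • z) + c) y = r ^ 2 • flatSchouten f (r • y) := by
  have h := flatSchouten_affine (f := f) 0 r c (y := y) (by rwa [zero_add])
  simpa only [zero_add] using h

theorem abs_dotProduct_self_le {p : Fin n → ℝ} {b : ℝ} (hp : ∀ i, |p i| ≤ b) :
    |p ⬝ᵥ p| ≤ n * b ^ 2 := by
  have h : ∀ i, |p i * p i| ≤ b ^ 2 := fun i => by
    rw [abs_mul, sq]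
    exact mul_le_mul (hp i) (hp i) (abs_nonneg _) ((abs_nonneg _).trans (hp i))
  calc |p ⬝ᵥ p| ≤ ∑ i, |p i * p i| := Finset.abs_sum_le_sum_abs _ _
    _ ≤ ∑ _i : Fin n, b ^ 2 := Finset.sum_le_sum fun i _ => h i
    _ = n * b ^ 2 := by simp

theorem abs_one_apply_le (i j : Fin n) : |(1 : Matrix (Fin n) (Fin n) ℝ) i j| ≤ 1 := by
  rw [Matrix.one_apply]; split_ifs <;> simp

theorem abs_vecMulVec_self_le {p : Fin n → ℝ} {b : ℝ} (hp : ∀ i, |p i| ≤ b) (i j : Fin n) :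
    |vecMulVec p p i j| ≤ b ^ 2 := by
  rw [vecMulVec_apply, abs_mul, sq]
  exact mul_le_mul (hp i) (hp j) (abs_nonneg _) ((abs_nonneg _).trans (hp i))

theorem abs_jetSchouten_le {p : Fin n → ℝ} {H : Matrix (Fin n) (Fin n) ℝ} {B s : ℝ}
    (hp : ∀ i, |p i| ≤ B * s) (hH : ∀ i j, |H i j| ≤ B * s ^ 2) (i j : Fin n) :
    |jetSchouten p H i j| ≤ (B + (n + 1) * B ^ 2) * s ^ 2 := by
  have h1 := abs_dotProduct_self_le hp
  have h2 := abs_vecMulVec_self_le hp i j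
  have h3 := abs_one_apply_le i j
  have h4 : |p ⬝ᵥ p / 2 * (1 : Matrix (Fin n) (Fin n) ℝ) i j| ≤ n * (B * s) ^ 2 := by
    rw [abs_mul, abs_div, abs_two]
    have := mul_le_mul_of_nonneg_left h3 (by positivity : 0 ≤ |p ⬝ᵥ p| / 2)
    have := abs_nonneg (p ⬝ᵥ p)
    linarith
  simp only [jetSchouten, Matrix.sub_apply, Matrix.add_apply, Matrix.smul_apply, smul_eq_mul]
  have h5 := abs_sub (H i j + vecMulVec p p i j) (p ⬝ᵥ p / 2 * (1 : Matrix (Fin n) (Fin n) ℝ) i j)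
  have h6 := abs_add_le (H i j) (vecMulVec p p i j)
  nlinarith [hH i j]

/-- The compact set of 2-jets with all entries bounded by `B`. -/
def jetBox (n : ℕ) (B : ℝ) : Set (Jet n) :=
  Set.Icc (-B) B ×ˢ (Set.univ.pi fun _ => Set.Icc (-B) B) ×ˢ
    (Set.univ.pi fun _ => Set.univ.pi fun _ => Set.Icc (-B) B)

theorem isCompact_jetBox (B : ℝ) : IsCompact (jetBox n B) :=
  isCompact_Icc.prod ((isCompact_univ_pi fun _ => isCompact_Icc).prod
    (isCompact_univ_pi fun _ => isCompact_univ_pi fun _ => isCompact_Icc))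

theorem mem_jetBox {B : ℝ} {Z : Jet n} :
    Z ∈ jetBox n B ↔ |Z.1| ≤ B ∧ (∀ i, |Z.2.1 i| ≤ B) ∧ ∀ i j, |Z.2.2 i j| ≤ B := by
  simp only [abs_le]
  exact ⟨fun h => ⟨h.1, fun i => h.2.1 i trivial, fun i j => h.2.2 i trivial j trivial⟩,
    fun h => ⟨h.1, fun i _ => h.2.1 i, fun i _ j _ => h.2.2 i j⟩⟩

theorem exists_jetBox {K : Set (Jet n)} (hK : IsCompact K) : ∃ B, 0 ≤ B ∧ K ⊆ jetBox n B := by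
  have hc : Continuous fun Z : Jet n => |Z.1| + (∑ i, |Z.2.1 i| + ∑ i, ∑ j, |Z.2.2 i j|) := by
    have h1 : Continuous fun Z : Jet n => Z.2.2 := by fun_prop
    have h2 : ∀ i j, Continuous fun Z : Jet n => |Z.2.2 i j| := fun i j => (h1.matrix_elem i j).abs
    exact Continuous.add (by fun_prop) (Continuous.add (by fun_prop)
      (continuous_finsetSum _ fun i _ => continuous_finsetSum _ fun j _ => h2 i j))
  obtain ⟨C, hC⟩ := hK.exists_bound_of_continuousOn hc.continuousOn
  refine ⟨max C 0, le_max_right _ _, fun Z hZ => mem_jetBox.2 ?_⟩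
  have h := ((le_abs_self _).trans (hC Z hZ)).trans (le_max_left C 0)
  have h1 : ∀ i, |Z.2.1 i| ≤ ∑ i, |Z.2.1 i| := fun i =>
    Finset.single_le_sum (f := fun i => |Z.2.1 i|) (fun _ _ => abs_nonneg _) (Finset.mem_univ i)
  have h2 : ∀ i j, |Z.2.2 i j| ≤ ∑ i, ∑ j, |Z.2.2 i j| := fun i j =>
    (Finset.single_le_sum (f := fun j => |Z.2.2 i j|) (fun _ _ => abs_nonneg _)
      (Finset.mem_univ j)).trans (Finset.single_le_sum (f := fun i => ∑ j, |Z.2.2 i j|)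
        (fun _ _ => Finset.sum_nonneg fun _ _ => abs_nonneg _) (Finset.mem_univ i))
  have p0 := abs_nonneg Z.1
  have p1 : 0 ≤ ∑ i, |Z.2.1 i| := Finset.sum_nonneg fun _ _ => abs_nonneg _
  have p2 : 0 ≤ ∑ i, ∑ j, |Z.2.2 i j| :=
    Finset.sum_nonneg fun _ _ => Finset.sum_nonneg fun _ _ => abs_nonneg _
  exact ⟨by linarith, fun i => by linarith [h1 i], fun i j => by linarith [h2 i j]⟩

/-- A bubble to be glued into the conformal factor `U` on a ball: the cut-off function is `1` on the
ball of radius `χ.rIn` and vanishes outside the ball of radius `χ.rOut`, and `κ` is the parameter of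
the soft minimum. -/
structure GlueData (n k : ℕ) where
  κ : ℝ
  R : ℝ
  C : ℝ
  U : EuclideanSpace ℝ (Fin n) → ℝ
  v : EuclideanSpace ℝ (Fin n) → ℝ
  χ : ContDiffBump (0 : EuclideanSpace ℝ (Fin n))
  one_le : 1 ≤ k
  kappa_pos : 0 < κ
  kappa_lt : (2 + 2 * κ) * k < n
  rOut_lt : χ.rOut < R
  contDiffOn : ContDiffOn ℝ 2 U (ball 0 R)
  mem_cone : ∀ x ∈ ball (0 : EuclideanSpace ℝ (Fin n)) R, flatSchouten U x ∈ coneGamma n k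
  bubble : IsBubble k C v

namespace GlueData

variable {k : ℕ} (D : GlueData n k)

/-- The bubble rescaled to size `t`. -/
def scaled (t : ℝ) (x : 𝔼) : ℝ := D.v (t⁻¹ • x) + 2 * Real.log t

/-- The change of the conformal factor caused by the gluing, so that
`e^{-κ (U + eta)} = e^{-κ U} + ε χ e^{-κ scaled}`; it vanishes for `χ.rOut ≤ ‖x‖`. -/
def eta (ε t : ℝ) (x : 𝔼) : ℝ :=
  -(D.κ⁻¹ * Real.log (1 + ε * (D.χ x * Real.exp (D.κ * (D.U x - D.scaled t x)))))

/-- The glued conformal factor. -/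
def glued (ε t : ℝ) (x : 𝔼) : ℝ := D.U x + D.eta ε t x

/-- The factor `U` in coordinates rescaled by `t`, normalized as seen from the bubble. -/
def outer (ε t : ℝ) (y : 𝔼) : ℝ :=
  D.U (t • y) + (-(2 * Real.log t) + D.κ⁻¹ * Real.log ε)

/-- The glued conformal factor in coordinates rescaled by `t`, normalized as seen from the
bubble. -/
def blowup (ε t : ℝ) (y : 𝔼) : ℝ :=
  D.glued ε t (t • y) + (-(2 * Real.log t) + D.κ⁻¹ * Real.log ε)

theorem contDiffAt_U {x : 𝔼} (hx : x ∈ ball 0 D.R) : ContDiffAt ℝ 2 D.U x :=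
  D.contDiffOn.contDiffAt (isOpen_ball.mem_nhds hx)

theorem closedBall_subset : closedBall 0 D.χ.rOut ⊆ ball (0 : 𝔼) D.R :=
  closedBall_subset_ball D.rOut_lt

theorem contDiff_scaled (t : ℝ) : ContDiff ℝ 2 (D.scaled t) :=
  (D.bubble.contDiff.comp (contDiff_const_smul t⁻¹)).add contDiff_const

theorem contDiffAt_zeta (t : ℝ) {x : 𝔼} (hx : x ∈ ball 0 D.R) :
    ContDiffAt ℝ 2 (fun x => D.χ x * Real.exp (D.κ * (D.U x - D.scaled t x))) x :=
  D.χ.contDiffAt.mul (contDiffAt_const.mul ((D.contDiffAt_U hx).sub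
    (D.contDiff_scaled t).contDiffAt)).exp

theorem one_add_pos {ε : ℝ} (hε : 0 < ε) (t : ℝ) (x : 𝔼) :
    0 < 1 + ε * (D.χ x * Real.exp (D.κ * (D.U x - D.scaled t x))) := by
  have := D.χ.nonneg' x
  positivity

theorem contDiffAt_glued {ε : ℝ} (hε : 0 < ε) (t : ℝ) {x : 𝔼} (hx : x ∈ ball 0 D.R) :
    ContDiffAt ℝ 2 (D.glued ε t) x :=
  (D.contDiffAt_U hx).add (contDiffAt_const.mul ((contDiffAt_const.add
    (contDiffAt_const.mul (D.contDiffAt_zeta t hx))).log (D.one_add_pos hε t x).ne')).neg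

theorem eta_eq_zero (ε t : ℝ) {x : 𝔼} (hx : D.χ.rOut ≤ ‖x‖) : D.eta ε t x = 0 := by
  rw [eta, D.χ.zero_of_le_dist (by rwa [dist_zero_right])]; simp

/-- Where the cut-off function is `1`, the glued factor is a soft minimum. -/
theorem blowup_eventuallyEq {ε t : ℝ} (hε : 0 < ε) (ht : 0 < t) {y : 𝔼}
    (hy : ‖t • y‖ < D.χ.rIn) :
    D.blowup ε t =ᶠ[𝓝 y] fun z => D.outer ε t z +
      -(D.κ⁻¹ * Real.log (1 + Real.exp (D.κ * (D.outer ε t z - D.v z)))) := by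
  have hc : ContinuousAt (fun z : 𝔼 => ‖t • z‖) y := by fun_prop
  filter_upwards [hc.eventually (gt_mem_nhds hy)] with z hz
  have h1 : D.χ (t • z) = 1 := D.χ.one_of_mem_closedBall (by simpa using hz.le)
  have h2 : ε * (1 * Real.exp (D.κ * (D.U (t • z) - D.scaled t (t • z)))) =
      Real.exp (D.κ * (D.outer ε t z - D.v z)) := by
    have := D.kappa_pos.ne'
    rw [scaled, outer, smul_smul, inv_mul_cancel₀ ht.ne', one_smul, one_mul]
    nth_rewrite 1 [← Real.exp_log hε]
    rw [← Real.exp_add]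
    congr 1
    field_simp
    ring
  rw [blowup, glued, eta, h1, h2, outer]
  ring

theorem flatSchouten_outer {ε t : ℝ} {y : 𝔼} (hy : t • y ∈ ball (0 : 𝔼) D.R) :
    grad (D.outer ε t) y = t • grad D.U (t • y) ∧
    flatSchouten (D.outer ε t) y = t ^ 2 • flatSchouten D.U (t • y) :=
  have h := flatSchouten_dilate (f := D.U) t (-(2 * Real.log t) + D.κ⁻¹ * Real.log ε)
    (D.contDiffAt_U hy)
  ⟨h.1, h.2.2⟩

theorem contDiffAt_outer {ε t : ℝ} {y : 𝔼} (hy : t • y ∈ ball (0 : 𝔼) D.R) :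
    ContDiffAt ℝ 2 (D.outer ε t) y :=
  (ContDiffAt.comp y (D.contDiffAt_U hy) (contDiff_const_smul t).contDiffAt).add contDiffAt_const

theorem flatSchouten_blowup {ε t : ℝ} (hε : 0 < ε) {y : 𝔼} (hy : t • y ∈ ball (0 : 𝔼) D.R) :
    flatSchouten (D.blowup ε t) y = t ^ 2 • flatSchouten (D.glued ε t) (t • y) :=
  (flatSchouten_dilate (f := D.glued ε t) t (-(2 * Real.log t) + D.κ⁻¹ * Real.log ε)
    (D.contDiffAt_glued hε t hy)).2.2

theorem rIn_lt : D.χ.rIn < D.R := D.χ.rIn_lt_rOut.trans D.rOut_lt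

/-- Inside the ball where the cut-off function is `1` no smallness of `ε` is needed: the constant
`κ⁻¹ log ε` only shifts one of the two factors of the soft minimum. -/
theorem flatSchouten_glued_mem_of_lt {ε t : ℝ} (hε : 0 < ε) (ht : 0 < t) {x : 𝔼}
    (hx : ‖x‖ < D.χ.rIn) : flatSchouten (D.glued ε t) x ∈ coneGamma n k := by
  have hxy : t • (t⁻¹ • x) = x := by rw [smul_smul, mul_inv_cancel₀ ht.ne', one_smul]
  have hxR : t • (t⁻¹ • x) ∈ ball (0 : 𝔼) D.R := by
    rw [hxy, mem_ball_zero_iff]; exact hx.trans D.rIn_lt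
  have h1 : flatSchouten (D.blowup ε t) (t⁻¹ • x) ∈ coneGamma n k := by
    rw [flatSchouten_congr (D.blowup_eventuallyEq hε ht (by rwa [hxy]))]
    refine softMin_mem_coneGamma D.one_le D.kappa_pos D.kappa_lt (D.contDiffAt_outer hxR)
      D.bubble.contDiff.contDiffAt ?_ (D.bubble.mem_cone _)
    rw [(D.flatSchouten_outer hxR).2]
    exact smul_mem_coneGamma (D.mem_cone _ hxR) (by positivity)
  rw [D.flatSchouten_blowup hε hxR, hxy] at h1
  have h2 := smul_mem_coneGamma h1 (c := (t ^ 2)⁻¹) (by positivity)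
  rwa [smul_smul, inv_mul_cancel₀ (by positivity), one_smul] at h2

/-- On the annulus where the cut-off takes place, the 2-jets of the rescaled bubbles are bounded
uniformly in the scale. -/
theorem exists_jet_scaled_mem : ∃ B, ∀ t, 0 < t → t ≤ 1 → ∀ x : 𝔼, D.χ.rIn ≤ ‖x‖ →
    ‖x‖ ≤ D.χ.rOut → jet (D.scaled t) x ∈ jetBox n B := by
  have hr := D.χ.rIn_pos
  have hr2 := D.χ.rOut_pos
  have hC := D.bubble.nonneg
  refine ⟨(D.C + 2 * (1 + D.χ.rOut + D.χ.rIn⁻¹)) + D.C * D.χ.rIn⁻¹ + D.C * (D.χ.rIn⁻¹) ^ 2,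
    fun t ht ht1 x hx1 hx2 => ?_⟩
  have hf : ContDiffAt ℝ 2 D.v (t⁻¹ • x) := D.bubble.contDiff.contDiffAt
  obtain ⟨hg, hh, -⟩ := flatSchouten_dilate t⁻¹ (2 * Real.log t) hf
  have hs : t * (1 + ‖t⁻¹ • x‖) = t + ‖x‖ := by
    rw [norm_smul, norm_inv, Real.norm_of_nonneg ht.le]; field_simp
  have hpos : 0 < 1 + ‖t⁻¹ • x‖ := by positivity
  have hinv : t⁻¹ * (1 + ‖t⁻¹ • x‖)⁻¹ ≤ D.χ.rIn⁻¹ := by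
    rw [← mul_inv, hs]
    exact inv_anti₀ hr (by linarith)
  have hinv0 : 0 ≤ t⁻¹ * (1 + ‖t⁻¹ • x‖)⁻¹ := by positivity
  have hri : 0 < D.χ.rIn⁻¹ := by positivity
  have h0 : (0:ℝ) ≤ D.C * D.χ.rIn⁻¹ := by positivity
  have h00 : (0:ℝ) ≤ D.C * (D.χ.rIn⁻¹) ^ 2 := by positivity
  refine mem_jetBox.2 ⟨?_, fun i => ?_, fun i j => ?_⟩
  · have h1 := D.bubble.abs_sub_log_le (t⁻¹ • x)
    have h2 : Real.log (t + ‖x‖) = Real.log t + Real.log (1 + ‖t⁻¹ • x‖) := by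
      rw [← hs, Real.log_mul ht.ne' hpos.ne']
    have htx : 0 < t + ‖x‖ := by linarith [norm_nonneg x]
    have h3 := Real.log_le_sub_one_of_pos htx
    have h4 := Real.one_sub_inv_le_log_of_pos htx
    have h5 : (t + ‖x‖)⁻¹ ≤ D.χ.rIn⁻¹ := inv_anti₀ hr (by linarith)
    change |D.v (t⁻¹ • x) + 2 * Real.log t| ≤ _
    rw [abs_le] at h1 ⊢
    constructor <;> linarith [h1.1, h1.2]
  · change |grad (fun z => D.v (t⁻¹ • z) + 2 * Real.log t) x i| ≤ _
    have h1 := D.bubble.abs_grad_le (t⁻¹ • x) i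
    have h2 : |(t⁻¹ • grad D.v (t⁻¹ • x)) i| ≤ D.C * D.χ.rIn⁻¹ := by
      rw [Pi.smul_apply, smul_eq_mul, abs_mul, abs_of_pos (inv_pos.2 ht)]
      calc t⁻¹ * |grad D.v (t⁻¹ • x) i| ≤ t⁻¹ * (D.C * (1 + ‖t⁻¹ • x‖)⁻¹) := by gcongr
        _ = D.C * (t⁻¹ * (1 + ‖t⁻¹ • x‖)⁻¹) := by ring
        _ ≤ _ := by gcongr
    rw [hg]; linarith
  · change |hess (fun z => D.v (t⁻¹ • z) + 2 * Real.log t) x i j| ≤ _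
    have h1 := D.bubble.abs_hess_le (t⁻¹ • x) i j
    have h2 : |((t⁻¹) ^ 2 • hess D.v (t⁻¹ • x)) i j| ≤ D.C * (D.χ.rIn⁻¹) ^ 2 := by
      rw [Matrix.smul_apply, smul_eq_mul, abs_mul, abs_of_pos (by positivity)]
      calc t⁻¹ ^ 2 * |hess D.v (t⁻¹ • x) i j| ≤ t⁻¹ ^ 2 * (D.C * ((1 + ‖t⁻¹ • x‖)⁻¹) ^ 2) := by
            gcongr
        _ = D.C * (t⁻¹ * (1 + ‖t⁻¹ • x‖)⁻¹) ^ 2 := by ring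
        _ ≤ _ := by gcongr
    rw [hh]; linarith

theorem isCompact_jet_U : IsCompact (jet D.U '' closedBall 0 D.χ.rOut) :=
  (isCompact_closedBall _ _).image_of_continuousOn fun _ hx =>
    (continuousAt_jet (D.contDiffAt_U (D.closedBall_subset hx))).continuousWithinAt

theorem isCompact_jet_cutoff : IsCompact (jet D.χ '' closedBall 0 D.χ.rOut) :=
  (isCompact_closedBall _ _).image_of_continuousOn fun _ _ =>
    (continuousAt_jet D.χ.contDiffAt).continuousWithinAt

theorem flatSchouten_glued {ε : ℝ} (hε : 0 < ε) (t : ℝ) {x : 𝔼} (hx : x ∈ ball 0 D.R) :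
    flatSchouten (D.glued ε t) x =
      glueSchouten D.κ ε (jet D.U x) (glueZeta D.κ (jet D.χ x, jet D.U x, jet (D.scaled t) x)) := by
  have hU := D.contDiffAt_U hx
  have hv := (D.contDiff_scaled t).contDiffAt (x := x)
  have hd : ContDiffAt ℝ 2 (fun z => D.κ * (D.U z - D.scaled t z)) x :=
    contDiffAt_const.mul (hU.sub hv)
  have h1 := flatSchouten_eq_glueSchouten (κ := D.κ) hU (D.contDiffAt_zeta t hx)
    (D.one_add_pos hε t x)
  rw [jet_mul D.χ.contDiffAt hd.exp, jet_exp hd, jet_smul_sub D.κ hU hv] at h1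
  exact h1

/-- For a small enough `ε` the glued factor has its Schouten tensor in `Γ_k`, for all scales: where
the cut-off function is `1` because it is a soft minimum, and on the annulus because `Γ_k` is
open. -/
theorem exists_glued_mem : ∃ ε > 0, ∀ t, 0 < t → t ≤ 1 → ∀ x ∈ ball (0 : 𝔼) D.R,
    flatSchouten (D.glued ε t) x ∈ coneGamma n k := by
  obtain ⟨B, hB⟩ := D.exists_jet_scaled_mem
  obtain ⟨ε, hε, hpos⟩ := exists_glue_pos (k := k) D.κ
    (D.isCompact_jet_cutoff.prod (D.isCompact_jet_U.prod (isCompact_jetBox (n := n) B))) (by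
      rintro ⟨X, A, Z⟩ ⟨-, ⟨x, hx, rfl⟩, -⟩ j h1 h2
      exact (D.mem_cone x (D.closedBall_subset hx)).2 j h1 h2)
  refine ⟨ε, hε, fun t ht ht1 x hx => ?_⟩
  rcases lt_or_ge ‖x‖ D.χ.rIn with h1 | h1
  · exact D.flatSchouten_glued_mem_of_lt hε ht h1
  rcases le_or_gt ‖x‖ D.χ.rOut with h2 | h2
  · have hx' : x ∈ closedBall (0 : 𝔼) D.χ.rOut := by simpa using h2
    refine ⟨jetSchouten_isSymm _ (hess_isSymm (D.contDiffAt_glued hε t hx)), fun j hj1 hj2 => ?_⟩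
    rw [D.flatSchouten_glued hε t hx]
    exact hpos (jet D.χ x, jet D.U x, jet (D.scaled t) x)
      ⟨⟨x, hx', rfl⟩, ⟨x, hx', rfl⟩, hB t ht ht1 x h1 h2⟩ j hj1 hj2
  · have hev : D.glued ε t =ᶠ[𝓝 x] D.U := by
      filter_upwards [continuous_norm.continuousAt.eventually (lt_mem_nhds h2)] with z hz
      rw [glued, D.eta_eq_zero ε t hz.le, add_zero]
    rw [flatSchouten_congr hev]
    exact D.mem_cone x hx

end GlueData

end GlueFlat

/-! ### Concentration of the glued metrics -/

section GlueLimit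

open Matrix MeasureTheory Metric Filter
open scoped Pointwise

variable {n : ℕ}

local notation "𝔼" => EuclideanSpace ℝ (Fin n)

theorem continuousAt_flatDensity {f : 𝔼 → ℝ} {y : 𝔼} (hf : ContDiffAt ℝ 2 f y) (j : ℕ) :
    ContinuousAt (flatDensity j f) y :=
  ((continuousAt_const.mul hf.continuousAt).rexp).mul
    ((continuous_sigma j).continuousAt.comp (continuousAt_flatSchouten hf))

/-- A bound `O(s²)` for the entries of a matrix gives a bound `O(s^{2j})` for `sigma j`. -/
theorem exists_abs_sigma_le (n j : ℕ) (B : ℝ) : ∃ C, 0 ≤ C ∧ ∀ (A : Matrix (Fin n) (Fin n) ℝ)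
    (s : ℝ), 0 < s → (∀ i i', |A i i'| ≤ B * s ^ 2) → |sigma j A| ≤ C * s ^ (2 * j) := by
  have hK : IsCompact (Set.univ.pi fun _ => Set.univ.pi fun _ => Set.Icc (-B) B :
      Set (Matrix (Fin n) (Fin n) ℝ)) :=
    isCompact_univ_pi fun _ => isCompact_univ_pi fun _ => isCompact_Icc
  obtain ⟨C, hC⟩ := hK.exists_bound_of_continuousOn (continuous_sigma (n := n) j).continuousOn
  refine ⟨max C 0, le_max_right _ _, fun A s hs hA => ?_⟩
  have h1 : A = s ^ 2 • ((s ^ 2)⁻¹ • A) := by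
    rw [smul_smul, mul_inv_cancel₀ (by positivity), one_smul]
  have h2 : (s ^ 2)⁻¹ • A ∈ (Set.univ.pi fun _ => Set.univ.pi fun _ => Set.Icc (-B) B :
      Set (Matrix (Fin n) (Fin n) ℝ)) := by
    intro i _ i' _
    rw [Set.mem_Icc, ← abs_le, Matrix.smul_apply, smul_eq_mul, abs_mul,
      abs_of_pos (by positivity), inv_mul_le_iff₀ (by positivity), mul_comm]
    exact hA i i'
  rw [h1, sigma_smul, abs_mul, abs_of_pos (by positivity), ← pow_mul, mul_comm]
  gcongr
  exact (hC _ h2).trans (le_max_left _ _)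

namespace GlueData

variable {k : ℕ} (D : GlueData n k)

theorem mem_ball_of_le {x : 𝔼} (hx : ‖x‖ ≤ D.χ.rOut) : x ∈ ball (0 : 𝔼) D.R :=
  D.closedBall_subset (by simpa using hx)

theorem exists_bound_U : ∃ B, 0 ≤ B ∧ ∀ x : 𝔼, ‖x‖ ≤ D.χ.rOut → |D.U x| ≤ B ∧
    (∀ i, |grad D.U x i| ≤ B) ∧ ∀ i j, |flatSchouten D.U x i j| ≤ B + (n + 1) * B ^ 2 := by
  obtain ⟨B, hB0, hB⟩ := exists_jetBox D.isCompact_jet_U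
  refine ⟨B, hB0, fun x hx => ?_⟩
  obtain ⟨h1, h2, h3⟩ := mem_jetBox.1 (hB ⟨x, by simpa using hx, rfl⟩)
  refine ⟨h1, h2, fun i j => ?_⟩
  have := abs_jetSchouten_le (p := grad D.U x) (H := hess D.U x) (B := B) (s := 1)
    (fun i => (h2 i).trans_eq (mul_one B).symm) (fun i j => (h3 i j).trans_eq (by ring)) i j
  exact this.trans_eq (by ring)

theorem exists_bound_annulus {ε : ℝ} (hε : 0 < ε) : ∃ B, 0 ≤ B ∧ ∀ t, 0 < t → t ≤ 1 → ∀ x : 𝔼,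
    D.χ.rIn ≤ ‖x‖ → ‖x‖ ≤ D.χ.rOut → ∀ i j, |flatSchouten (D.glued ε t) x i j| ≤ B := by
  obtain ⟨B, hB⟩ := D.exists_jet_scaled_mem
  obtain ⟨C, hC⟩ := exists_glue_bound D.κ hε
    (D.isCompact_jet_cutoff.prod (D.isCompact_jet_U.prod (isCompact_jetBox (n := n) B))) (by
      rintro ⟨X, A, Z⟩ ⟨⟨x, hx, rfl⟩, -, -⟩
      exact D.χ.nonneg)
  refine ⟨max C 0, le_max_right _ _, fun t ht ht1 x h1 h2 i j => ?_⟩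
  have hx' : x ∈ closedBall (0 : 𝔼) D.χ.rOut := by simpa using h2
  rw [D.flatSchouten_glued hε t (D.closedBall_subset hx')]
  exact (hC (jet D.χ x, jet D.U x, jet (D.scaled t) x)
    ⟨⟨x, hx', rfl⟩, ⟨x, hx', rfl⟩, hB t ht ht1 x h1 h2⟩ i j).trans (le_max_left _ _)

/-- In the rescaled coordinates, the Schouten tensor of the glued factor is dominated by that of
the bubble, uniformly in the scale. -/
theorem exists_bound_blowup {ε : ℝ} (hε : 0 < ε) : ∃ B, ∀ t, 0 < t → t ≤ 1 → ∀ y : 𝔼,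
    ‖t • y‖ ≤ D.χ.rOut → ∀ i j,
      |flatSchouten (D.blowup ε t) y i j| ≤ B * ((1 + ‖y‖)⁻¹) ^ 2 := by
  obtain ⟨B₁, hB₁, hU⟩ := D.exists_bound_U
  obtain ⟨B₃, hB₃, hA⟩ := D.exists_bound_annulus hε
  have hC := D.bubble.nonneg
  have hr := D.χ.rOut_pos
  have hκ := D.kappa_pos
  set m := 1 + D.χ.rOut with hm
  set q := m * B₁ + D.C with hq
  have hm0 : 0 < m := by positivity
  have hq0 : 0 ≤ q := by positivity
  set B₂ := D.C + (n + 1) * D.C ^ 2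
  set B₁' := B₁ + (n + 1) * B₁ ^ 2
  have hB₁' : 0 ≤ B₁' := by positivity
  have hB₂ : 0 ≤ B₂ := by positivity
  refine ⟨(B₁' * m ^ 2 + B₂ + (n + (2 + 2 * D.κ)) * q ^ 2) + B₃ * m ^ 2,
    fun t ht ht1 y hy i j => ?_⟩
  set s := (1 + ‖y‖)⁻¹ with hs
  have hs0 : 0 < s := by positivity
  have hnorm : ‖t • y‖ = t * ‖y‖ := by rw [norm_smul, Real.norm_of_nonneg ht.le]
  have hts : t ≤ m * s := by
    rw [hs, ← div_eq_mul_inv, le_div_iff₀ (by positivity)]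
    rw [hnorm] at hy
    linarith
  have hR : t • y ∈ ball (0 : 𝔼) D.R := D.mem_ball_of_le hy
  have ht2 : t ^ 2 ≤ m ^ 2 * s ^ 2 := by rw [← mul_pow]; gcongr
  obtain ⟨-, hU2, hU3⟩ := hU _ hy
  have hP3 : 0 ≤ B₃ * m ^ 2 * s ^ 2 := by positivity
  have hP1 : 0 ≤ (B₁' * m ^ 2 + B₂ + (n + (2 + 2 * D.κ)) * q ^ 2) * s ^ 2 := by positivity
  rw [add_mul]
  rcases lt_or_ge ‖t • y‖ D.χ.rIn with h1 | h1
  · refine le_trans ?_ (le_add_of_nonneg_right hP3)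
    rw [flatSchouten_congr (D.blowup_eventuallyEq hε ht h1), flatSchouten_softMin hκ.ne'
      (D.contDiffAt_outer hR) D.bubble.contDiff.contDiffAt rfl rfl]
    set a := (1 + Real.exp (D.κ * (D.outer ε t y - D.v y)))⁻¹ with ha
    set d := grad (D.outer ε t) y - grad D.v y with hd
    have ha0 : 0 ≤ a := by positivity
    have ha1 : a ≤ 1 := inv_le_one_of_one_le₀ (by
      linarith [Real.exp_pos (D.κ * (D.outer ε t y - D.v y))])
    have e1 : |flatSchouten (D.outer ε t) y i j| ≤ B₁' * m ^ 2 * s ^ 2 := by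
      rw [(D.flatSchouten_outer hR).2, Matrix.smul_apply, smul_eq_mul, abs_mul,
        abs_of_pos (by positivity)]
      calc t ^ 2 * |flatSchouten D.U (t • y) i j| ≤ m ^ 2 * s ^ 2 * B₁' :=
            mul_le_mul ht2 (hU3 i j) (abs_nonneg _) (by positivity)
        _ = _ := by ring
    have e2 : |flatSchouten D.v y i j| ≤ B₂ * s ^ 2 :=
      abs_jetSchouten_le (D.bubble.abs_grad_le y) (D.bubble.abs_hess_le y) i j
    have e3 : ∀ i, |d i| ≤ q * s := fun i => by
      have h2 := D.bubble.abs_grad_le y i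
      have h3 : |grad (D.outer ε t) y i| ≤ m * B₁ * s := by
        rw [(D.flatSchouten_outer hR).1, Pi.smul_apply, smul_eq_mul, abs_mul, abs_of_pos ht]
        calc t * |grad D.U (t • y) i| ≤ m * s * B₁ :=
              mul_le_mul hts (hU2 i) (abs_nonneg _) (by positivity)
          _ = _ := by ring
      have h4 := abs_sub (grad (D.outer ε t) y i) (grad D.v y i)
      rw [hd, Pi.sub_apply, hq, add_mul]
      linarith
    have e4 := abs_dotProduct_self_le e3
    have e5 := abs_vecMulVec_self_le e3 i j
    have e6 := abs_one_apply_le i j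
    simp only [Matrix.add_apply, Matrix.sub_apply, Matrix.smul_apply, smul_eq_mul]
    generalize flatSchouten (D.outer ε t) y i j = x₁ at e1 ⊢
    generalize flatSchouten D.v y i j = x₂ at e2 ⊢
    generalize vecMulVec d d i j = x₃ at e5 ⊢
    generalize d ⬝ᵥ d = x₄ at e4 ⊢
    generalize (1 : Matrix (Fin n) (Fin n) ℝ) i j = x₅ at e6 ⊢
    have hb0 : 0 ≤ 1 - a := by linarith
    have hab : a * (1 - a) / 2 ≤ 1 := by nlinarith
    have f1 : |a * x₁| ≤ B₁' * m ^ 2 * s ^ 2 := by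
      rw [abs_mul, abs_of_nonneg ha0]
      exact (mul_le_of_le_one_left (abs_nonneg _) ha1).trans e1
    have f2 : |(1 - a) * x₂| ≤ B₂ * s ^ 2 := by
      rw [abs_mul, abs_of_nonneg hb0]
      exact (mul_le_of_le_one_left (abs_nonneg _) (by linarith)).trans e2
    have f3 : |a * (1 - a) / 2 * (x₄ * x₅ - (2 + 2 * D.κ) * x₃)| ≤
        n * (q * s) ^ 2 + (2 + 2 * D.κ) * (q * s) ^ 2 := by
      rw [abs_mul, abs_of_nonneg (by positivity : 0 ≤ a * (1 - a) / 2)]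
      refine (mul_le_of_le_one_left (abs_nonneg _) hab).trans ((abs_sub _ _).trans ?_)
      rw [abs_mul, abs_mul, abs_of_pos (by positivity : 0 < 2 + 2 * D.κ)]
      exact add_le_add ((mul_le_of_le_one_right (abs_nonneg _) e6).trans e4)
        (mul_le_mul_of_nonneg_left e5 (by positivity))
    calc |a * x₁ + (1 - a) * x₂ + a * (1 - a) / 2 * (x₄ * x₅ - (2 + 2 * D.κ) * x₃)|
        ≤ _ := abs_add_le _ _
      _ ≤ (B₁' * m ^ 2 * s ^ 2 + B₂ * s ^ 2) + (n * (q * s) ^ 2 + (2 + 2 * D.κ) * (q * s) ^ 2) :=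
        add_le_add ((abs_add_le _ _).trans (add_le_add f1 f2)) f3
      _ = _ := by ring
  · refine le_trans ?_ (le_add_of_nonneg_left hP1)
    rw [D.flatSchouten_blowup hε hR, Matrix.smul_apply, smul_eq_mul, abs_mul,
      abs_of_pos (by positivity)]
    calc t ^ 2 * |flatSchouten (D.glued ε t) (t • y) i j| ≤ m ^ 2 * s ^ 2 * B₃ :=
          mul_le_mul ht2 (hA t ht ht1 _ h1 hy i j) (abs_nonneg _) (by positivity)
      _ = _ := by ring

/-- Seen from the bubble, the glued factor is a soft minimum of `outer` and the bubble, the latter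
with the cut-off function as weight. -/
theorem exp_neg_blowup {ε t : ℝ} (hε : 0 < ε) (ht : 0 < t) (y : 𝔼) :
    Real.exp (-(D.κ * D.blowup ε t y)) =
      Real.exp (-(D.κ * D.outer ε t y)) + D.χ (t • y) * Real.exp (-(D.κ * D.v y)) := by
  have hκ := D.kappa_pos.ne'
  have h0 := D.one_add_pos hε t (t • y)
  have h1 : -(D.κ * D.blowup ε t y) = -(D.κ * D.outer ε t y) +
      Real.log (1 + ε * (D.χ (t • y) * Real.exp (D.κ * (D.U (t • y) - D.scaled t (t • y))))) := by
    rw [blowup, glued, eta, outer]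
    field_simp
    ring
  have h2 : Real.exp (-(D.κ * D.outer ε t y)) *
      (ε * Real.exp (D.κ * (D.U (t • y) - D.scaled t (t • y)))) = Real.exp (-(D.κ * D.v y)) := by
    nth_rewrite 2 [← Real.exp_log hε]
    rw [← Real.exp_add, ← Real.exp_add, scaled, outer, smul_smul, inv_mul_cancel₀ ht.ne', one_smul]
    congr 1
    field_simp
    ring
  rw [h1, Real.exp_add, Real.exp_log h0, ← h2]
  ring

/-- The density of the volume decays like that of the round metric, uniformly in the scale. -/
theorem exists_bound_neg_blowup {ε : ℝ} (hε : 0 < ε) : ∃ L, ∀ t, 0 < t → t ≤ 1 → ∀ y : 𝔼,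
    ‖t • y‖ ≤ D.χ.rOut → -D.blowup ε t y ≤ L - 2 * Real.log (1 + ‖y‖) := by
  obtain ⟨B₁, hB₁, hU⟩ := D.exists_bound_U
  have hr := D.χ.rOut_pos
  have hκ := D.kappa_pos
  have hC := D.bubble.nonneg
  set m := 1 + D.χ.rOut with hm
  have hm0 : 0 < m := by positivity
  have hm1 : 0 ≤ Real.log m := Real.log_nonneg (by linarith)
  set L := (B₁ + 2 * Real.log m + |D.κ⁻¹ * Real.log ε|) + D.C with hL
  refine ⟨D.κ⁻¹ * Real.log 2 + L, fun t ht ht1 y hy => ?_⟩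
  have hy0 : 0 < 1 + ‖y‖ := by positivity
  have h1 : -D.outer ε t y ≤ L - 2 * Real.log (1 + ‖y‖) := by
    have e1 : Real.log (t * (1 + ‖y‖)) ≤ Real.log m := by
      refine Real.log_le_log (by positivity) ?_
      rw [norm_smul, Real.norm_of_nonneg ht.le] at hy
      linarith
    rw [Real.log_mul ht.ne' hy0.ne'] at e1
    have e2 := neg_abs_le (D.U (t • y))
    have e3 := neg_abs_le (D.κ⁻¹ * Real.log ε)
    have e4 := (hU _ hy).1
    rw [outer, hL]
    linarith
  have h2 : -D.v y ≤ L - 2 * Real.log (1 + ‖y‖) := by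
    have e1 := (abs_le.1 (D.bubble.abs_sub_log_le y)).1
    have e2 := abs_nonneg (D.κ⁻¹ * Real.log ε)
    rw [hL]
    linarith
  have h3 : Real.exp (-(D.κ * D.blowup ε t y)) ≤
      2 * Real.exp (D.κ * (L - 2 * Real.log (1 + ‖y‖))) := by
    rw [D.exp_neg_blowup hε ht]
    have e1 : Real.exp (-(D.κ * D.outer ε t y)) ≤ Real.exp (D.κ * (L - 2 * Real.log (1 + ‖y‖))) := by
      rw [Real.exp_le_exp, ← mul_neg]; gcongr
    have e2 : Real.exp (-(D.κ * D.v y)) ≤ Real.exp (D.κ * (L - 2 * Real.log (1 + ‖y‖))) := by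
      rw [Real.exp_le_exp, ← mul_neg]; gcongr
    have e3 := mul_le_of_le_one_left (Real.exp_pos (-(D.κ * D.v y))).le (D.χ.le_one (x := t • y))
    linarith
  have h4 := Real.log_le_log (Real.exp_pos _) h3
  rw [Real.log_exp, Real.log_mul (by norm_num) (Real.exp_pos _).ne', Real.log_exp] at h4
  have h5 := mul_le_mul_of_nonneg_left h4 (inv_pos.2 hκ).le
  have e1 : D.κ⁻¹ * -(D.κ * D.blowup ε t y) = -D.blowup ε t y := by field_simp
  have e2 : D.κ⁻¹ * (Real.log 2 + D.κ * (L - 2 * Real.log (1 + ‖y‖))) =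
      D.κ⁻¹ * Real.log 2 + (L - 2 * Real.log (1 + ‖y‖)) := by field_simp
  rw [e1, e2] at h5
  linarith

theorem tendsto_smul_zero (y : 𝔼) : Tendsto (fun t : ℝ => t • y) (𝓝[>] 0) (𝓝 (0 : 𝔼)) := by
  have h : Tendsto (fun t : ℝ => t • y) (𝓝 0) (𝓝 ((0 : ℝ) • y)) :=
    (continuous_id.smul continuous_const).tendsto 0
  rw [zero_smul] at h
  exact h.mono_left nhdsWithin_le_nhds

theorem eventually_norm_smul_lt {r : ℝ} (hr : 0 < r) (y : 𝔼) : ∀ᶠ t : ℝ in 𝓝[>] 0, ‖t • y‖ < r := by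
  have h := (tendsto_smul_zero y).norm
  rw [norm_zero] at h
  exact h.eventually (gt_mem_nhds hr)

theorem zero_mem : (0 : 𝔼) ∈ ball (0 : 𝔼) D.R := D.mem_ball_of_le (by simpa using D.χ.rOut_pos.le)

/-- Seen from the bubble, the factor `U` recedes to infinity and drops out of the soft minimum. -/
theorem tendsto_outer (ε : ℝ) (y : 𝔼) : Tendsto (fun t => D.outer ε t y) (𝓝[>] 0) atTop := by
  have h1 : Tendsto (fun t : ℝ => D.U (t • y)) (𝓝[>] 0) (𝓝 (D.U 0)) :=
    (D.contDiffAt_U D.zero_mem).continuousAt.tendsto.comp (tendsto_smul_zero y)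
  refine h1.add_atTop (tendsto_atTop_add_const_right _ _ ?_)
  refine tendsto_neg_atBot_atTop.comp ?_
  exact (Real.tendsto_log_nhdsGT_zero).const_mul_atBot (by norm_num)

theorem tendsto_blowup {ε : ℝ} (hε : 0 < ε) (y : 𝔼) :
    Tendsto (fun t => D.blowup ε t y) (𝓝[>] 0) (𝓝 (D.v y)) := by
  have hκ := D.kappa_pos
  have h1 : Tendsto (fun t => Real.exp (-(D.κ * D.outer ε t y))) (𝓝[>] 0) (𝓝 0) :=
    Real.tendsto_exp_neg_atTop_nhds_zero.comp ((D.tendsto_outer ε y).const_mul_atTop hκ)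
  have h2 : Tendsto (fun t => Real.exp (-(D.κ * D.blowup ε t y))) (𝓝[>] 0)
      (𝓝 (0 + Real.exp (-(D.κ * D.v y)))) := by
    refine (h1.add tendsto_const_nhds).congr' ?_
    filter_upwards [self_mem_nhdsWithin, eventually_norm_smul_lt D.χ.rIn_pos y] with t ht hy
    rw [D.exp_neg_blowup hε ht, D.χ.one_of_mem_closedBall (by simpa using hy.le), one_mul]
  rw [zero_add] at h2
  have h3 := ((Real.continuousAt_log (Real.exp_pos (-(D.κ * D.v y))).ne').tendsto.comp h2).const_mul
    (-D.κ⁻¹)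
  simp only [Function.comp_def, Real.log_exp] at h3
  have e : ∀ x : ℝ, -D.κ⁻¹ * -(D.κ * x) = x := fun x => by field_simp
  simpa only [e] using h3

theorem tendsto_flatSchouten_blowup {ε : ℝ} (hε : 0 < ε) (y : 𝔼) :
    Tendsto (fun t => flatSchouten (D.blowup ε t) y) (𝓝[>] 0) (𝓝 (flatSchouten D.v y)) := by
  have hκ := D.kappa_pos
  have ht0 : Tendsto (fun t : ℝ => t) (𝓝[>] 0) (𝓝 0) := nhdsWithin_le_nhds
  have h1 : Tendsto (fun t => (1 + Real.exp (D.κ * (D.outer ε t y - D.v y)))⁻¹) (𝓝[>] 0) (𝓝 0) := by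
    refine tendsto_inv_atTop_zero.comp (tendsto_atTop_add_const_left _ _ ?_)
    refine Real.tendsto_exp_atTop.comp (Tendsto.const_mul_atTop hκ ?_)
    exact tendsto_atTop_add_const_right _ _ (D.tendsto_outer ε y)
  have h2 : Tendsto (fun t : ℝ => t ^ 2 • flatSchouten D.U (t • y)) (𝓝[>] 0)
      (𝓝 ((0:ℝ) ^ 2 • flatSchouten D.U 0)) :=
    (ht0.pow 2).smul ((continuousAt_flatSchouten (D.contDiffAt_U D.zero_mem)).tendsto.comp
      (tendsto_smul_zero y))
  have h3 : Tendsto (fun t : ℝ => t • grad D.U (t • y) - grad D.v y) (𝓝[>] 0)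
      (𝓝 ((0:ℝ) • grad D.U 0 - grad D.v y)) :=
    (ht0.smul ((continuousAt_jet (D.contDiffAt_U D.zero_mem)).snd.fst.tendsto.comp
      (tendsto_smul_zero y))).sub tendsto_const_nhds
  set d₀ := (0:ℝ) • grad D.U 0 - grad D.v y
  have h4 : Tendsto (fun t : ℝ => vecMulVec (t • grad D.U (t • y) - grad D.v y)
      (t • grad D.U (t • y) - grad D.v y)) (𝓝[>] 0) (𝓝 (vecMulVec d₀ d₀)) :=
    ((continuous_id.matrix_vecMulVec continuous_id).tendsto d₀).comp h3
  have h5 : Tendsto (fun t : ℝ => (t • grad D.U (t • y) - grad D.v y) ⬝ᵥ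
      (t • grad D.U (t • y) - grad D.v y)) (𝓝[>] 0) (𝓝 (d₀ ⬝ᵥ d₀)) :=
    ((continuous_id.dotProduct continuous_id).tendsto d₀).comp h3
  have h6 := ((h1.smul h2).add ((h1.const_sub 1).smul_const (flatSchouten D.v y))).add
    (((h1.mul (h1.const_sub 1)).div_const 2).smul
      ((h5.smul_const (1 : Matrix (Fin n) (Fin n) ℝ)).sub (h4.const_smul (2 + 2 * D.κ))))
  have e : (0:ℝ) • (0:ℝ) ^ 2 • flatSchouten D.U 0 + ((1:ℝ) - 0) • flatSchouten D.v y +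
      ((0:ℝ) * (1 - 0) / 2) • ((d₀ ⬝ᵥ d₀) • (1 : Matrix (Fin n) (Fin n) ℝ) -
        (2 + 2 * D.κ) • vecMulVec d₀ d₀) = flatSchouten D.v y := by simp
  rw [e] at h6
  refine h6.congr' ?_
  filter_upwards [self_mem_nhdsWithin, eventually_norm_smul_lt D.χ.rIn_pos y] with t ht hy
  have hR : t • y ∈ ball (0 : 𝔼) D.R := D.mem_ball_of_le (hy.le.trans D.χ.rIn_lt_rOut.le)
  rw [flatSchouten_congr (D.blowup_eventuallyEq hε ht hy), flatSchouten_softMin hκ.ne'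
    (D.contDiffAt_outer hR) D.bubble.contDiff.contDiffAt rfl rfl, (D.flatSchouten_outer hR).1,
    (D.flatSchouten_outer hR).2]

/-- The change of variables `x = t y`. -/
theorem integral_flatDensity_blowup {ε t : ℝ} (hε : 0 < ε) (ht : 0 < t) (j : ℕ) :
    ∫ y in ball (0 : 𝔼) (D.χ.rOut / t), flatDensity j (D.blowup ε t) y =
      Real.exp (((n : ℝ) - 2 * j) * (Real.log t - D.κ⁻¹ * Real.log ε)) *
        ∫ x in ball (0 : 𝔼) D.χ.rOut, flatDensity j (D.glued ε t) x := by
  set N := (n : ℝ) - 2 * j with hN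
  have h1 : ∀ y ∈ ball (0 : 𝔼) (D.χ.rOut / t), flatDensity j (D.blowup ε t) y =
      (Real.exp (N * (2 * Real.log t - D.κ⁻¹ * Real.log ε)) * t ^ (2 * j)) *
        flatDensity j (D.glued ε t) (t • y) := by
    intro y hy
    have hR : t • y ∈ ball (0 : 𝔼) D.R := by
      refine D.mem_ball_of_le ?_
      rw [mem_ball_zero_iff, lt_div_iff₀ ht] at hy
      rw [norm_smul, Real.norm_of_nonneg ht.le]
      linarith
    rw [flatDensity, flatDensity, D.flatSchouten_blowup hε hR, sigma_smul, blowup, ← pow_mul]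
    have : -N * (D.glued ε t (t • y) + (-(2 * Real.log t) + D.κ⁻¹ * Real.log ε)) =
        N * (2 * Real.log t - D.κ⁻¹ * Real.log ε) + -N * D.glued ε t (t • y) := by ring
    rw [this, Real.exp_add]
    ring
  have h2 : t • ball (0 : 𝔼) (D.χ.rOut / t) = ball 0 D.χ.rOut := by
    rw [_root_.smul_ball ht.ne', smul_zero, Real.norm_of_nonneg ht.le]
    congr 1
    field_simp
  rw [setIntegral_congr_fun measurableSet_ball h1, integral_const_mul,
    Measure.setIntegral_comp_smul_of_pos volume (flatDensity j (D.glued ε t)) _ ht, h2,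
    finrank_euclideanSpace_fin, smul_eq_mul, ← mul_assoc]
  congr 1
  have e : N * (2 * Real.log t - D.κ⁻¹ * Real.log ε) =
      N * (Real.log t - D.κ⁻¹ * Real.log ε) + (n * Real.log t - (2 * j : ℕ) * Real.log t) := by
    rw [hN]; push_cast; ring
  rw [e, Real.exp_add, Real.exp_sub, Real.exp_nat_mul, Real.exp_nat_mul, Real.exp_log ht]
  field_simp

/-- As the scale tends to zero, the renormalized `σ_j`-integrals of the glued factor converge to the
one of the bubble. -/
theorem tendsto_integral {ε : ℝ} (hε : 0 < ε) {j : ℕ} (hj : 2 * j < n) :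
    Tendsto (fun t => Real.exp (((n : ℝ) - 2 * j) * (Real.log t - D.κ⁻¹ * Real.log ε)) *
        ∫ x in ball (0 : 𝔼) D.χ.rOut, flatDensity j (D.glued ε t) x) (𝓝[>] 0)
      (𝓝 (∫ y, flatDensity j D.v y)) := by
  obtain ⟨B, hB⟩ := D.exists_bound_blowup hε
  obtain ⟨L, hL⟩ := D.exists_bound_neg_blowup hε
  obtain ⟨C, hC0, hC⟩ := exists_abs_sigma_le n j B
  set N := (n : ℝ) - 2 * j with hN
  have hjr : 2 * (j : ℝ) < n := by exact_mod_cast hj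
  have hN0 : 0 < N := by rw [hN]; linarith
  have hev : ∀ᶠ t : ℝ in 𝓝[>] 0, 0 < t ∧ t ≤ 1 := by
    filter_upwards [Ioc_mem_nhdsGT (zero_lt_one (α := ℝ))] with t ht using ht
  have hmem : ∀ {t : ℝ} {y : 𝔼}, 0 < t → y ∈ ball (0 : 𝔼) (D.χ.rOut / t) → ‖t • y‖ ≤ D.χ.rOut := by
    intro t y ht hy
    rw [mem_ball_zero_iff, lt_div_iff₀ ht] at hy
    rw [norm_smul, Real.norm_of_nonneg ht.le]
    linarith
  have key : Tendsto (fun t => ∫ y, (ball (0 : 𝔼) (D.χ.rOut / t)).indicator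
      (flatDensity j (D.blowup ε t)) y) (𝓝[>] 0) (𝓝 (∫ y, flatDensity j D.v y)) := by
    -- the density of `σ_j` is `O(|y|^{-2(n-2j)} |y|^{-2j})`, integrable because `2j < n`
    refine tendsto_integral_filter_of_dominated_convergence
      (fun y => Real.exp (N * L) * C * (1 + ‖y‖) ^ (-(2 * (n : ℝ) - 2 * j))) ?_ ?_ ?_ ?_
    · filter_upwards [hev] with t ht
      rw [aestronglyMeasurable_indicator_iff measurableSet_ball]
      refine ContinuousOn.aestronglyMeasurable (fun y hy => ?_) measurableSet_ball
      have hR := D.mem_ball_of_le (hmem ht.1 hy)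
      refine (continuousAt_flatDensity ?_ j).continuousWithinAt
      exact (ContDiffAt.comp y (D.contDiffAt_glued hε t hR)
        (contDiff_const_smul t).contDiffAt).add contDiffAt_const
    · filter_upwards [hev] with t ht
      refine Eventually.of_forall fun y => ?_
      have hy0 : 0 < 1 + ‖y‖ := by positivity
      by_cases hy : y ∈ ball (0 : 𝔼) (D.χ.rOut / t)
      · rw [Set.indicator_of_mem hy, flatDensity, Real.norm_eq_abs, abs_mul, Real.abs_exp]
        have h1 := hC _ (1 + ‖y‖)⁻¹ (by positivity) (hB t ht.1 ht.2 y (hmem ht.1 hy))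
        have h2 : Real.exp (-N * D.blowup ε t y) ≤
            Real.exp (N * L) * (1 + ‖y‖) ^ (-(2 * N)) := by
          rw [Real.rpow_def_of_pos hy0, ← Real.exp_add, Real.exp_le_exp]
          have := mul_le_mul_of_nonneg_left (hL t ht.1 ht.2 y (hmem ht.1 hy)) hN0.le
          linarith
        have h3 : ((1 + ‖y‖)⁻¹) ^ (2 * j) = (1 + ‖y‖) ^ (-(2 * (j : ℝ))) := by
          rw [inv_pow, Real.rpow_neg hy0.le, ← Real.rpow_natCast]; push_cast; rfl
        calc _ ≤ (Real.exp (N * L) * (1 + ‖y‖) ^ (-(2 * N))) *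
              (C * ((1 + ‖y‖)⁻¹) ^ (2 * j)) := mul_le_mul h2 h1 (abs_nonneg _) (by positivity)
          _ = Real.exp (N * L) * C * ((1 + ‖y‖) ^ (-(2 * N)) * (1 + ‖y‖) ^ (-(2 * (j : ℝ)))) := by
            rw [h3]; ring
          _ = _ := by
            rw [← Real.rpow_add hy0]; congr 2; rw [hN]; ring
      · rw [Set.indicator_of_notMem hy, norm_zero]
        positivity
    · refine (integrable_one_add_norm ?_).const_mul _
      rw [finrank_euclideanSpace_fin]
      linarith
    · refine Eventually.of_forall fun y => ?_
      have h1 : Tendsto (fun t => flatDensity j (D.blowup ε t) y) (𝓝[>] 0)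
          (𝓝 (flatDensity j D.v y)) :=
        ((Real.continuous_exp.tendsto _).comp ((D.tendsto_blowup hε y).const_mul (-N))).mul
          (((continuous_sigma j).tendsto _).comp (D.tendsto_flatSchouten_blowup hε y))
      refine h1.congr' ?_
      filter_upwards [self_mem_nhdsWithin, eventually_norm_smul_lt D.χ.rOut_pos y] with t ht hy
      rw [Set.indicator_of_mem]
      rw [norm_smul, Real.norm_of_nonneg (le_of_lt ht)] at hy
      rw [mem_ball_zero_iff, lt_div_iff₀ ht]
      linarith
  refine key.congr' ?_
  filter_upwards [hev] with t ht
  rw [integral_indicator measurableSet_ball, D.integral_flatDensity_blowup hε ht.1]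

end GlueData

end GlueLimit

/-! ### Local Hölder classes

The spaces live in `Type`, so that inductions on the order of differentiation may pass from `F` to
`E →L[ℝ] F`. -/

section Holder

open Asymptotics Filter

variable {E F G H : Type} [NormedAddCommGroup E] [NormedSpace ℝ E] [NormedAddCommGroup F]
  [NormedSpace ℝ F] [NormedAddCommGroup G] [NormedSpace ℝ G] [NormedAddCommGroup H]
  [NormedSpace ℝ H]

/-- `f` is Hölder continuous with exponent `α` near `a`, as an estimate for pairs of points close to
`(a, a)`. -/
def IsHolderNear (α : ℝ≥0) (f : E → F) (a : E) : Prop :=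
  (fun p : E × E => f p.1 - f p.2) =O[𝓝 (a, a)] fun p => ‖p.1 - p.2‖ ^ (α : ℝ)

/-- `f` is of class `C^{m,α}` near `a`. -/
def ContDiffHolderAt (α : ℝ≥0) (m : ℕ) (f : E → F) (a : E) : Prop :=
  ContDiffAt ℝ m f a ∧ IsHolderNear α (iteratedFDeriv ℝ m f) a

theorem isHolderNear_iff {α : ℝ≥0} {f : E → F} {a : E} :
    IsHolderNear α f a ↔ ∃ s ∈ 𝓝 a, ∃ C : ℝ≥0, HolderOnWith C α f s := by
  have key : ∀ (C : ℝ≥0) (x y : E), edist (f x) (f y) ≤ C * edist x y ^ (α : ℝ) ↔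
      ‖f x - f y‖ ≤ C * ‖x - y‖ ^ (α : ℝ) := by
    intro C x y
    rw [edist_dist, edist_dist, ENNReal.ofReal_rpow_of_nonneg (p := (α : ℝ)) dist_nonneg α.coe_nonneg,
      ← ENNReal.ofReal_coe_nnreal, ← ENNReal.ofReal_mul C.coe_nonneg, ENNReal.ofReal_le_ofReal_iff
      (by positivity), dist_eq_norm, dist_eq_norm]
  constructor
  · intro h
    obtain ⟨C, hC0, hC⟩ := h.exists_nonneg
    rw [IsBigOWith, nhds_prod_eq] at hC
    obtain ⟨s, hs, hs'⟩ := (eventually_prod_self_iff (r := fun x y =>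
      ‖f x - f y‖ ≤ C * ‖‖x - y‖ ^ (α : ℝ)‖)).1 hC
    refine ⟨s, hs, ⟨C, hC0⟩, fun x hx y hy => (key _ x y).2 ?_⟩
    have := hs' x hx y hy
    rwa [Real.norm_of_nonneg (by positivity)] at this
  · rintro ⟨s, hs, C, hC⟩
    refine IsBigO.of_bound C ?_
    filter_upwards [prod_mem_nhds hs hs] with p hp
    rw [Real.norm_of_nonneg (by positivity)]
    exact (key _ _ _).1 (hC p.1 hp.1 p.2 hp.2)

theorem IsHolderNear.congr_norm {α : ℝ≥0} {f : E → F} {g : E → G} {a : E}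
    (hf : IsHolderNear α f a) (h : ∀ x y, ‖g x - g y‖ = ‖f x - f y‖) : IsHolderNear α g a :=
  (IsBigO.of_norm_left (by
    refine (hf.norm_left).congr_left fun p => (h p.1 p.2).symm))

theorem IsHolderNear.congr {α : ℝ≥0} {f g : E → F} {a : E} (hf : IsHolderNear α f a)
    (h : f =ᶠ[𝓝 a] g) : IsHolderNear α g a := by
  refine IsBigO.congr' hf ?_ (EventuallyEq.refl _ _)
  filter_upwards [prod_mem_nhds h h] with p hp
  rw [show f p.1 = g p.1 from hp.1, show f p.2 = g p.2 from hp.2]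

/-- Lipschitz estimates imply Hölder estimates of exponent `α ≤ 1`. -/
theorem isBigO_norm_rpow {α : ℝ≥0} (h1 : α ≤ 1) (a : E) :
    (fun p : E × E => p.1 - p.2) =O[𝓝 (a, a)] fun p => ‖p.1 - p.2‖ ^ (α : ℝ) := by
  refine IsBigO.of_bound 1 ?_
  have hc : Continuous fun p : E × E => ‖p.1 - p.2‖ := by fun_prop
  have h : ∀ᶠ p in 𝓝 (a, a), ‖p.1 - p.2‖ < 1 :=
    hc.continuousAt.eventually (gt_mem_nhds (by simp))
  filter_upwards [h] with p hp
  rw [one_mul, Real.norm_of_nonneg (by positivity)]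
  exact Real.self_le_rpow_of_le_one (norm_nonneg _) hp.le (by exact_mod_cast h1)

theorem isBigO_sub_of_contDiffAt {f : E → F} {a : E} (h : ContDiffAt ℝ 1 f a) :
    (fun p : E × E => f p.1 - f p.2) =O[𝓝 (a, a)] fun p => p.1 - p.2 :=
  (h.hasStrictFDerivAt (by norm_num)).isBigO_sub

theorem IsHolderNear.of_contDiffAt {α : ℝ≥0} (h1 : α ≤ 1) {f : E → F} {a : E}
    (h : ContDiffAt ℝ 1 f a) : IsHolderNear α f a :=
  (isBigO_sub_of_contDiffAt h).trans (isBigO_norm_rpow h1 a)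

theorem IsHolderNear.comp {α : ℝ≥0} {g : F → G} {f : E → F} {a : E}
    (hg : IsHolderNear α g (f a)) (hf : ContDiffAt ℝ 1 f a) :
    IsHolderNear α (fun x => g (f x)) a := by
  have hc : Tendsto (fun p : E × E => (f p.1, f p.2)) (𝓝 (a, a)) (𝓝 (f a, f a)) := by
    rw [nhds_prod_eq, nhds_prod_eq]
    exact Tendsto.prodMap hf.continuousAt hf.continuousAt
  refine (hg.comp_tendsto hc).trans ?_
  exact IsBigO.rpow α.2 (Eventually.of_forall fun p => norm_nonneg _)
    (isBigO_sub_of_contDiffAt hf).norm_norm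

theorem IsHolderNear.add {α : ℝ≥0} {f g : E → F} {a : E} (hf : IsHolderNear α f a)
    (hg : IsHolderNear α g a) : IsHolderNear α (fun x => f x + g x) a :=
  (IsBigO.add hf hg).congr_left fun _ => (add_sub_add_comm _ _ _ _).symm

theorem IsHolderNear.bilin {α : ℝ≥0} (B : F →L[ℝ] G →L[ℝ] H) {f : E → F} {g : E → G} {a : E}
    (hf : IsHolderNear α f a) (hg : IsHolderNear α g a) (hfc : ContinuousAt f a)
    (hgc : ContinuousAt g a) : IsHolderNear α (fun x => B (f x) (g x)) a := by
  have b1 : (fun p : E × E => g p.1) =O[𝓝 (a, a)] fun _ => (1 : ℝ) :=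
    (hgc.tendsto.comp (continuous_fst.tendsto (a, a))).isBigO_one ℝ
  have b2 : (fun p : E × E => f p.2) =O[𝓝 (a, a)] fun _ => (1 : ℝ) :=
    (hfc.tendsto.comp (continuous_snd.tendsto (a, a))).isBigO_one ℝ
  have t1 : (fun p : E × E => B (f p.1 - f p.2) (g p.1)) =O[𝓝 (a, a)]
      fun p => ‖p.1 - p.2‖ ^ (α : ℝ) := by
    have : (fun p : E × E => B (f p.1 - f p.2) (g p.1)) =O[𝓝 (a, a)]
        fun p => ‖f p.1 - f p.2‖ * ‖g p.1‖ :=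
      IsBigO.of_bound ‖B‖ (Eventually.of_forall fun p => by
        rw [norm_mul, norm_norm, norm_norm, ← mul_assoc]; exact B.le_opNorm₂ _ _)
    exact (this.trans (hf.norm_left.mul b1.norm_left)).congr_right fun p => mul_one _
  have t2 : (fun p : E × E => B (f p.2) (g p.1 - g p.2)) =O[𝓝 (a, a)]
      fun p => ‖p.1 - p.2‖ ^ (α : ℝ) := by
    have : (fun p : E × E => B (f p.2) (g p.1 - g p.2)) =O[𝓝 (a, a)]
        fun p => ‖f p.2‖ * ‖g p.1 - g p.2‖ :=
      IsBigO.of_bound ‖B‖ (Eventually.of_forall fun p => by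
        rw [norm_mul, norm_norm, norm_norm, ← mul_assoc]; exact B.le_opNorm₂ _ _)
    exact (this.trans (b2.norm_left.mul hg.norm_left)).congr_right fun p => one_mul _
  refine (t1.add t2).congr_left fun p => ?_
  simp only [map_sub, _root_.sub_apply]
  abel

theorem contDiffHolderAt_zero {α : ℝ≥0} {f : E → F} {a : E} :
    ContDiffHolderAt α 0 f a ↔ ContDiffAt ℝ 0 f a ∧ IsHolderNear α f a := by
  have hn : ∀ x y, ‖iteratedFDeriv ℝ 0 f x - iteratedFDeriv ℝ 0 f y‖ = ‖f x - f y‖ := by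
    intro x y
    rw [iteratedFDeriv_zero_eq_comp, Function.comp_apply, Function.comp_apply,
      ← LinearIsometryEquiv.map_sub, LinearIsometryEquiv.norm_map]
  exact ⟨fun h => ⟨h.1, h.2.congr_norm fun x y => (hn x y).symm⟩,
    fun h => ⟨h.1, h.2.congr_norm hn⟩⟩

theorem contDiffHolderAt_succ {α : ℝ≥0} {m : ℕ} {f : E → F} {a : E} :
    ContDiffHolderAt α (m + 1) f a ↔
      (∀ᶠ z in 𝓝 a, DifferentiableAt ℝ f z) ∧ ContDiffHolderAt α m (fderiv ℝ f) a := by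
  have hn : ∀ x y, ‖iteratedFDeriv ℝ (m + 1) f x - iteratedFDeriv ℝ (m + 1) f y‖ =
      ‖iteratedFDeriv ℝ m (fderiv ℝ f) x - iteratedFDeriv ℝ m (fderiv ℝ f) y‖ := by
    intro x y
    have h : iteratedFDeriv ℝ (m + 1) f =
        (continuousMultilinearCurryRightEquiv' ℝ m E F).symm ∘ iteratedFDeriv ℝ m (fderiv ℝ f) :=
      funext fun z => iteratedFDeriv_succ_eq_comp_right
    rw [h, Function.comp_apply, Function.comp_apply, ← LinearIsometryEquiv.map_sub,
      LinearIsometryEquiv.norm_map]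
  constructor
  · rintro ⟨h1, h2⟩
    have h1' : ContDiffAt ℝ ((m : WithTop ℕ∞) + 1) f a := by exact_mod_cast h1
    refine ⟨?_, h1'.fderiv_right le_rfl, h2.congr_norm fun x y => (hn x y).symm⟩
    filter_upwards [(h1'.of_le (le_add_self : (1 : WithTop ℕ∞) ≤ _)).eventually (by simp)] with z hz
    exact hz.differentiableAt (by simp)
  · rintro ⟨h1, h2, h3⟩
    refine ⟨?_, h3.congr_norm hn⟩
    have : ContDiffAt ℝ ((m : WithTop ℕ∞) + 1) f a :=
      contDiffAt_succ_iff_hasFDerivAt.2 ⟨fderiv ℝ f, ⟨_, h1, fun z hz => hz.hasFDerivAt⟩, h2⟩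
    exact_mod_cast this

theorem ContDiffHolderAt.of_contDiffAt {α : ℝ≥0} (h1 : α ≤ 1) {m : ℕ} {f : E → F} {a : E}
    (h : ContDiffAt ℝ ((m : WithTop ℕ∞) + 1) f a) : ContDiffHolderAt α m f a := by
  refine ⟨h.of_le le_self_add, IsHolderNear.of_contDiffAt h1 ?_⟩
  exact h.iteratedFDeriv_right (by rw [add_comm])

theorem ContDiffHolderAt.of_succ {α : ℝ≥0} (h1 : α ≤ 1) {m : ℕ} {f : E → F} {a : E}
    (h : ContDiffHolderAt α (m + 1) f a) : ContDiffHolderAt α m f a :=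
  .of_contDiffAt h1 (by exact_mod_cast h.1)

theorem ContDiffHolderAt.congr {α : ℝ≥0} {m : ℕ} {f g : E → F} {a : E}
    (hf : ContDiffHolderAt α m f a) (h : f =ᶠ[𝓝 a] g) : ContDiffHolderAt α m g a :=
  ⟨hf.1.congr_of_eventuallyEq h.symm, hf.2.congr (h.iteratedFDeriv ℝ m)⟩

theorem ContDiffHolderAt.add {α : ℝ≥0} {m : ℕ} {f g : E → F} {a : E}
    (hf : ContDiffHolderAt α m f a) (hg : ContDiffHolderAt α m g a) :
    ContDiffHolderAt α m (fun x => f x + g x) a := by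
  refine ⟨hf.1.add hg.1, (hf.2.add hg.2).congr ?_⟩
  filter_upwards [hf.1.eventually (by simp), hg.1.eventually (by simp)] with z h1 h2
  exact (iteratedFDeriv_add_apply h1 h2).symm

theorem ContDiffHolderAt.bilin {α : ℝ≥0} (h1 : α ≤ 1) {m : ℕ} (B : F →L[ℝ] G →L[ℝ] H) {f : E → F}
    {g : E → G} {a : E} (hf : ContDiffHolderAt α m f a) (hg : ContDiffHolderAt α m g a) :
    ContDiffHolderAt α m (fun x => B (f x) (g x)) a := by
  induction m generalizing F G H with
  | zero =>
    rw [contDiffHolderAt_zero] at *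
    exact ⟨B.isBoundedBilinearMap.contDiff.contDiffAt.comp a (hf.1.prodMk hg.1),
      hf.2.bilin B hg.2 hf.1.continuousAt hg.1.continuousAt⟩
  | succ m ih =>
    have hf' := contDiffHolderAt_succ.1 hf
    have hg' := contDiffHolderAt_succ.1 hg
    have hev : ∀ᶠ z in 𝓝 a, HasFDerivAt (fun x => B (f x) (g x))
        (B.precompR E (f z) (fderiv ℝ g z) + B.precompL E (fderiv ℝ f z) (g z)) z := by
      filter_upwards [hf'.1, hg'.1] with z h2 h3
      exact B.hasFDerivAt_of_bilinear h2.hasFDerivAt h3.hasFDerivAt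
    refine contDiffHolderAt_succ.2 ⟨hev.mono fun z hz => hz.differentiableAt, ?_⟩
    refine ContDiffHolderAt.congr ?_ (hev.mono fun z hz => hz.fderiv.symm)
    exact (ih (B.precompR E) (hf.of_succ h1) hg'.2).add (ih (B.precompL E) hf'.2 (hg.of_succ h1))

theorem ContDiffHolderAt.comp {α : ℝ≥0} (h1 : α ≤ 1) {m : ℕ} {g : F → G} {f : E → F} {a : E}
    (hg : ContDiffHolderAt α m g (f a)) (hf : ContDiffHolderAt α m f a)
    (hf1 : ContDiffAt ℝ 1 f a) : ContDiffHolderAt α m (fun x => g (f x)) a := by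
  induction m generalizing G with
  | zero =>
    rw [contDiffHolderAt_zero] at *
    exact ⟨hg.1.comp a hf.1, hg.2.comp hf1⟩
  | succ m ih =>
    have hf' := contDiffHolderAt_succ.1 hf
    have hg' := contDiffHolderAt_succ.1 hg
    have hev : ∀ᶠ z in 𝓝 a, HasFDerivAt (fun x => g (f x))
        (ContinuousLinearMap.compL ℝ E F G (fderiv ℝ g (f z)) (fderiv ℝ f z)) z := by
      filter_upwards [hf'.1, hf1.continuousAt.eventually hg'.1] with z h2 h3
      exact h3.hasFDerivAt.comp z h2.hasFDerivAt
    refine contDiffHolderAt_succ.2 ⟨hev.mono fun z hz => hz.differentiableAt, ?_⟩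
    refine ContDiffHolderAt.congr ?_ (hev.mono fun z hz => hz.fderiv.symm)
    exact ContDiffHolderAt.bilin h1 _ (ih hg'.2 (hf.of_succ h1)) hf'.2

theorem ContDiffHolderAt.mul {α : ℝ≥0} (h1 : α ≤ 1) {m : ℕ} {f g : E → ℝ} {a : E}
    (hf : ContDiffHolderAt α m f a) (hg : ContDiffHolderAt α m g a) :
    ContDiffHolderAt α m (fun x => f x * g x) a :=
  ContDiffHolderAt.bilin h1 (ContinuousLinearMap.mul ℝ ℝ) hf hg

theorem ContDiffHolderAt.const {α : ℝ≥0} (h1 : α ≤ 1) (m : ℕ) (c : F) (a : E) :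
    ContDiffHolderAt α m (fun _ : E => c) a :=
  .of_contDiffAt h1 contDiffAt_const

/-- Composition with a function smooth on both sides. -/
theorem ContDiffHolderAt.comp_contDiffAt {α : ℝ≥0} (h1 : α ≤ 1) {m : ℕ} {g : F → G} {f : E → F}
    {a : E} (hg : ContDiffHolderAt α m g (f a)) (hf : ContDiffAt ℝ ∞ f a) :
    ContDiffHolderAt α m (fun x => g (f x)) a :=
  hg.comp h1 (.of_contDiffAt h1 (hf.of_le (by exact_mod_cast le_top))) (hf.of_le (by simp))

theorem ContDiffHolderAt.scomp {α : ℝ≥0} (h1 : α ≤ 1) {m : ℕ} (hm : 1 ≤ m) {g : ℝ → ℝ} {f : E → ℝ}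
    {a : E} (hg : ContDiffAt ℝ ∞ g (f a)) (hf : ContDiffHolderAt α m f a) :
    ContDiffHolderAt α m (fun x => g (f x)) a :=
  ContDiffHolderAt.comp h1 (.of_contDiffAt h1 (hg.of_le (by exact_mod_cast le_top))) hf
    (hf.1.of_le (by exact_mod_cast hm))

end Holder

section HolderManifold

open Filter

variable {n : ℕ} {M : Type*} [TopologicalSpace M] [ChartedSpace (EuclideanSpace ℝ (Fin n)) M]
  [IsManifold (𝓡 n) ∞ M] {e : OpenPartialHomeomorph M (EuclideanSpace ℝ (Fin n))}

local notation "𝔼" => EuclideanSpace ℝ (Fin n)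

/-- The matrix of a smooth metric is smooth in every chart of the maximal atlas. -/
theorem contDiffOn_gram (g : SmoothMetric n M) (he : e ∈ IsManifold.maximalAtlas (𝓡 n) ∞ M)
    (i j : Fin n) : ContDiffOn ℝ ∞ (fun y => gram g.inner e y i j) e.target := by
  have : IsManifold (𝓡 n) 1 M := IsManifold.of_le (n := ∞) (by exact_mod_cast le_top)
  have hes := contMDiffOn_symm_of_mem_maximalAtlas he
  have hT := hes.contMDiffOn_tangentMapWithin (m := ∞) (by exact_mod_cast le_rfl)
    e.open_target.uniqueMDiffOn
  have hvec : ∀ i : Fin n, ContMDiffOn (𝓡 n) ((𝓡 n).prod 𝓘(ℝ, 𝔼)) ∞ (fun y : 𝔼 =>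
      (Bundle.TotalSpace.mk' 𝔼 (e.symm y) (coordVec e y i) : TangentBundle (𝓡 n) M)) e.target := by
    intro i
    have hs : ContMDiff (𝓡 n) (𝓡 n).tangent ∞ (fun y : 𝔼 =>
        (⟨y, EuclideanSpace.single i (1:ℝ)⟩ : TangentBundle (𝓡 n) 𝔼)) := by
      intro y
      rw [Bundle.contMDiffAt_totalSpace]
      refine ⟨contMDiffAt_id, ?_⟩
      simp
      exact contMDiffAt_const
    have h1 := hT.comp (hs.contMDiffOn (s := e.target)) (fun y hy => hy)
    refine h1.congr fun y hy => ?_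
    simp only [Function.comp_apply, tangentMapWithin, coordVec]
    rw [mfderivWithin_of_isOpen e.open_target hy]
  have hg : ContMDiffOn (𝓡 n) ((𝓡 n).prod 𝓘(ℝ, 𝔼 →L[ℝ] 𝔼 →L[ℝ] ℝ)) ∞
      (fun y : 𝔼 => Bundle.TotalSpace.mk' (𝔼 →L[ℝ] 𝔼 →L[ℝ] ℝ)
        (E := fun x : M => TangentSpace (𝓡 n) x →L[ℝ] TangentSpace (𝓡 n) x →L[ℝ] ℝ)
        (e.symm y) (g.inner (e.symm y))) e.target := g.contMDiff.comp_contMDiffOn hes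
  intro y hy
  have h2 : ContMDiffWithinAt (𝓡 n) ((𝓡 n).prod 𝓘(ℝ)) ∞
      (fun y : 𝔼 => Bundle.TotalSpace.mk' ℝ (E := Bundle.Trivial M ℝ) (e.symm y)
        (g.inner (e.symm y) (coordVec e y i) (coordVec e y j))) e.target y := by
    apply ContMDiffWithinAt.clm_bundle_apply₂ (F₁ := 𝔼) (F₂ := 𝔼)
    · exact hg y hy
    · exact hvec i y hy
    · exact hvec j y hy
  simp only [Bundle.contMDiffWithinAt_totalSpace] at h2
  exact h2.2.contDiffWithinAt

/-- The conformal factor of a smooth metric in a conformally flat chart is smooth. -/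
theorem IsFlatIn.contDiffOn [NeZero n] {g : SmoothMetric n M} {w : 𝔼 → ℝ}
    (h : IsFlatIn g.inner e w) (he : e ∈ IsManifold.maximalAtlas (𝓡 n) ∞ M) :
    ContDiffOn ℝ ∞ w e.target := by
  have h1 : ∀ y ∈ e.target, gram g.inner e y 0 0 = Real.exp (-2 * w y) := fun y hy => by
    rw [h y hy]; simp
  have h2 : ContDiffOn ℝ ∞ (fun y => -(1 / 2) * Real.log (gram g.inner e y 0 0)) e.target :=
    contDiffOn_const.mul ((contDiffOn_gram g he 0 0).log fun y hy => by
      rw [h1 y hy]; exact (Real.exp_pos _).ne')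
  refine h2.congr fun y hy => ?_
  rw [h1 y hy, Real.log_exp]
  ring

theorem isC4Holder_of_contDiffHolderAt {α : ℝ≥0} {u : M → ℝ}
    (h : ∀ e ∈ atlas (EuclideanSpace ℝ (Fin n)) M, ∀ y ∈ e.target,
      ContDiffHolderAt α 4 (fun z => u (e.symm z)) y) : IsC4Holder (n := n) α u := by
  intro e he
  refine ⟨fun y hy => (h e he y hy).1.contDiffWithinAt, fun y hy => ?_⟩
  exact isHolderNear_iff.1 (h e he y hy).2

/-- `IsC4Holder` refers to the charts of the atlas; the regularity passes to all charts of the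
maximal atlas. -/
theorem IsC4Holder.contDiffHolderAt {α : ℝ≥0} (h1 : α ≤ 1) {u : M → ℝ}
    (hu : IsC4Holder (n := n) α u) (he : e ∈ IsManifold.maximalAtlas (𝓡 n) ∞ M) {y : 𝔼}
    (hy : y ∈ e.target) : ContDiffHolderAt α 4 (fun z => u (e.symm z)) y := by
  set c := chartAt (EuclideanSpace ℝ (Fin n)) (e.symm y) with hcdef
  have hc : c ∈ IsManifold.maximalAtlas (𝓡 n) ∞ M := IsManifold.chart_mem_maximalAtlas _
  have hyc : e.symm y ∈ c.source := mem_chart_source _ _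
  have hct : c (e.symm y) ∈ c.target := c.map_source hyc
  obtain ⟨h2, h3⟩ := hu c (chart_mem_atlas _ _)
  have h4 : ContDiffHolderAt α 4 (u ∘ c.symm) (c (e.symm y)) :=
    ⟨h2.contDiffAt (c.open_target.mem_nhds hct), isHolderNear_iff.2 (h3 _ hct)⟩
  refine (h4.comp_contDiffAt h1 (contDiffAt_transition hc he hy hyc)).congr ?_
  filter_upwards [(e.continuousAt_symm hy).eventually (c.open_source.mem_nhds hyc)] with z hz
  rw [Function.comp_apply, c.left_inv hz]

/-- Adding to a `C^{4,α}` function one supported in a compact subset of a chart. -/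
theorem IsC4Holder.add_extend [T2Space M] {α : ℝ≥0} (h1 : α ≤ 1) {u : M → ℝ}
    (hu : IsC4Holder (n := n) α u) (he : e ∈ IsManifold.maximalAtlas (𝓡 n) ∞ M) {K : Set 𝔼}
    (hK : IsCompact K) (hKe : K ⊆ e.target) {η : 𝔼 → ℝ}
    (hη : ∀ y ∈ e.target, ContDiffHolderAt α 4 η y) (h0 : ∀ y ∉ K, η y = 0) {u' : M → ℝ}
    (hin : ∀ x ∈ e.source, u' x = u x + η (e x)) (hout : ∀ x ∉ e.source, u' x = u x) :
    IsC4Holder (n := n) α u' := by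
  have hcl : IsClosed (e.symm '' K) :=
    (hK.image_of_continuousOn (e.continuousOn_symm.mono hKe)).isClosed
  have hK0 : ∀ x ∉ e.symm '' K, u' x = u x := by
    intro x hx
    by_cases hxe : x ∈ e.source
    · rw [hin x hxe, h0, add_zero]
      exact fun hh => hx ⟨e x, hh, e.left_inv hxe⟩
    · exact hout x hxe
  refine isC4Holder_of_contDiffHolderAt fun c hcA y hy => ?_
  have hc : c ∈ IsManifold.maximalAtlas (𝓡 n) ∞ M := IsManifold.subset_maximalAtlas hcA
  have huc := hu.contDiffHolderAt h1 hc hy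
  by_cases hxe : c.symm y ∈ e.source
  · have h2 := (hη _ (e.map_source hxe)).comp_contDiffAt h1 (contDiffAt_transition he hc hy hxe)
    refine (huc.add h2).congr ?_
    filter_upwards [(c.continuousAt_symm hy).eventually (e.open_source.mem_nhds hxe)] with z hz
    exact (hin _ hz).symm
  · have hxK : c.symm y ∈ (e.symm '' K)ᶜ := by
      rintro ⟨z, hz, hze⟩
      exact hxe (hze ▸ e.map_target (hKe hz))
    refine huc.congr ?_
    filter_upwards [(c.continuousAt_symm hy).eventually (hcl.isOpen_compl.mem_nhds hxK)] with z hz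
    exact (hK0 _ hz).symm

end HolderManifold

section GlueHolder

open Metric

variable {n : ℕ}

local notation "𝔼" => EuclideanSpace ℝ (Fin n)

/-- The gluing preserves the class `C^{4,α}`. -/
theorem GlueData.contDiffHolderAt_eta {k : ℕ} (D : GlueData n k) {α : ℝ≥0} (h1 : α ≤ 1)
    (hU : ∀ x ∈ ball (0 : 𝔼) D.R, ContDiffHolderAt α 4 D.U x)
    (hv : ∀ x, ContDiffHolderAt α 4 D.v x) {ε : ℝ} (hε : 0 < ε) (t : ℝ) {x : 𝔼}
    (hx : x ∈ ball 0 D.R) : ContDiffHolderAt α 4 (D.eta ε t) x := by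
  have hs : ContDiffHolderAt α 4 (D.scaled t) x :=
    ((hv _).comp_contDiffAt h1 (contDiff_const_smul t⁻¹).contDiffAt).add (.const h1 4 _ x)
  have hχ : ContDiffHolderAt α 4 D.χ x :=
    .of_contDiffAt h1 D.χ.contDiffAt
  have hd : ContDiffHolderAt α 4 (fun x => D.κ * (D.U x + -1 * D.scaled t x)) x :=
    (ContDiffHolderAt.const h1 4 _ x).mul h1
      ((hU x hx).add ((ContDiffHolderAt.const h1 4 _ x).mul h1 hs))
  have he := ContDiffHolderAt.scomp h1 (by norm_num) Real.contDiff_exp.contDiffAt hd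
  have ha := (ContDiffHolderAt.const h1 4 (1:ℝ) x).add
    ((ContDiffHolderAt.const h1 4 ε x).mul h1 (hχ.mul h1 he))
  have hl := ContDiffHolderAt.scomp (g := Real.log) h1 (by norm_num) (Real.contDiffAt_log.2 (by
    have h := D.one_add_pos hε t x
    rw [sub_eq_add_neg, ← neg_one_mul] at h
    exact h.ne')) ha
  refine ((ContDiffHolderAt.const h1 4 (-D.κ⁻¹) x).mul h1 hl).congr (Filter.Eventually.of_forall
    fun z => ?_)
  simp only [GlueData.eta]
  rw [sub_eq_add_neg (D.U z), ← neg_one_mul (D.scaled t z)]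
  ring

end GlueHolder

/-! ### Conformal factors that extend across infinity -/

section Inversion

open Metric Filter MeasureTheory Matrix

variable {n : ℕ}

local notation "𝔼" => EuclideanSpace ℝ (Fin n)

/-- Partial derivatives of a function with a parameter, jointly in the parameter and the variable.
-/
theorem contDiffAt_pd_param {G : ℝ → 𝔼 → ℝ} {p : ℝ × 𝔼} {m : ℕ}
    (h : ContDiffAt ℝ ((m : WithTop ℕ∞) + 1) (fun q : ℝ × 𝔼 => G q.1 q.2) p) (i : Fin n) :
    ContDiffAt ℝ m (fun q : ℝ × 𝔼 => pd i (G q.1) q.2) p := by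
  have h1 : ContDiffAt ℝ m (fun q : ℝ × 𝔼 => fderiv ℝ (G q.1) q.2) p := by
    refine ContDiffAt.fderiv (n := (m : WithTop ℕ∞) + 1) (f := fun q : ℝ × 𝔼 => G q.1)
      (g := fun q => q.2) ?_ contDiffAt_snd le_rfl
    exact ContDiffAt.comp (p, p.2) (g := fun q : ℝ × 𝔼 => G q.1 q.2)
      (f := fun r : (ℝ × 𝔼) × 𝔼 => (r.1.1, r.2)) h (by fun_prop)
  exact h1.clm_apply contDiffAt_const

theorem continuousAt_jet_param {G : ℝ → 𝔼 → ℝ} {p : ℝ × 𝔼}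
    (h : ContDiffAt ℝ 2 (fun q : ℝ × 𝔼 => G q.1 q.2) p) :
    ContinuousAt (fun q : ℝ × 𝔼 => jet (G q.1) q.2) p := by
  have h1 := contDiffAt_pd_param (m := 1) (G := G) (p := p) (by exact_mod_cast h)
  have h2 : ∀ i j, ContDiffAt ℝ 0 (fun q : ℝ × 𝔼 => pd i (pd j (G q.1)) q.2) p := fun i j =>
    contDiffAt_pd_param (m := 0) (G := fun s => pd j (G s)) (by simpa using h1 j) i
  exact h.continuousAt.prodMk ((continuousAt_pi.2 fun i => (h1 i).continuousAt).prodMk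
    (continuousAt_pi.2 fun i => continuousAt_pi.2 fun j => (h2 i j).continuousAt))

/-- A conformal factor on `ℝⁿ` is a bubble if, up to the factor `|y|²`, it extends smoothly across
infinity: the homogeneity of the inversion bounds its derivatives. -/
theorem exists_isBubble {k : ℕ} {V : 𝔼 → ℝ} (hV : ContDiff ℝ 2 V)
    (hΓ : ∀ y, flatSchouten V y ∈ coneGamma n k) (G : ℝ → 𝔼 → ℝ)
    (hG : ∀ σ z, z ≠ 0 → ContDiffAt ℝ 2 (fun q : ℝ × 𝔼 => G q.1 q.2) (σ, z))
    (hVG : ∀ s : ℝ, 0 < s → ∀ z : 𝔼, z ≠ 0 → V (s • z) = G s⁻¹ z + 2 * Real.log s) :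
    ∃ C, IsBubble k C V := by
  have hK₁ : IsCompact (jet V '' closedBall 0 1) :=
    (isCompact_closedBall _ _).image_of_continuousOn fun x _ =>
      (continuousAt_jet hV.contDiffAt).continuousWithinAt
  have hK₂ : IsCompact ((fun q : ℝ × 𝔼 => jet (G q.1) q.2) ''
      (Set.Icc 0 1 ×ˢ sphere (0 : 𝔼) 1)) :=
    (isCompact_Icc.prod (isCompact_sphere _ _)).image_of_continuousOn fun q hq =>
      (continuousAt_jet_param (hG q.1 q.2 (ne_of_mem_sphere hq.2 one_ne_zero))).continuousWithinAt
  obtain ⟨B, hB0, hB⟩ := exists_jetBox (hK₁.union hK₂)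
  have hsmall : ∀ y : 𝔼, ‖y‖ ≤ 1 → |V y| ≤ B ∧ (∀ i, |grad V y i| ≤ B) ∧
      ∀ i j, |hess V y i j| ≤ B := fun y hy =>
    mem_jetBox.1 (hB (Or.inl ⟨y, by simpa using hy, rfl⟩))
  have hlarge : ∀ y : 𝔼, 1 ≤ ‖y‖ → |V y - 2 * Real.log ‖y‖| ≤ B ∧
      (∀ i, ‖y‖ * |grad V y i| ≤ B) ∧ ∀ i j, ‖y‖ ^ 2 * |hess V y i j| ≤ B := by
    intro y hy
    set s := ‖y‖ with hs
    have hs0 : 0 < s := by linarith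
    set θ := s⁻¹ • y with hθ
    have hsθ : s • θ = y := by rw [hθ, smul_smul, mul_inv_cancel₀ hs0.ne', one_smul]
    have hnθ : ‖θ‖ = 1 := by
      rw [hθ, norm_smul, norm_inv, Real.norm_of_nonneg hs0.le, ← hs, inv_mul_cancel₀ hs0.ne']
    have hθ0 : θ ≠ 0 := fun h => by rw [h, norm_zero] at hnθ; norm_num at hnθ
    have hGc : ContDiffAt ℝ 2 (G s⁻¹) θ :=
      ContDiffAt.comp θ (g := fun q : ℝ × 𝔼 => G q.1 q.2) (f := fun z => (s⁻¹, z)) (hG s⁻¹ θ hθ0)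
        (contDiffAt_const.prodMk contDiffAt_id)
    obtain ⟨h1, h2, h3⟩ := mem_jetBox.1 (hB (Or.inr ⟨(s⁻¹, θ),
      ⟨⟨by positivity, inv_le_one_of_one_le₀ hy⟩, by simpa using hnθ⟩, rfl⟩))
    have hev : (fun z => V (s • z) + -(2 * Real.log s)) =ᶠ[𝓝 θ] G s⁻¹ := by
      filter_upwards [isOpen_ne.mem_nhds hθ0] with z hz
      rw [hVG s hs0 z hz]; ring
    obtain ⟨g1, g2, -⟩ := flatSchouten_dilate (f := V) s (-(2 * Real.log s)) (y := θ)
      hV.contDiffAt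
    rw [grad_congr hev, hsθ] at g1
    rw [hess_congr hev, hsθ] at g2
    refine ⟨?_, fun i => ?_, fun i j => ?_⟩
    · have := hVG s hs0 θ hθ0
      rw [hsθ] at this
      rw [this, add_sub_cancel_right]
      exact h1
    · have h4 : |grad (G s⁻¹) θ i| ≤ B := h2 i
      rwa [g1, Pi.smul_apply, smul_eq_mul, abs_mul, abs_of_pos hs0] at h4
    · have h4 : |hess (G s⁻¹) θ i j| ≤ B := h3 i j
      rwa [g2, Matrix.smul_apply, smul_eq_mul, abs_mul, abs_of_pos (by positivity)] at h4
  have hl2 : Real.log 2 ≤ 1 := by linarith [Real.log_two_lt_d9]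
  have hl20 : 0 ≤ Real.log 2 := Real.log_nonneg (by norm_num)
  refine ⟨4 * B + 2, hV, hΓ, fun y => ?_, fun y i => ?_, fun y i j => ?_⟩
  · have hlog : ∀ x : ℝ, 0 ≤ x → 0 ≤ Real.log (1 + x) := fun x hx => Real.log_nonneg (by linarith)
    have h0 := hlog ‖y‖ (norm_nonneg y)
    rcases le_total ‖y‖ 1 with hy | hy
    · have h1 := abs_le.1 (hsmall y hy).1
      have h2 : Real.log (1 + ‖y‖) ≤ Real.log 2 :=
        Real.log_le_log (by positivity) (by linarith)
      rw [abs_le]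
      constructor <;> linarith [h1.1, h1.2]
    · have h1 := abs_le.1 (hlarge y hy).1
      have h2 : Real.log (1 + ‖y‖) ≤ Real.log 2 + Real.log ‖y‖ := by
        rw [← Real.log_mul (by norm_num) (by positivity)]
        exact Real.log_le_log (by positivity) (by linarith)
      have h3 : Real.log ‖y‖ ≤ Real.log (1 + ‖y‖) :=
        Real.log_le_log (by positivity) (by linarith)
      rw [abs_le]
      constructor <;> linarith [h1.1, h1.2]
  · rw [← div_eq_mul_inv, le_div_iff₀ (by positivity)]
    rcases le_total ‖y‖ 1 with hy | hy
    · nlinarith [(hsmall y hy).2.1 i, abs_nonneg (grad V y i)]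
    · nlinarith [(hlarge y hy).2.1 i, abs_nonneg (grad V y i)]
  · rw [inv_pow, ← div_eq_mul_inv, le_div_iff₀ (by positivity)]
    have h0 := abs_nonneg (hess V y i j)
    rcases le_total ‖y‖ 1 with hy | hy
    · have h1 := (hsmall y hy).2.2 i j
      have h2 : (1 + ‖y‖) ^ 2 ≤ 4 := by nlinarith [norm_nonneg y]
      nlinarith [mul_le_mul_of_nonneg_left h2 h0]
    · have h1 := (hlarge y hy).2.2 i j
      have h2 : (1 + ‖y‖) ^ 2 ≤ 4 * ‖y‖ ^ 2 := by nlinarith [norm_nonneg y]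
      nlinarith [mul_le_mul_of_nonneg_left h2 h0]

/-- The `σ_j`-integral of a bubble is positive. -/
theorem IsBubble.integral_flatDensity_pos {k : ℕ} {C : ℝ} {v : 𝔼 → ℝ} (h : IsBubble k C v) {j : ℕ}
    (hj : j ≤ k) (hjn : 2 * j < n) : 0 < ∫ y, flatDensity j v y := by
  have hpos : ∀ y, 0 < flatDensity j v y := fun y =>
    mul_pos (Real.exp_pos _) (sigma_pos_of_mem (h.mem_cone y) hj)
  have hcont : Continuous (flatDensity j v) := continuous_iff_continuousAt.2 fun y =>
    continuousAt_flatDensity h.contDiff.contDiffAt j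
  have hjr : 2 * (j : ℝ) < n := by exact_mod_cast hjn
  set N := (n : ℝ) - 2 * j with hN
  have hN0 : 0 < N := by rw [hN]; linarith
  obtain ⟨A, hA0, hA⟩ := exists_abs_sigma_le n j (C + (n + 1) * C ^ 2)
  have hint : Integrable (flatDensity j v) := by
    refine Integrable.mono' (g := fun y => Real.exp (N * C) * A *
      (1 + ‖y‖) ^ (-(2 * (n : ℝ) - 2 * j))) ((integrable_one_add_norm ?_).const_mul _)
      hcont.aestronglyMeasurable (Eventually.of_forall fun y => ?_)
    · rw [finrank_euclideanSpace_fin]; linarith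
    · have hy0 : 0 < 1 + ‖y‖ := by positivity
      rw [flatDensity, Real.norm_eq_abs, abs_mul, Real.abs_exp]
      have h1 := hA (flatSchouten v y) (1 + ‖y‖)⁻¹ (by positivity)
        (abs_jetSchouten_le (h.abs_grad_le y) (h.abs_hess_le y))
      have h2 : Real.exp (-N * v y) ≤ Real.exp (N * C) * (1 + ‖y‖) ^ (-(2 * N)) := by
        rw [Real.rpow_def_of_pos hy0, ← Real.exp_add, Real.exp_le_exp]
        have := mul_le_mul_of_nonneg_left (abs_le.1 (h.abs_sub_log_le y)).1 hN0.le
        linarith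
      have h3 : ((1 + ‖y‖)⁻¹) ^ (2 * j) = (1 + ‖y‖) ^ (-(2 * (j : ℝ))) := by
        rw [inv_pow, Real.rpow_neg hy0.le, ← Real.rpow_natCast]; push_cast; rfl
      calc _ ≤ (Real.exp (N * C) * (1 + ‖y‖) ^ (-(2 * N))) *
            (A * ((1 + ‖y‖)⁻¹) ^ (2 * j)) := mul_le_mul h2 h1 (abs_nonneg _) (by positivity)
        _ = Real.exp (N * C) * A * ((1 + ‖y‖) ^ (-(2 * N)) * (1 + ‖y‖) ^ (-(2 * (j : ℝ)))) := by
          rw [h3]; ring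
        _ = _ := by
          rw [← Real.rpow_add hy0]; congr 2; rw [hN]; ring
  rw [integral_pos_iff_support_of_nonneg (fun y => (hpos y).le) hint]
  have : Function.support (flatDensity j v) = Set.univ :=
    Set.eq_univ_of_forall fun y => (hpos y).ne'
  rw [this]
  exact Measure.measure_univ_pos.2 (NeZero.ne _)

end Inversion

/-! ### The round sphere in stereographic coordinates -/

section NoAtoms

open MeasureTheory

variable {n : ℕ} {M : Type*} [TopologicalSpace M] [ChartedSpace (EuclideanSpace ℝ (Fin n)) M]
  [CompactSpace M] [T2Space M] [MeasurableSpace M] [BorelSpace M]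

theorem volumeMeasure_singleton [NeZero n] (g : FormField n M) (p : M) :
    volumeMeasure g {p} = 0 := by
  rw [volumeMeasure, Measure.sum_apply _ (measurableSet_singleton p), ENNReal.tsum_eq_zero]
  intro i
  rw [map_chart_symm_apply _ _ (measurableSet_singleton p)]
  refine setLIntegral_measure_zero _ _ (Set.Subsingleton.measure_zero ?_ _)
  intro y hy z hz
  exact (chartAt (EuclideanSpace ℝ (Fin n)) i).symm.injOn hy.2 hz.2 (hy.1.trans hz.1.symm)

end NoAtoms

section Sphere

open Metric Module MeasureTheory
open scoped RealInnerProductSpace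

variable {n : ℕ}

local notation "𝔼" => EuclideanSpace ℝ (Fin n)
local notation "𝔽" => EuclideanSpace ℝ (Fin (n + 1))
local notation "𝕊" => Metric.sphere (0 : EuclideanSpace ℝ (Fin (n + 1))) 1

/-- The stereographic projection of the unit sphere from `v`. -/
def stereoChart (v : 𝕊) : OpenPartialHomeomorph 𝕊 𝔼 :=
  haveI := Fact.mk (@finrank_euclideanSpace_fin ℝ _ (n + 1))
  stereographic' n v

/-- The linear isometry onto the hyperplane `v^⊥` that the stereographic projection from `v`
uses as coordinates of that hyperplane. -/
def stereoIsom (v : 𝕊) : 𝔼 →ₗᵢ[ℝ] 𝔽 :=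
  haveI := Fact.mk (@finrank_euclideanSpace_fin ℝ _ (n + 1))
  (ℝ ∙ (v : 𝔽))ᗮ.subtypeₗᵢ.comp
    (OrthonormalBasis.fromOrthogonalSpanSingleton n
      (ne_zero_of_mem_unit_sphere v)).repr.symm.toLinearIsometry

theorem stereoChart_source (v : 𝕊) : (stereoChart v).source = {v}ᶜ := by
  have := Fact.mk (@finrank_euclideanSpace_fin ℝ _ (n + 1))
  exact stereographic'_source v

theorem stereoChart_target (v : 𝕊) : (stereoChart v).target = Set.univ := by
  have := Fact.mk (@finrank_euclideanSpace_fin ℝ _ (n + 1))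
  exact stereographic'_target v

theorem inner_stereoIsom (v : 𝕊) (y : 𝔼) : ⟪(v : 𝔽), stereoIsom v y⟫ = 0 :=
  Submodule.mem_orthogonal_singleton_iff_inner_right.1 (Subtype.property _)

theorem inner_self_sphere (v : 𝕊) : ⟪(v : 𝔽), (v : 𝔽)⟫ = 1 := by
  rw [real_inner_self_eq_norm_sq, norm_eq_of_mem_sphere]; norm_num

/-- The inverse of the stereographic projection. -/
def stereoInv (v : 𝕊) (y : 𝔼) : 𝔽 :=
  (‖y‖ ^ 2 + 4)⁻¹ • ((4 : ℝ) • stereoIsom v y + (‖y‖ ^ 2 - 4) • (v : 𝔽))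

theorem coe_stereoChart_symm (v : 𝕊) (y : 𝔼) :
    ((stereoChart v).symm y : 𝔽) = stereoInv v y := by
  have := Fact.mk (@finrank_euclideanSpace_fin ℝ _ (n + 1))
  have h := stereographic'_symm_apply v y
  have hn : ‖(((OrthonormalBasis.fromOrthogonalSpanSingleton (𝕜 := ℝ) n
      (ne_zero_of_mem_unit_sphere v)).repr.symm y : (ℝ ∙ (v : 𝔽))ᗮ) : 𝔽)‖ = ‖y‖ :=
    (stereoIsom v).norm_map y
  simp only [hn] at h
  rw [stereoInv, smul_add]
  exact h

theorem inner_stereoInv (v : 𝕊) (y : 𝔼) :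
    ⟪(v : 𝔽), stereoInv v y⟫ = (‖y‖ ^ 2 + 4)⁻¹ * (‖y‖ ^ 2 - 4) := by
  rw [stereoInv, inner_smul_right, inner_add_right, inner_smul_right, inner_smul_right,
    inner_stereoIsom, inner_self_sphere]
  ring

theorem stereoIsom_stereoChart (v x : 𝕊) :
    stereoIsom v (stereoChart v x) =
      (2 / (1 - ⟪(v : 𝔽), (x : 𝔽)⟫)) • ((x : 𝔽) - ⟪(v : 𝔽), (x : 𝔽)⟫ • (v : 𝔽)) := by
  have := Fact.mk (@finrank_euclideanSpace_fin ℝ _ (n + 1))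
  have h1 : stereoIsom v (stereoChart v x) =
      ((stereographic (norm_eq_of_mem_sphere v) x : (ℝ ∙ (v : 𝔽))ᗮ) : 𝔽) := by
    change (((OrthonormalBasis.fromOrthogonalSpanSingleton (𝕜 := ℝ) n
      (ne_zero_of_mem_unit_sphere v)).repr.symm ((OrthonormalBasis.fromOrthogonalSpanSingleton
      (𝕜 := ℝ) n (ne_zero_of_mem_unit_sphere v)).repr
        (stereographic (norm_eq_of_mem_sphere v) x)) : (ℝ ∙ (v : 𝔽))ᗮ) : 𝔽) = _
    rw [LinearIsometryEquiv.symm_apply_apply]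
  have h2 := (ℝ ∙ (v : 𝔽)).starProjection_add_starProjection_orthogonal (x : 𝔽)
  rw [Submodule.starProjection_unit_singleton ℝ (norm_eq_of_mem_sphere v)] at h2
  rw [h1, stereographic_apply, Submodule.coe_smul_of_tower]
  congr 1
  exact eq_sub_of_add_eq' h2

/-- The coordinates in the two stereographic projections from antipodal points are exchanged by an
inversion. -/
theorem stereoIsom_transition (v : 𝕊) {y : 𝔼} (hy : y ≠ 0) :
    stereoIsom (-v) (stereoChart (-v) ((stereoChart v).symm y)) =
      (4 / ‖y‖ ^ 2) • stereoIsom v y := by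
  have hρ : ‖y‖ ^ 2 + 4 ≠ 0 := by positivity
  have hy0 : ‖y‖ ≠ 0 := norm_ne_zero_iff.2 hy
  rw [stereoIsom_stereoChart, coe_stereoChart_symm]
  have h1 : ((-v : 𝕊) : 𝔽) = -(v : 𝔽) := rfl
  have h2 : stereoInv v y - ((‖y‖ ^ 2 + 4)⁻¹ * (‖y‖ ^ 2 - 4)) • (v : 𝔽) =
      ((‖y‖ ^ 2 + 4)⁻¹ * 4) • stereoIsom v y := by
    rw [stereoInv, smul_add, smul_smul, smul_smul, add_sub_cancel_right]
  rw [h1, inner_neg_left, inner_stereoInv, smul_neg, neg_smul, neg_neg, h2, smul_smul]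
  have h3 : 1 - -((‖y‖ ^ 2 + 4)⁻¹ * (‖y‖ ^ 2 - 4)) = 2 * ‖y‖ ^ 2 / (‖y‖ ^ 2 + 4) := by
    field_simp
    ring
  rw [h3]
  congr 1
  field_simp

theorem stereoChart_transition_smul (v : 𝕊) {y : 𝔼} (hy : y ≠ 0) {s : ℝ} (hs : 0 < s) :
    stereoChart (-v) ((stereoChart v).symm (s • y)) =
      s⁻¹ • stereoChart (-v) ((stereoChart v).symm y) := by
  apply (stereoIsom (-v)).injective
  rw [map_smul, stereoIsom_transition v hy, stereoIsom_transition v (smul_ne_zero hs.ne' hy),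
    map_smul, norm_smul, Real.norm_of_nonneg hs.le, smul_smul, smul_smul]
  congr 1
  have : ‖y‖ ≠ 0 := norm_ne_zero_iff.2 hy
  field_simp

theorem stereoChart_symm_mem_source_neg (v : 𝕊) {y : 𝔼} (hy : y ≠ 0) :
    (stereoChart v).symm y ∈ (stereoChart (-v)).source := by
  rw [stereoChart_source, Set.mem_compl_singleton_iff]
  intro h
  have h1 : stereoInv v y = -(v : 𝔽) := by rw [← coe_stereoChart_symm, h]; rfl
  have h2 := inner_stereoInv v y
  rw [h1, inner_neg_right, inner_self_sphere] at h2
  have hρ : ‖y‖ ^ 2 + 4 ≠ 0 := by positivity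
  field_simp at h2
  have : 0 < ‖y‖ ^ 2 := by positivity
  linarith

instance : IsManifold (𝓡 n) ∞ 𝕊 := IsManifold.of_le (n := ω) le_top

theorem stereoChart_mem_maximalAtlas (v : 𝕊) :
    stereoChart v ∈ IsManifold.maximalAtlas (𝓡 n) ∞ 𝕊 :=
  IsManifold.subset_maximalAtlas ⟨v, rfl⟩

theorem hasFDerivAt_stereoInv (v : 𝕊) (y : 𝔼) : ∃ A : 𝔼 →L[ℝ] 𝔽, HasFDerivAt (stereoInv v) A y ∧
    ∀ a, A a = (‖y‖ ^ 2 + 4)⁻¹ • ((4 : ℝ) • stereoIsom v a + (2 * ⟪y, a⟫) • (v : 𝔽)) -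
      (2 * ⟪y, a⟫ * ((‖y‖ ^ 2 + 4) ^ 2)⁻¹) •
        ((4 : ℝ) • stereoIsom v y + (‖y‖ ^ 2 - 4) • (v : 𝔽)) := by
  have hρ : ‖y‖ ^ 2 + 4 ≠ 0 := by positivity
  have h1 : HasFDerivAt (fun y : 𝔼 => ‖y‖ ^ 2) (2 • innerSL ℝ y) y :=
    (hasStrictFDerivAt_norm_sq y).hasFDerivAt
  have h2 := (hasDerivAt_inv hρ).comp_hasFDerivAt y (h1.add_const 4)
  have h3 : HasFDerivAt (fun y : 𝔼 => (4 : ℝ) • stereoIsom v y + (‖y‖ ^ 2 - 4) • (v : 𝔽)) _ y :=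
    ((stereoIsom v).toContinuousLinearMap.hasFDerivAt.const_smul (4 : ℝ)).add
      ((h1.sub_const 4).smul_const (v : 𝔽))
  refine ⟨_, h2.smul h3, fun a => ?_⟩
  simp [sub_eq_add_neg]
  module

/-- The inverse of the stereographic projection is conformal. -/
theorem inner_fderiv_stereoInv (v : 𝕊) (y a b : 𝔼) :
    ⟪fderiv ℝ (stereoInv v) y a, fderiv ℝ (stereoInv v) y b⟫ =
      (4 / (‖y‖ ^ 2 + 4)) ^ 2 * ⟪a, b⟫ := by
  obtain ⟨A, hA, hAa⟩ := hasFDerivAt_stereoInv v y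
  have hρ : ‖y‖ ^ 2 + 4 ≠ 0 := by positivity
  have e1 : ∀ z, ⟪stereoIsom v z, (v : 𝔽)⟫ = 0 := fun z => by
    rw [real_inner_comm, inner_stereoIsom]
  rw [hA.fderiv, hAa, hAa]
  simp only [inner_sub_left, inner_sub_right, inner_add_left, inner_add_right, inner_smul_left,
    inner_smul_right, LinearIsometry.inner_map_map, inner_stereoIsom, e1, real_inner_self_eq_norm_sq,
    norm_eq_of_mem_sphere, conj_trivial, real_inner_comm a y]
  field_simp
  ring

theorem gram_roundMetric (v : 𝕊) (y : 𝔼) :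
    gram (roundMetric n) (stereoChart v) y = (4 / (‖y‖ ^ 2 + 4)) ^ 2 • 1 := by
  have he : MDifferentiableAt (𝓡 n) (𝓡 n) (stereoChart v).symm y :=
    mdifferentiableAt_chart_symm (stereoChart_mem_maximalAtlas v)
      (by rw [stereoChart_target]; trivial)
  have := Fact.mk (@finrank_euclideanSpace_fin ℝ _ (n + 1))
  have hc : MDifferentiableAt (𝓡 n) (𝓡 (n + 1)) (Subtype.val : 𝕊 → 𝔽) ((stereoChart v).symm y) :=
    (contMDiff_coe_sphere (m := 1)).mdifferentiableAt (by norm_num)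
  have h1 := mfderiv_comp (I := 𝓡 n) (I' := 𝓡 n) (I'' := 𝓡 (n + 1)) y hc he
  have h2 : (Subtype.val : 𝕊 → 𝔽) ∘ (stereoChart v).symm = stereoInv v :=
    funext fun z => coe_stereoChart_symm v z
  rw [h2, mfderiv_eq_fderiv] at h1
  have h3 : ∀ i, (mfderiv (𝓡 n) (𝓡 (n + 1)) (Subtype.val : 𝕊 → 𝔽) ((stereoChart v).symm y)
      (coordVec (stereoChart v) y i) : 𝔽) =
      fderiv ℝ (stereoInv v) y (EuclideanSpace.single i (1:ℝ)) := fun i => by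
    rw [h1]; rfl
  ext i j
  have h4 := roundMetric_apply n ((stereoChart v).symm y) (coordVec (stereoChart v) y i)
    (coordVec (stereoChart v) y j)
  have h5 : gram (roundMetric n) (stereoChart v) y i j =
      ⟪fderiv ℝ (stereoInv v) y (EuclideanSpace.single i (1:ℝ)),
        fderiv ℝ (stereoInv v) y (EuclideanSpace.single j (1:ℝ))⟫ := by
    rw [← h3 i, ← h3 j]; exact h4
  rw [h5, inner_fderiv_stereoInv, Matrix.smul_apply, smul_eq_mul, EuclideanSpace.inner_single_left]
  simp [Matrix.one_apply]

/-- The conformal factor of the round metric in stereographic coordinates. -/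
def roundFactor (y : 𝔼) : ℝ := Real.log ((‖y‖ ^ 2 + 4) / 4)

theorem isFlatIn_roundMetric (v : 𝕊) : IsFlatIn (roundMetric n) (stereoChart v) roundFactor := by
  intro y _
  rw [gram_roundMetric]
  congr 1
  have h : 0 < (‖y‖ ^ 2 + 4) / 4 := by positivity
  rw [roundFactor, show -2 * Real.log ((‖y‖ ^ 2 + 4) / 4) =
    ((2 : ℕ) : ℝ) * -Real.log ((‖y‖ ^ 2 + 4) / 4) by push_cast; ring, Real.exp_nat_mul,
    ← Real.log_inv, Real.exp_log (inv_pos.2 h), inv_div]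

theorem contDiff_roundFactor {m : WithTop ℕ∞} : ContDiff ℝ m (roundFactor (n := n)) :=
  (((contDiff_norm_sq ℝ).add contDiff_const).div_const 4).log fun y => by positivity

end Sphere

/-! ### Bubbles from metrics on the sphere -/

section SphereBubble

open Metric Module MeasureTheory

variable {n : ℕ}

local notation "𝔼" => EuclideanSpace ℝ (Fin n)
local notation "𝕊" => Metric.sphere (0 : EuclideanSpace ℝ (Fin (n + 1))) 1

/-- The behaviour at infinity of a conformal factor in the stereographic projection from `v` is read
off from the projection from `-v`: along rays the transition map is `s z ↦ s⁻¹ ψ z`. -/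
theorem exists_isBubble_stereoChart (v : 𝕊) {k : ℕ} {u : 𝕊 → ℝ}
    (hu : ∀ v : 𝕊, ContDiff ℝ 2 fun y => u ((stereoChart v).symm y))
    (hΓ : ∀ y, flatSchouten (fun y => u ((stereoChart v).symm y) + roundFactor y) y ∈
      coneGamma n k) :
    ∃ C, IsBubble k C fun y => u ((stereoChart v).symm y) + roundFactor y := by
  set ψ : 𝔼 → 𝔼 := fun z => stereoChart (-v) ((stereoChart v).symm z) with hψ
  have hψc : ∀ z, z ≠ 0 → ContDiffAt ℝ ∞ ψ z := fun z hz =>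
    contDiffAt_transition (stereoChart_mem_maximalAtlas _) (stereoChart_mem_maximalAtlas _)
      (by rw [stereoChart_target]; trivial) (stereoChart_symm_mem_source_neg v hz)
  refine exists_isBubble ((hu v).add contDiff_roundFactor) hΓ
    (fun σ z => u ((stereoChart (-v)).symm (σ • ψ z)) + Real.log ((‖z‖ ^ 2 + 4 * σ ^ 2) / 4))
    (fun σ z hz => ?_) (fun s hs z hz => ?_)
  · have h1 : ContDiffAt ℝ 2 (fun q : ℝ × 𝔼 => q.1 • ψ q.2) (σ, z) :=
      contDiffAt_fst.smul (ContDiffAt.comp (σ, z) (g := ψ) (f := Prod.snd)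
        ((hψc z hz).of_le (by norm_cast)) contDiffAt_snd)
    have h2 : ContDiffAt ℝ 2 (fun q : ℝ × 𝔼 => ‖q.2‖ ^ 2) (σ, z) :=
      ((contDiff_norm_sq ℝ).comp contDiff_snd).contDiffAt
    have h3 : 0 < ‖z‖ ^ 2 := by positivity
    refine (ContDiffAt.comp (σ, z) (g := fun y => u ((stereoChart (-v)).symm y))
      (hu (-v)).contDiffAt h1).add (((h2.add (contDiffAt_const.mul
        (contDiffAt_fst.pow 2))).div_const 4).log ?_)
    positivity
  · have h1 : s • z ≠ 0 := smul_ne_zero hs.ne' hz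
    have h2 : s⁻¹ • ψ z = stereoChart (-v) ((stereoChart v).symm (s • z)) :=
      (stereoChart_transition_smul v hz hs).symm
    have h3 : 0 < ‖z‖ ^ 2 := by positivity
    have h4 : (‖s • z‖ ^ 2 + 4) / 4 = (‖z‖ ^ 2 + 4 * s⁻¹ ^ 2) / 4 * s ^ 2 := by
      rw [norm_smul, Real.norm_of_nonneg hs.le]
      field_simp
    rw [h2, (stereoChart (-v)).left_inv (stereoChart_symm_mem_source_neg v h1), roundFactor, h4,
      Real.log_mul (by positivity) (by positivity), Real.log_pow]
    push_cast
    ring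

/-- A conformal metric on the round sphere in `Γ_k` is, in stereographic coordinates, a bubble. -/
theorem exists_bubble_of_mem_admissibleClass {α : ℝ≥0} (h1 : α ≤ 1) (hn : 3 ≤ n) {k : ℕ}
    {h : FormField n 𝕊} (hh : h ∈ admissibleClass α k (roundMetric n)) :
    ∃ C v, IsBubble (n := n) k C v ∧ (∀ y, ContDiffHolderAt α 4 v y) ∧
      ∀ j, totalSigma j h = ∫ y, flatDensity j v y := by
  have : NeZero n := ⟨by omega⟩
  obtain ⟨⟨u, hu, rfl⟩, hadm⟩ := hh
  have hmem : ∀ (v : 𝕊) (y : 𝔼), y ∈ (stereoChart v).target := fun v y => by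
    rw [stereoChart_target]; trivial
  have huc : ∀ (v : 𝕊) (y : 𝔼), ContDiffHolderAt α 4 (fun y => u ((stereoChart v).symm y)) y :=
    fun v y => hu.contDiffHolderAt h1 (stereoChart_mem_maximalAtlas v) (hmem v y)
  have hu2 : ∀ v : 𝕊, ContDiff ℝ 2 fun y => u ((stereoChart v).symm y) := fun v =>
    contDiff_iff_contDiffAt.2 fun y => (huc v y).1.of_le (by norm_cast)
  have hr2 : ContDiff ℝ 2 (roundFactor (n := n)) :=
    contDiff_roundFactor
  have hflat : ∀ v : 𝕊, IsFlatIn (conformalChange u (roundMetric n)) (stereoChart v)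
      fun y => u ((stereoChart v).symm y) + roundFactor y := fun v =>
    (isFlatIn_roundMetric v).conformalChange u
  have hcharts : HasFlatCharts (conformalChange u (roundMetric n)) := fun p =>
    ⟨stereoChart (-p), stereoChart_mem_maximalAtlas _, mem_chart_source _ p, _,
      ((hu2 (-p)).add hr2).contDiffOn, hflat _⟩
  have hne : Nonempty 𝕊 := by
    have : Nontrivial (EuclideanSpace ℝ (Fin (n + 1))) := inferInstance
    exact (NormedSpace.sphere_nonempty.2 zero_le_one).to_subtype
  obtain ⟨v⟩ := hne
  set V : 𝔼 → ℝ := fun y => u ((stereoChart v).symm y) + roundFactor y with hV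
  have hVc : ContDiff ℝ 2 V := (hu2 v).add hr2
  have hΓ : ∀ y, flatSchouten V y ∈ coneGamma n k := by
    intro y
    refine ⟨jetSchouten_isSymm _ (hess_isSymm hVc.contDiffAt), fun j hj1 hj2 => ?_⟩
    have hx := (stereoChart v).map_target (hmem v y)
    have h2 := hadm ((stereoChart v).symm y) j hj1 hj2
    rw [sigmaCurv_eq_flatSigma hn (hflat v) (stereoChart_mem_maximalAtlas v) hx hVc.contDiffAt,
      (stereoChart v).right_inv (hmem v y)] at h2
    exact pos_of_mul_pos_right h2 (Real.exp_pos _).le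
  obtain ⟨C, hC⟩ := exists_isBubble_stereoChart v hu2 hΓ
  refine ⟨C, V, hC, fun y => (huc v y).add (.of_contDiffAt h1
    contDiff_roundFactor.contDiffAt), fun j => ?_⟩
  have himg : (stereoChart v).symm '' Set.univ = {v}ᶜ := by
    have h2 := (stereoChart v).symm_image_target_eq_source
    rwa [stereoChart_target, stereoChart_source] at h2
  have h2 := setIntegral_sigmaCurv hn hcharts (hflat v) (stereoChart_mem_maximalAtlas v)
    hVc.contDiffOn MeasurableSet.univ (by rw [stereoChart_target])
    (by rw [himg]; exact (measurableSet_singleton v).compl) j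
  rw [himg, setIntegral_univ] at h2
  rw [← h2, totalSigma]
  refine (setIntegral_eq_integral_of_ae_compl_eq_zero ?_).symm
  have h3 : ∀ᵐ x ∂(volumeMeasure (conformalChange u (roundMetric n))), x ≠ v := by
    rw [ae_iff]
    simpa using volumeMeasure_singleton _ v
  filter_upwards [h3] with x hx hx2
  exact absurd hx2 (not_not.2 hx)

end SphereBubble

/-! ### Test metrics -/

section TestMetric

open Metric MeasureTheory Filter

variable {n : ℕ} {M : Type*} [TopologicalSpace M] [ChartedSpace (EuclideanSpace ℝ (Fin n)) M]

local notation "𝔼" => EuclideanSpace ℝ (Fin n)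

/-- `sigmaCurv` is local. -/
theorem sigmaCurv_congr {g g' : FormField n M} {x : M} (h : ∀ᶠ z in 𝓝 x, g z = g' z) (j : ℕ) :
    sigmaCurv j g x = sigmaCurv j g' x := by
  set c := chartAt (EuclideanSpace ℝ (Fin n)) x with hc
  have hx : x ∈ c.source := mem_chart_source _ x
  have hcs : ContinuousAt c.symm (c x) := c.continuousAt_symm (c.map_source hx)
  have hev : gram g c =ᶠ[𝓝 (c x)] gram g' c := by
    have h' : ∀ᶠ z in 𝓝 (c.symm (c x)), g z = g' z := by rwa [c.left_inv hx]
    filter_upwards [hcs.eventually h'] with z hz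
    simp only [gram, hz]
  change sigma j ((gram g c (c x))⁻¹ * schouten (gram g c) (c x)) =
    sigma j ((gram g' c (c x))⁻¹ * schouten (gram g' c) (c x))
  rw [hev.self_of_nhds, schouten_congr hev]

theorem flatSchouten_translate {f : 𝔼 → ℝ} (x₀ : 𝔼) {y : 𝔼} (hf : ContDiffAt ℝ 2 f (x₀ + y)) :
    flatSchouten (fun z => f (x₀ + z)) y = flatSchouten f (x₀ + y) := by
  have h := (flatSchouten_affine x₀ 1 0 (y := y) (f := f) (by rwa [one_smul])).2.2
  simpa only [one_smul, add_zero, one_pow] using h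

theorem setIntegral_flatDensity_translate {f F : 𝔼 → ℝ} {x₀ : 𝔼} {r : ℝ}
    (hr : r ≠ 0) (hf : ∀ y ∈ ball (0 : 𝔼) r, ContDiffAt ℝ 2 F (x₀ + y))
    (h : ∀ y ∈ ball (0 : 𝔼) r, f y = F (x₀ + y)) (j : ℕ) :
    ∫ y in closedBall x₀ r, flatDensity j F y = ∫ y in ball (0 : 𝔼) r, flatDensity j f y := by
  have hb : (closedBall x₀ r : Set 𝔼) =ᵐ[volume] ball x₀ r := by
    rw [← ball_union_sphere]
    exact union_ae_eq_left_of_ae_eq_empty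
      (ae_eq_empty.2 (Measure.addHaar_sphere_of_ne_zero volume x₀ hr))
  rw [setIntegral_congr_set hb, ← integral_indicator measurableSet_ball,
    ← integral_indicator measurableSet_ball, ← integral_add_left_eq_self _ x₀]
  congr 1
  funext y
  by_cases hy : y ∈ ball (0 : 𝔼) r
  · have hy' : x₀ + y ∈ ball x₀ r := by simpa using hy
    have hev : f =ᶠ[𝓝 y] fun z => F (x₀ + z) := by
      filter_upwards [isOpen_ball.mem_nhds hy] with z hz using h z hz
    rw [Set.indicator_of_mem hy, Set.indicator_of_mem hy', flatDensity, flatDensity, h y hy,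
      flatSchouten_congr hev, flatSchouten_translate x₀ (hf y hy)]
  · have hy' : x₀ + y ∉ ball x₀ r := by simpa using hy
    rw [Set.indicator_of_notMem hy, Set.indicator_of_notMem hy']

variable [IsManifold (𝓡 n) ∞ M]

/-- The metrics of a locally conformally flat class with `C^{4,α}` conformal factor are flat in
charts up to a `C²` factor. -/
theorem IsLocallyConformallyFlat.hasFlatCharts [NeZero n] {g₀ : SmoothMetric n M}
    (h : IsLocallyConformallyFlat g₀.inner) {α : ℝ≥0} (h1 : α ≤ 1) {u : M → ℝ}
    (hu : IsC4Holder (n := n) α u) : HasFlatCharts (conformalChange u g₀.inner) := by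
  intro p
  obtain ⟨e, he, hp, w, hw⟩ := h p
  refine ⟨e, he, hp, _, ?_, IsFlatIn.conformalChange hw u⟩
  intro y hy
  exact ((hu.contDiffHolderAt h1 he hy).1.of_le (by norm_cast)).contDiffWithinAt.add
    ((IsFlatIn.contDiffOn hw he y hy).of_le (by norm_cast))

variable [CompactSpace M] [T2Space M] [MeasurableSpace M] [BorelSpace M]

/-- Gluing a bubble of small scale into an admissible metric: the resulting metrics are admissible,
and after renormalization their `σ_j`-integrals tend to those of the bubble. -/
theorem exists_test_metrics (hn : 3 ≤ n) {k : ℕ} (hk : 1 ≤ k) (hkn : 2 * k < n) {α : ℝ≥0}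
    (h1 : α ≤ 1) (g₀ : SmoothMetric n M) (hflat : IsLocallyConformallyFlat g₀.inner) {u : M → ℝ}
    (hu : IsC4Holder (n := n) α u) (hadm : IsAdmissible k (conformalChange u g₀.inner)) (p : M)
    {C : ℝ} {v : 𝔼 → ℝ} (hv : IsBubble k C v) (hv4 : ∀ y, ContDiffHolderAt α 4 v y) :
    ∃ (g : ℝ → FormField n M) (s : ℝ → ℝ),
      (∀ᶠ t in 𝓝[>] 0, g t ∈ admissibleClass α k g₀.inner) ∧
      ∀ j, 2 * j < n → Tendsto (fun t => Real.exp (((n : ℝ) - 2 * j) * s t) * totalSigma j (g t))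
        (𝓝[>] 0) (𝓝 (∫ y, flatDensity j v y)) := by
  classical
  have : NeZero n := ⟨by omega⟩
  obtain ⟨e, he, hp, w, hw⟩ := hflat p
  have hwc := IsFlatIn.contDiffOn hw he
  set x₀ := e p with hx₀
  have hx₀t : x₀ ∈ e.target := e.map_source hp
  obtain ⟨R, hR, hRt⟩ := Metric.isOpen_iff.1 e.open_target x₀ hx₀t
  set f : 𝔼 → ℝ := fun y => u (e.symm y) + w y with hf
  have hf4 : ∀ y ∈ e.target, ContDiffHolderAt α 4 f y := fun y hy =>
    (hu.contDiffHolderAt h1 he hy).add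
      (.of_contDiffAt h1 ((hwc.contDiffAt (e.open_target.mem_nhds hy)).of_le (by norm_cast)))
  have hf2 : ∀ y ∈ e.target, ContDiffAt ℝ 2 f y := fun y hy => (hf4 y hy).1.of_le (by norm_cast)
  have hball : ∀ {y : 𝔼}, y ∈ ball (0 : 𝔼) R → x₀ + y ∈ e.target := fun {y} hy =>
    hRt (by simpa using hy)
  have htr : ∀ y : 𝔼, ContDiffAt ℝ ∞ (fun z : 𝔼 => x₀ + z) y := fun y =>
    contDiffAt_const.add contDiffAt_id
  have hU4 : ∀ y ∈ ball (0 : 𝔼) R, ContDiffHolderAt α 4 (fun z => f (x₀ + z)) y := fun y hy =>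
    (hf4 _ (hball hy)).comp_contDiffAt h1 (htr y)
  have hflat₁ : IsFlatIn (conformalChange u g₀.inner) e f := IsFlatIn.conformalChange hw u
  let χ : ContDiffBump (0 : 𝔼) := ⟨R / 4, R / 2, by positivity, by linarith⟩
  have hkr : (1 : ℝ) ≤ k := by exact_mod_cast hk
  let D : GlueData n k :=
    -- `κ = 1 / (4k)` gives `(2 + 2κ) k = 2k + 1/2 < n`
    { κ := 1 / (4 * k)
      R := R
      C := C
      U := fun z => f (x₀ + z)
      v := v
      χ := χ
      one_le := hk
      kappa_pos := by positivity
      kappa_lt := by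
        have : (2 : ℝ) * k + 1 ≤ n := by exact_mod_cast hkn
        have : (2 + 2 * (1 / (4 * (k : ℝ)))) * k = 2 * k + 1 / 2 := by
          field_simp
          ring
        linarith
      rOut_lt := by change R / 2 < R; linarith
      contDiffOn := fun y hy => ((hU4 y hy).1.of_le (by norm_cast)).contDiffWithinAt
      mem_cone := fun y hy => by
        have hy' := hball hy
        rw [flatSchouten_translate x₀ (hf2 _ hy')]
        refine ⟨jetSchouten_isSymm _ (hess_isSymm (hf2 _ hy')), fun j hj1 hj2 => ?_⟩
        have h2 := hadm (e.symm (x₀ + y)) j hj1 hj2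
        have h3 : e (e.symm (x₀ + y)) = x₀ + y := e.right_inv hy'
        rw [sigmaCurv_eq_flatSigma hn hflat₁ he (e.map_target hy') (by rw [h3]; exact hf2 _ hy'),
          h3] at h2
        exact pos_of_mul_pos_right h2 (Real.exp_pos _).le
      bubble := hv }
  set r := D.χ.rOut with hr
  have hrR : r < R := D.rOut_lt
  obtain ⟨ε, hε, hΓ⟩ := D.exists_glued_mem
  set K : Set 𝔼 := closedBall x₀ r with hK
  have hKt : K ⊆ e.target := (closedBall_subset_ball hrR).trans hRt
  have hKM : IsClosed (e.symm '' K) :=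
    ((isCompact_closedBall _ _).image_of_continuousOn (e.continuousOn_symm.mono hKt)).isClosed
  set η : ℝ → 𝔼 → ℝ := fun t y => D.eta ε t (-x₀ + y) with hη
  have hη0 : ∀ t, ∀ y ∉ K, η t y = 0 := fun t y hy => by
    refine D.eta_eq_zero ε t ?_
    rw [hK, mem_closedBall, not_le, dist_eq_norm, sub_eq_neg_add] at hy
    exact hy.le
  have hη4 : ∀ t, ∀ y ∈ e.target, ContDiffHolderAt α 4 (η t) y := by
    intro t y hy
    by_cases hyR : -x₀ + y ∈ ball (0 : 𝔼) R
    · exact ContDiffHolderAt.comp_contDiffAt h1 (f := fun z => -x₀ + z)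
        (D.contDiffHolderAt_eta h1 hU4 hv4 hε t hyR) (contDiffAt_const.add contDiffAt_id)
    · have hyK : y ∈ Kᶜ := fun h => hyR (by
        rw [hK, mem_closedBall, dist_eq_norm, sub_eq_neg_add] at h
        rw [mem_ball_zero_iff]; linarith)
      refine (ContDiffHolderAt.const h1 4 (0:ℝ) y).congr ?_
      filter_upwards [isClosed_closedBall.isOpen_compl.mem_nhds hyK] with z hz
      exact (hη0 t z hz).symm
  set u' : ℝ → M → ℝ := fun t x => u x + if x ∈ e.source then η t (e x) else 0 with hu'
  have hin : ∀ t, ∀ x ∈ e.source, u' t x = u x + η t (e x) := fun t x hx => by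
    simp only [hu', if_pos hx]
  have hout : ∀ t, ∀ x ∉ e.source, u' t x = u x := fun t x hx => by
    simp only [hu', if_neg hx, add_zero]
  have hu'4 : ∀ t, IsC4Holder (n := n) α (u' t) := fun t =>
    hu.add_extend h1 he (isCompact_closedBall _ _) hKt (hη4 t) (hη0 t) (hin t) (hout t)
  have hu'K : ∀ t, ∀ x ∉ e.symm '' K, u' t x = u x := by
    intro t x hx
    by_cases hxe : x ∈ e.source
    · rw [hin t x hxe, hη0, add_zero]
      exact fun hh => hx ⟨e x, hh, e.left_inv hxe⟩
    · exact hout t x hxe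
  set g : ℝ → FormField n M := fun t => conformalChange (u' t) g₀.inner with hg
  have hgK : ∀ t, ∀ x ∉ e.symm '' K, g t x = conformalChange u g₀.inner x := fun t x hx => by
    simp only [hg, conformalChange, hu'K t x hx]
  have hcurvK : ∀ t, ∀ x ∉ e.symm '' K, ∀ j,
      sigmaCurv j (g t) x = sigmaCurv j (conformalChange u g₀.inner) x := fun t x hx j =>
    sigmaCurv_congr (by
      filter_upwards [hKM.isOpen_compl.mem_nhds hx] with z hz using hgK t z hz) j
  set F : ℝ → 𝔼 → ℝ := fun t y => u' t (e.symm y) + w y with hF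
  have hFflat : ∀ t, IsFlatIn (g t) e (F t) := fun t => IsFlatIn.conformalChange hw (u' t)
  have hF2 : ∀ t, ∀ y ∈ e.target, ContDiffAt ℝ 2 (F t) y := fun t y hy =>
    (((hu'4 t).contDiffHolderAt h1 he hy).1.of_le (by norm_cast)).add
      ((hwc.contDiffAt (e.open_target.mem_nhds hy)).of_le (by norm_cast))
  have hFglued : ∀ t, ∀ y ∈ ball (0 : 𝔼) R, D.glued ε t y = F t (x₀ + y) := by
    intro t y hy
    have hy' := hball hy
    simp only [hF, hin t _ (e.map_target hy'), e.right_inv hy', hη, neg_add_cancel_left]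
    change f (x₀ + y) + D.eta ε t y = _
    simp only [hf]
    ring
  have hcharts : ∀ t, HasFlatCharts (g t) := fun t => hflat.hasFlatCharts h1 (hu'4 t)
  refine ⟨g, fun t => Real.log t - D.κ⁻¹ * Real.log ε, ?_, fun j hj => ?_⟩
  · filter_upwards [Ioc_mem_nhdsGT (zero_lt_one (α := ℝ))] with t ht
    refine ⟨⟨u' t, hu'4 t, rfl⟩, fun x j hj1 hj2 => ?_⟩
    by_cases hx : x ∈ e.symm '' K
    · obtain ⟨y, hy, rfl⟩ := hx
      have hyt := hKt hy
      have hyR : -x₀ + y ∈ ball (0 : 𝔼) R := by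
        rw [hK, mem_closedBall, dist_eq_norm, sub_eq_neg_add] at hy
        rw [mem_ball_zero_iff]; linarith
      have hxy : x₀ + (-x₀ + y) = y := add_neg_cancel_left _ _
      rw [sigmaCurv_eq_flatSigma hn (hFflat t) he (e.map_target hyt)
        (by rw [e.right_inv hyt]; exact hF2 t y hyt), e.right_inv hyt, flatSigma]
      refine mul_pos (Real.exp_pos _) ?_
      have hm := hΓ t ht.1 ht.2 _ hyR
      have hev : D.glued ε t =ᶠ[𝓝 (-x₀ + y)] fun z => F t (x₀ + z) := by
        filter_upwards [isOpen_ball.mem_nhds hyR] with z hz using hFglued t z hz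
      rw [flatSchouten_congr hev, flatSchouten_translate x₀ (by rw [hxy]; exact hF2 t y hyt),
        hxy] at hm
      exact hm.2 j hj1 hj2
    · rw [hcurvK t x hx]
      exact hadm x j hj1 hj2
  · set a := ∫ x in (e.symm '' K)ᶜ, sigmaCurv j (conformalChange u g₀.inner) x
      ∂(volumeMeasure (conformalChange u g₀.inner)) with ha
    have htot : ∀ t, totalSigma j (g t) =
        (∫ y in ball (0 : 𝔼) r, flatDensity j (D.glued ε t) y) + a := by
      intro t
      rw [totalSigma, ← integral_add_compl hKM.measurableSet
        ((hcharts t).integrable_sigmaCurv hn j),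
        setIntegral_sigmaCurv hn (hcharts t) (hFflat t) he
          (fun y hy => (hF2 t y hy).contDiffWithinAt) measurableSet_closedBall hKt
          hKM.measurableSet j,
        setIntegral_sigmaCurv_congr hKM.measurableSet.compl (hgK t) j
          (fun x hx => hcurvK t x hx j)]
      congr 1
      refine setIntegral_flatDensity_translate D.χ.rOut_pos.ne' (fun y hy => hF2 t _ (hball ?_))
        (fun y hy => hFglued t y ?_) j
      · exact ball_subset_ball hrR.le hy
      · exact ball_subset_ball hrR.le hy
    have hN : 0 < (n : ℝ) - 2 * j := by
      have : 2 * (j : ℝ) < n := by exact_mod_cast hj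
      linarith
    have hs : Tendsto (fun t => Real.exp (((n : ℝ) - 2 * j) *
        (Real.log t - D.κ⁻¹ * Real.log ε))) (𝓝[>] 0) (𝓝 0) := by
      refine Real.tendsto_exp_atBot.comp (Tendsto.const_mul_atBot hN ?_)
      simp only [sub_eq_add_neg]
      exact tendsto_atBot_add_const_right _ _ Real.tendsto_log_nhdsGT_zero
    have hlim := (D.tendsto_integral hε hj).add (hs.mul_const a)
    rw [zero_mul, add_zero] at hlim
    refine hlim.congr fun t => ?_
    rw [htot t, mul_add]

end TestMetric

/-! ### The limit of the quotients -/

section Quotient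

open Filter

/-- The Yamabe quotient is invariant under scaling, so that its limit can be computed from
renormalized integrals. -/
theorem tendsto_quotient {A B s : ℝ → ℝ} {F : Filter ℝ} {a b N N' : ℝ} (hb : 0 < b) (hN : N ≠ 0)
    (hA : Tendsto (fun t => Real.exp (N' * s t) * A t) F (𝓝 a))
    (hB : Tendsto (fun t => Real.exp (N * s t) * B t) F (𝓝 b)) :
    Tendsto (fun t => B t ^ (-(N' / N)) * A t) F (𝓝 (b ^ (-(N' / N)) * a)) := by
  refine ((hB.rpow_const (Or.inl hb.ne')).mul hA).congr' ?_
  filter_upwards [hB.eventually (lt_mem_nhds hb)] with t ht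
  have hBt : 0 < B t := pos_of_mul_pos_right ht (Real.exp_pos _).le
  rw [Real.mul_rpow (Real.exp_pos _).le hBt.le, ← Real.exp_mul]
  have h1 : N * s t * -(N' / N) = -(N' * s t) := by field_simp
  have h2 : Real.exp (-(N' * s t)) * Real.exp (N' * s t) = 1 := by
    rw [← Real.exp_add]; simp
  rw [h1]
  calc _ = Real.exp (-(N' * s t)) * Real.exp (N' * s t) * (B t ^ (-(N' / N)) * A t) := by ring
    _ = _ := by rw [h2, one_mul]

end Quotient

end SchoutenGeom

end

theorem theorem4 (n k l : ℕ) (hlk : l < k) (hkn : 2 * k < n) (α : ℝ≥0) (hα0 : 0 < α) (hα1 : α < 1)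
    {M : Type*} [TopologicalSpace M] [T2Space M] [CompactSpace M]
    [ChartedSpace (EuclideanSpace ℝ (Fin n)) M] [IsManifold (𝓡 n) ∞ M]
    [MeasurableSpace M] [BorelSpace M]
    (g₀ : SmoothMetric n M) (hflat : IsLocallyConformallyFlat g₀.inner)
    (hadm : (admissibleClass α k g₀.inner).Nonempty) :
    yamabeConst α k l g₀.inner ≤ yamabeConst α k l (roundMetric n) := by
  have hn : 3 ≤ n := by omega
  have hln : 2 * l < n := by omega
  refine le_iInf₂ fun h hh => ?_
  obtain ⟨C, v, hv, hv4, htot⟩ := exists_bubble_of_mem_admissibleClass hα1.le hn hh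
  have hpos : ∀ j, j ≤ k → 0 < totalSigma j h := fun j hj => by
    rw [htot]
    exact hv.integral_flatDensity_pos hj (by omega)
  obtain ⟨_, ⟨u, hu, rfl⟩, hu'⟩ := hadm
  rcases isEmpty_or_nonempty M with hM | ⟨⟨p⟩⟩
  · -- On the empty manifold all integrals vanish.
    refine (iInf₂_le (conformalChange u g₀.inner) ⟨⟨u, hu, rfl⟩, hu'⟩).trans ?_
    have h0 : totalSigma k (conformalChange u g₀.inner) = 0 := by
      rw [totalSigma, MeasureTheory.Measure.eq_zero_of_isEmpty (volumeMeasure _),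
        MeasureTheory.integral_zero_measure]
    rw [h0, mul_zero]
    exact EReal.coe_le_coe_iff.2
      (mul_pos (Real.rpow_pos_of_pos (hpos l hlk.le) _) (hpos k le_rfl)).le
  · obtain ⟨g, s, hg, hlim⟩ := exists_test_metrics hn (by omega) hkn hα1.le g₀ hflat hu hu' p hv
      hv4
    have hN : (n : ℝ) - 2 * l ≠ 0 := by
      have : 2 * (l : ℝ) < n := by exact_mod_cast hln
      linarith
    have hk := hlim k hkn
    have hl := hlim l hln
    rw [← htot] at hk hl
    have hq := (continuous_coe_real_ereal.tendsto _).comp (tendsto_quotient (hpos l hlk.le) hN hk hl)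
    refine ge_of_tendsto hq ?_
    filter_upwards [hg] with t ht
    exact iInf₂_le (g t) ht
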